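/- All Banach spaces are real. Let $\mathcal D$ be the set of dyadic intervals $[\frac{i}{2^k},\frac{i+1}{2^k})$, $k\ge 0$, $0\le i<2^k$, and let $\mathcal D_k$ and $\mathcal D_{\le k}$ be the sets of those of length $2^{-k}$ and at least $2^{-k}$, respectively. For $I\in\mathcal D$ let $I^+$, $I^-$ be its left and right halves and $h_I=\chi_{I^+}-\chi_{I^-}$. Put $h_\varnothing=\chi_{[0,1)}$, $\mathcal D^+=\mathcal D\cup\{\varnothing\}$, $\iota(\varnothing)=0$, $\iota([\frac{i}{2^k},\frac{i+1}{2^k}))=2^k+i$, and $H=\operatorname{span}\{h_I\}_{I\in\mathcal D^+}$. Let $r_n=\sum_{I\in\mathcal D_n}h_I$, $n\ge 0$, be the standard Rademacher functions. Let $\|\cdot\|_X$ be a norm on $H$ such that $\|f\|_X=\|g\|_X$ whenever $|f|$ and $|g|$ have the same distribution, and $\|\chi_{[0,1)}\|_X=1$. Let $\mathbf r=(r_I)_{I\in\mathcal D^+}$ be either the independent family $(r_{\iota(I)})_{I\in\mathcal D^+}$ or the constant family $(r_0)_{I\in\mathcal D^+}$, and let $X(\mathbf r)$ be the completion of $H$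 under $$\Bigl\|\sum_{I\in\mathcal D^+}a_Ih_I\Bigr\|_{X(\mathbf r)}=\Bigl\|s\mapsto\int_0^1\Bigl|\sum_{I\in\mathcal D^+}r_I(u)a_Ih_I(s)\Bigr|\,du\Bigr\|_X .$$ Let $Y=X_0(\mathbf r)$ be the closure of $\operatorname{span}\{h_I\}_{I\in\mathcal D}$ in $X(\mathbf r)$ (a Haar system Hardy space). Let $(\tau_n)_{n\ge 0}$ be pairwise disjoint subsets of $\{0,1,2,\dots\}$ with $|\tau_n|=n+1$. For each $n$, let $k_0<\dots<k_n$ be the elements of $\tau_n$ and define $(h_I^n)_{I\in\mathcal D_{\le n}}$ inductively by $\mathcal B_{[0,1)}=\mathcal D_{k_0}$, $\mathcal B_{I^\pm}=\{K\in\mathcal D_{k_{j+1}}: K\subset\{h_I^n=\pm1\}\}$ for $I\in\mathcal D_j$, $0\le j<n$, and $h_I^n=\sum_{K\in\mathcal B_I}h_K$. Let $Y_\omega$ be the closure in $Y$ of the span of all $h_I^n$, $n\ge0$, $I\in\mathcal D_{\le n}$. Order the pairs $(n,I)$ by $(n,I)\prec(m,J)$ iff $n<m$, or $n=m$ and $\iota(I)<\iota(J)$.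 **Theorem.** Assume that the sequence $(r_n)_{n\ge0}$ is weakly null in $Y$. Then: 1. $Y_\omega$ has the primary factorization property: for every bounded linear operator $T$ on $Y_\omega$ there are bounded linear operators $A,B$ on $Y_\omega$ with $ATB=I_{Y_\omega}$ or with $A(I_{Y_\omega}-T)B=I_{Y_\omega}$. 2. $(h_I^n)_{(n,I)}$, in the order $\prec$, is a Schauder basis of $Y_\omega$ and has the factorization property: if $T$ is a bounded linear operator on $Y_\omega$ with $\inf_{(n,I)}|\langle (h_I^n)^*,Th_I^n\rangle|>0$, where $(h_I^n)^*$ are the coordinate functionals of the basis, then there are bounded linear operators $A,B$ on $Y_\omega$ with $ATB=I_{Y_\omega}$. 3. The set $\mathcal M_{Y_\omega}$ of all bounded linear operators $T$ on $Y_\omega$ such that $I_{Y_\omega}\ne ATB$ for all bounded linear operators $A,B$ on $Y_\omega$ is the largest proper two-sided ideal of the algebra of bounded linear operators on $Y_\omega$. -/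

import Mathlib

open MeasureTheory Set Filter Topology

noncomputable section

/-! ### DyadicInterval intervals and the Haar system on `[0,1)` -/

/-- The dyadic interval `[i/2^k, (i+1)/2^k)`, `0 ≤ i < 2^k`, recorded as the pair `⟨k, i⟩`. -/
abbrev DyadicInterval := Σ k : ℕ, Fin (2 ^ k)

namespace DyadicInterval

/-- The dyadic interval as a subset of the real line. -/
def toSet (I : DyadicInterval) : Set ℝ := Ico ((I.2 : ℝ) / 2 ^ I.1) (((I.2 : ℝ) + 1) / 2 ^ I.1)

/-- The left half `I⁺` of `I`. -/
def left (I : DyadicInterval) : DyadicInterval :=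
  ⟨I.1 + 1, ⟨2 * I.2, by have := I.2.isLt; rw [pow_succ]; omega⟩⟩

/-- The right half `I⁻` of `I`. -/
def right (I : DyadicInterval) : DyadicInterval :=
  ⟨I.1 + 1, ⟨2 * I.2 + 1, by have := I.2.isLt; rw [pow_succ]; omega⟩⟩

/-- The set `𝒟_n` of dyadic intervals of length `2^{-n}`. -/
def level (n : ℕ) : Finset DyadicInterval :=
  Finset.univ.map (Function.Embedding.sigmaMk (β := fun k => Fin (2 ^ k)) n)

end DyadicInterval

/-- The enumeration `ι` of `𝒟⁺ = 𝒟 ∪ {∅}` (`none` stands for `∅`). -/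
def dyadicIndex : Option DyadicInterval → ℕ
  | none => 0
  | some I => 2 ^ I.1 + I.2

/-- The Haar functions `h_I = χ_{I⁺} - χ_{I⁻}` and `h_∅ = χ_{[0,1)}`. -/
def haarFun : Option DyadicInterval → ℝ → ℝ
  | none => indicator (Ico 0 1) 1
  | some I => fun s => indicator I.left.toSet 1 s - indicator I.right.toSet 1 s

/-- The standard Rademacher functions `r_n = ∑_{I ∈ 𝒟_n} h_I`. -/
def rademacher (n : ℕ) : ℝ → ℝ := fun u => ∑ I ∈ DyadicInterval.level n, haarFun (some I) u

/-- `H`, the linear span of the Haar system `(h_I)_{I ∈ 𝒟⁺}`. -/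
def haarSpan : Submodule ℝ (ℝ → ℝ) := Submodule.span ℝ (range haarFun)

/-! ### `H` consists of the dyadic step functions, and the Haar system is a basis of it -/

/-- `f` vanishes off `[0,1)` and is constant on the dyadic intervals of length `2^{-n}`. -/
def IsDyadicStep (n : ℕ) (f : ℝ → ℝ) : Prop :=
  (∀ s, s ∉ Ico (0 : ℝ) 1 → f s = 0) ∧
    ∀ s ∈ Ico (0 : ℝ) 1, ∀ t ∈ Ico (0 : ℝ) 1, ⌊(2 : ℝ) ^ n * s⌋₊ = ⌊(2 : ℝ) ^ n * t⌋₊ → f s = f t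

theorem DyadicInterval.mem_toSet_iff (I : DyadicInterval) (s : ℝ) :
    s ∈ I.toSet ↔ s ∈ Ico (0 : ℝ) 1 ∧ ⌊(2 : ℝ) ^ I.1 * s⌋₊ = (I.2 : ℕ) := by
  obtain ⟨k, i⟩ := I
  have hk : (0 : ℝ) < 2 ^ k := by positivity
  have hi : ((i : ℕ) : ℝ) + 1 ≤ 2 ^ k := by
    have := i.isLt
    exact_mod_cast this
  simp only [DyadicInterval.toSet, mem_Ico]
  rw [div_le_iff₀ hk, lt_div_iff₀ hk]
  constructor
  · rintro ⟨h1, h2⟩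
    have h0 : 0 ≤ s := by
      by_contra h
      have : s * 2 ^ k < 0 := mul_neg_of_neg_of_pos (not_le.1 h) hk
      have : (0 : ℝ) ≤ (i : ℕ) := Nat.cast_nonneg _
      linarith
    refine ⟨⟨h0, ?_⟩, ?_⟩
    · by_contra h
      have : (2 : ℝ) ^ k ≤ s * 2 ^ k := by nlinarith
      linarith
    · rw [Nat.floor_eq_iff (by positivity)]
      constructor <;> linarith
  · rintro ⟨⟨h0, _⟩, h⟩
    rw [Nat.floor_eq_iff (by positivity)] at h
    constructor <;> linarith [h.1, h.2]

theorem isDyadicStep_mono {m n : ℕ} (hmn : m ≤ n) {f : ℝ → ℝ} (hf : IsDyadicStep m f) :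
    IsDyadicStep n f := by
  refine ⟨hf.1, fun s hs t ht h => hf.2 s hs t ht ?_⟩
  obtain ⟨d, rfl⟩ := Nat.exists_eq_add_of_le hmn
  have key : ∀ x : ℝ, ⌊(2 : ℝ) ^ m * x⌋₊ = ⌊(2 : ℝ) ^ (m + d) * x⌋₊ / 2 ^ d := by
    intro x
    rw [← Nat.floor_div_natCast]
    congr 1
    push_cast
    field_simp
    ring
  rw [key, key, h]

theorem isDyadicStep_toSet (I : DyadicInterval) : IsDyadicStep I.1 (indicator I.toSet 1) := by
  refine ⟨fun s hs => indicator_of_notMem (fun h => hs ((I.mem_toSet_iff s).1 h).1) _, ?_⟩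
  intro s hs t ht h
  have : s ∈ I.toSet ↔ t ∈ I.toSet := by
    rw [I.mem_toSet_iff, I.mem_toSet_iff, h]
    simp [hs, ht]
  by_cases hm : s ∈ I.toSet
  · rw [indicator_of_mem hm, indicator_of_mem (this.1 hm)]; rfl
  · rw [indicator_of_notMem hm, indicator_of_notMem (fun h' => hm (this.2 h'))]

theorem IsDyadicStep.add {n : ℕ} {f g : ℝ → ℝ} (hf : IsDyadicStep n f) (hg : IsDyadicStep n g) :
    IsDyadicStep n (f + g) :=
  ⟨fun s hs => by simp [hf.1 s hs, hg.1 s hs],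
    fun s hs t ht h => by simp [hf.2 s hs t ht h, hg.2 s hs t ht h]⟩

theorem IsDyadicStep.smul {n : ℕ} {f : ℝ → ℝ} (c : ℝ) (hf : IsDyadicStep n f) :
    IsDyadicStep n (c • f) :=
  ⟨fun s hs => by simp [hf.1 s hs], fun s hs t ht h => by simp [hf.2 s hs t ht h]⟩

/-- The generation of `h_I`: it is a dyadic step function at this level. -/
def haarGen : Option DyadicInterval → ℕ
  | none => 0
  | some I => I.1 + 1

theorem isDyadicStep_haarFun (I : Option DyadicInterval) : IsDyadicStep (haarGen I) (haarFun I) := by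
  cases I with
  | none =>
    refine ⟨fun s hs => indicator_of_notMem hs _, fun s hs t ht _ => ?_⟩
    simp [haarFun, indicator_of_mem hs, indicator_of_mem ht]
  | some I =>
    have h1 := isDyadicStep_toSet I.left
    have h2 := (isDyadicStep_toSet I.right).smul (-1)
    have h3 := h1.add h2
    have : haarFun (some I) = indicator I.left.toSet 1 + (-1 : ℝ) • indicator I.right.toSet 1 := by
      funext s
      simp [haarFun, sub_eq_add_neg]
    rw [this]
    exact h3

theorem toSet_eq_union (I : DyadicInterval) (s : ℝ) :
    (indicator I.toSet 1 s : ℝ) = indicator I.left.toSet 1 s + indicator I.right.toSet 1 s := by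
  have key : ⌊(2 : ℝ) ^ I.1 * s⌋₊ = ⌊(2 : ℝ) ^ (I.1 + 1) * s⌋₊ / 2 := by
    have := Nat.floor_div_natCast ((2 : ℝ) ^ (I.1 + 1) * s) 2
    rw [← this]
    congr 1
    push_cast
    rw [pow_succ]
    ring
  have h0 := I.mem_toSet_iff s
  have h1 := I.left.mem_toSet_iff s
  have h2 := I.right.mem_toSet_iff s
  simp only [DyadicInterval.left, DyadicInterval.right] at h1 h2
  simp only [indicator, DyadicInterval.left, DyadicInterval.right, Pi.one_apply, h0, h1, h2]
  by_cases hs : s ∈ Ico (0 : ℝ) 1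
  · simp only [hs, true_and, key]
    split_ifs <;> first | (exfalso; omega) | norm_num
  · simp [hs]

theorem indicator_toSet_mem (I : DyadicInterval) : indicator I.toSet (1 : ℝ → ℝ) ∈ haarSpan := by
  obtain ⟨k, i⟩ := I
  induction k with
  | zero =>
    have : indicator (DyadicInterval.toSet ⟨0, i⟩) (1 : ℝ → ℝ) = haarFun none := by
      have hi : (i : ℕ) = 0 := by have := i.isLt; simp only [pow_zero] at this; omega
      simp [haarFun, DyadicInterval.toSet]
    rw [this]
    exact Submodule.subset_span ⟨none, rfl⟩
  | succ k ih =>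
    have hj : (i : ℕ) / 2 < 2 ^ k := by have := i.isLt; have h2 := pow_succ 2 k; omega
    set J : DyadicInterval := ⟨k, ⟨(i : ℕ) / 2, hj⟩⟩
    have hJm : indicator J.toSet (1 : ℝ → ℝ) ∈ haarSpan := ih _
    have hH : haarFun (some J) ∈ haarSpan := Submodule.subset_span ⟨some J, rfl⟩
    rcases Nat.mod_two_eq_zero_or_one (i : ℕ) with h | h
    · have hI : (⟨k + 1, i⟩ : DyadicInterval) = J.left := by
        refine congrArg (Sigma.mk (k + 1)) (Fin.ext ?_)
        change (i : ℕ) = 2 * ((i : ℕ) / 2)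
        omega
      have : indicator (DyadicInterval.toSet ⟨k + 1, i⟩) (1 : ℝ → ℝ)
          = (1 / 2 : ℝ) • (indicator J.toSet (1 : ℝ → ℝ) + haarFun (some J)) := by
        funext s
        rw [hI]
        simp only [Pi.smul_apply, Pi.add_apply, toSet_eq_union J s, haarFun, smul_eq_mul]
        ring
      rw [this]
      exact haarSpan.smul_mem _ (haarSpan.add_mem hJm hH)
    · have hI : (⟨k + 1, i⟩ : DyadicInterval) = J.right := by
        refine congrArg (Sigma.mk (k + 1)) (Fin.ext ?_)
        change (i : ℕ) = 2 * ((i : ℕ) / 2) + 1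
        omega
      have : indicator (DyadicInterval.toSet ⟨k + 1, i⟩) (1 : ℝ → ℝ)
          = (1 / 2 : ℝ) • (indicator J.toSet (1 : ℝ → ℝ) - haarFun (some J)) := by
        funext s
        rw [hI]
        simp only [Pi.smul_apply, Pi.sub_apply, toSet_eq_union J s, haarFun, smul_eq_mul]
        ring
      rw [this]
      exact haarSpan.smul_mem _ (haarSpan.sub_mem hJm hH)

theorem IsDyadicStep.eq_sum {n : ℕ} {f : ℝ → ℝ} (hf : IsDyadicStep n f) :
    f = ∑ i : Fin (2 ^ n), f ((i : ℝ) / 2 ^ n) • indicator (DyadicInterval.toSet ⟨n, i⟩) (1 : ℝ → ℝ) := by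
  funext s
  rw [Finset.sum_apply]
  simp only [Pi.smul_apply, smul_eq_mul]
  by_cases hs : s ∈ Ico (0 : ℝ) 1
  · have hn : (0 : ℝ) < 2 ^ n := by positivity
    have hlt : ⌊(2 : ℝ) ^ n * s⌋₊ < 2 ^ n := by
      rw [Nat.floor_lt (mul_nonneg hn.le hs.1)]
      push_cast
      nlinarith [hs.2]
    rw [Finset.sum_eq_single (⟨⌊(2 : ℝ) ^ n * s⌋₊, hlt⟩ : Fin (2 ^ n))]
    · rw [indicator_of_mem (((DyadicInterval.mem_toSet_iff _ s)).2 ⟨hs, rfl⟩)]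
      simp only [Pi.one_apply, mul_one]
      refine hf.2 s hs _ ⟨by positivity, ?_⟩ ?_
      · rw [div_lt_one hn]
        exact_mod_cast hlt
      · rw [mul_div_cancel₀ _ hn.ne', Nat.floor_natCast]
    · intro j _ hj
      rw [indicator_of_notMem, mul_zero]
      intro h
      exact hj (Fin.ext ((DyadicInterval.mem_toSet_iff _ s).1 h).2.symm)
    · simp
  · rw [hf.1 s hs]
    symm
    refine Finset.sum_eq_zero fun i _ => ?_
    rw [(isDyadicStep_toSet ⟨n, i⟩).1 s hs, mul_zero]

theorem mem_haarSpan_iff (f : ℝ → ℝ) : f ∈ haarSpan ↔ ∃ n, IsDyadicStep n f := by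
  constructor
  · intro h
    induction h using Submodule.span_induction with
    | mem x hx =>
      obtain ⟨I, rfl⟩ := hx
      exact ⟨_, isDyadicStep_haarFun I⟩
    | zero => exact ⟨0, fun _ _ => rfl, fun _ _ _ _ _ => rfl⟩
    | add x y _ _ hx hy =>
      obtain ⟨m, hm⟩ := hx
      obtain ⟨n, hn⟩ := hy
      exact ⟨max m n, (isDyadicStep_mono (le_max_left _ _) hm).add
        (isDyadicStep_mono (le_max_right _ _) hn)⟩
    | smul c x _ hx =>
      obtain ⟨m, hm⟩ := hx
      exact ⟨m, hm.smul c⟩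
  · rintro ⟨n, hn⟩
    rw [hn.eq_sum]
    exact Submodule.sum_mem _ fun i _ => Submodule.smul_mem _ _ (indicator_toSet_mem _)

theorem haarFun_left_endpoint (J : DyadicInterval) :
    ∃ x ∈ Ico (0 : ℝ) 1, ∃ y ∈ Ico (0 : ℝ) 1,
      haarFun (some J) x = 1 ∧ haarFun (some J) y = -1 ∧
      ⌊(2 : ℝ) ^ J.1 * x⌋₊ = (J.2 : ℕ) ∧ ⌊(2 : ℝ) ^ J.1 * y⌋₊ = (J.2 : ℕ) := by
  have ne : ∀ K : DyadicInterval, ∃ x, x ∈ K.toSet := fun K =>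
    ⟨(K.2 : ℝ) / 2 ^ K.1, le_rfl, by gcongr; linarith⟩
  obtain ⟨x, hx⟩ := ne J.left
  obtain ⟨y, hy⟩ := ne J.right
  have hx' := (J.left.mem_toSet_iff x).1 hx
  have hy' := (J.right.mem_toSet_iff y).1 hy
  have hxr : x ∉ J.right.toSet := by
    intro h
    have := ((J.right.mem_toSet_iff x).1 h).2
    have h2 := hx'.2
    simp only [DyadicInterval.left, DyadicInterval.right] at this h2
    omega
  have hyl : y ∉ J.left.toSet := by
    intro h
    have := ((J.left.mem_toSet_iff y).1 h).2
    have h2 := hy'.2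
    simp only [DyadicInterval.left, DyadicInterval.right] at this h2
    omega
  have hxJ : (indicator J.toSet 1 x : ℝ) = 1 := by
    rw [toSet_eq_union, indicator_of_mem hx, indicator_of_notMem hxr]; simp
  have hyJ : (indicator J.toSet 1 y : ℝ) = 1 := by
    rw [toSet_eq_union, indicator_of_mem hy, indicator_of_notMem hyl]; simp
  refine ⟨x, hx'.1, y, hy'.1, ?_, ?_, ?_, ?_⟩
  · simp [haarFun, hx, hxr]
  · simp [haarFun, hy, hyl]
  · refine ((J.mem_toSet_iff x).1 ?_).2
    by_contra h
    simp [h] at hxJ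
  · refine ((J.mem_toSet_iff y).1 ?_).2
    by_contra h
    simp [h] at hyJ

theorem linearIndependent_haarFun : LinearIndependent ℝ haarFun := by
  rw [linearIndependent_iff]
  intro l hl
  by_contra hne
  have hval : ∀ s, ∑ I ∈ l.support, l I * haarFun I s = 0 := by
    intro s
    have := congrFun hl s
    simpa [Finsupp.linearCombination_apply, Finsupp.sum, Finset.sum_apply] using this
  obtain ⟨M, hM, hmax⟩ :=
    Finset.exists_max_image l.support haarGen (Finsupp.support_nonempty_iff.2 hne)
  have hM0 : l M ≠ 0 := Finsupp.mem_support_iff.1 hM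
  cases M with
  | none =>
    have h := hval 0
    rw [Finset.sum_eq_single none] at h
    · have h1 : haarFun none 0 = 1 := by simp [haarFun]
      rw [h1, mul_one] at h
      exact hM0 h
    · intro I hI hIn
      have := hmax I hI
      cases I with
      | none => exact absurd rfl hIn
      | some I => simp [haarGen] at this
    · intro h
      exact absurd hM h
  | some J =>
    obtain ⟨x, hx, y, hy, hx1, hy1, hxJ, hyJ⟩ := haarFun_left_endpoint J
    have h : ∑ I ∈ l.support, l I * (haarFun I x - haarFun I y) = 0 := by
      have := congrArg₂ (· - ·) (hval x) (hval y)
      simp only [sub_zero] at this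
      rw [← this, ← Finset.sum_sub_distrib]
      exact Finset.sum_congr rfl fun I _ => by ring
    rw [Finset.sum_eq_single (some J)] at h
    · rw [hx1, hy1] at h
      norm_num at h
      exact hM0 h
    · intro I hI hIn
      have hle := hmax I hI
      simp only [haarGen] at hle
      have : haarFun I x = haarFun I y := by
        rcases Nat.lt_or_ge (haarGen I) (J.1 + 1) with hlt | hge
        · exact (isDyadicStep_mono (Nat.lt_succ_iff.1 hlt) (isDyadicStep_haarFun I)).2 x hx y hy
            (hxJ.trans hyJ.symm)
        · cases I with
          | none => simp [haarGen] at hge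
          | some I =>
            obtain ⟨k, i⟩ := I
            obtain ⟨k', j⟩ := J
            simp only [haarGen] at hge hle
            obtain rfl : k = k' := by omega
            have hij : (i : ℕ) ≠ j := fun h => hIn (by rw [Fin.ext h])
            have hz : ∀ z : ℝ, ⌊(2 : ℝ) ^ k * z⌋₊ = (j : ℕ) → haarFun (some ⟨k, i⟩) z = 0 := by
              intro z hz
              have h0 : z ∉ DyadicInterval.toSet ⟨k, i⟩ := by
                rw [DyadicInterval.mem_toSet_iff]
                rintro ⟨_, h⟩
                exact hij (h.symm.trans hz)
              have h1 := toSet_eq_union ⟨k, i⟩ z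
              rw [indicator_of_notMem h0] at h1
              have ha : (0 : ℝ) ≤ indicator (DyadicInterval.left ⟨k, i⟩).toSet 1 z :=
                indicator_nonneg (fun _ _ => zero_le_one) _
              have hb : (0 : ℝ) ≤ indicator (DyadicInterval.right ⟨k, i⟩).toSet 1 z :=
                indicator_nonneg (fun _ _ => zero_le_one) _
              simp only [haarFun]
              linarith
            rw [hz x hxJ, hz y hyJ]
      rw [this, sub_self, mul_zero]
    · intro h
      exact absurd hM h

/-- The Haar system as a basis of the vector space `H`. -/
def haarBasis : Module.Basis (Option DyadicInterval) ℝ haarSpan :=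
  Module.Basis.span linearIndependent_haarFun

/-! ### Haar system spaces -/

/-- A norm on `H` which defines a Haar system space: it depends only on the distribution of
the absolute value of a function (with respect to Lebesgue measure on `[0,1)`),
and `χ_{[0,1)}` has norm one. -/
structure HaarSystemNorm extends Seminorm ℝ haarSpan where
  eq_zero_of_norm_eq_zero : ∀ f : haarSpan, toFun f = 0 → f = 0
  norm_eq_of_map_eq : ∀ f g : haarSpan,
    Measure.map (fun s => |(f : ℝ → ℝ) s|) (volume.restrict (Ico (0 : ℝ) 1)) =
      Measure.map (fun s => |(g : ℝ → ℝ) s|) (volume.restrict (Ico (0 : ℝ) 1)) →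
    toFun f = toFun g
  norm_one : toFun (haarBasis none) = 1

/-- Haar system norms are monotone in `|f|`. -/
theorem HaarSystemNorm.mono (X : HaarSystemNorm) (f g : haarSpan)
    (h : ∀ s, |(f : ℝ → ℝ) s| ≤ |(g : ℝ → ℝ) s|) : X.toSeminorm f ≤ X.toSeminorm g := by
  obtain ⟨m, hm⟩ := (mem_haarSpan_iff _).1 f.2
  obtain ⟨n, hn⟩ := (mem_haarSpan_iff _).1 g.2
  replace hm := isDyadicStep_mono (le_max_left m n) hm
  replace hn := isDyadicStep_mono (le_max_right m n) hn
  generalize max m n = N at hm hn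
  let e : Fin (2 ^ N) → haarSpan := fun i => ⟨_, indicator_toSet_mem ⟨N, i⟩⟩
  let p : Fin (2 ^ N) → ℝ := fun i => (i : ℝ) / 2 ^ N
  let F : (Fin (2 ^ N) → ℝ) →ₗ[ℝ] haarSpan :=
    ∑ i, (LinearMap.proj i : (Fin (2 ^ N) → ℝ) →ₗ[ℝ] ℝ).smulRight ((g : ℝ → ℝ) (p i) • e i)
  have hF : ∀ v, F v = ∑ i, v i • (g : ℝ → ℝ) (p i) • e i := by
    intro v
    simp [F]
  have hFs : ∀ v s, (F v : ℝ → ℝ) s =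
      ∑ i, v i * ((g : ℝ → ℝ) (p i) * indicator (DyadicInterval.toSet ⟨N, i⟩) 1 s) := by
    intro v s
    rw [hF]
    simp [e, Finset.sum_apply]
  have hgs : ∀ s, (g : ℝ → ℝ) s =
      ∑ i, (g : ℝ → ℝ) (p i) * indicator (DyadicInterval.toSet ⟨N, i⟩) 1 s := by
    intro s
    have := congrFun hn.eq_sum s
    rw [this, Finset.sum_apply]
    simp [p]
  have hpm : ∀ i, p i ∈ Ico (0 : ℝ) 1 := by
    intro i
    refine ⟨by positivity, ?_⟩
    rw [div_lt_one (by positivity)]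
    exact_mod_cast i.isLt
  have hdisj : ∀ s (i j : Fin (2 ^ N)), s ∈ DyadicInterval.toSet ⟨N, i⟩ → s ∈ DyadicInterval.toSet ⟨N, j⟩ →
      i = j := by
    intro s i j hi hj
    exact Fin.ext ((((DyadicInterval.mem_toSet_iff _ s).1 hi).2).symm.trans
      ((DyadicInterval.mem_toSet_iff _ s).1 hj).2)
  have hsub : convexHull ℝ (univ.pi fun _ : Fin (2 ^ N) => ({-1, 1} : Set ℝ)) ⊆
      F ⁻¹' (X.toSeminorm.closedBall 0 (X.toSeminorm g)) := by
    refine convexHull_min ?_ ((X.toSeminorm.convex_closedBall 0 _).linear_preimage F)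
    intro v hv
    rw [mem_preimage, Seminorm.mem_closedBall, sub_zero]
    refine le_of_eq (X.norm_eq_of_map_eq _ _ ?_)
    congr 1
    funext s
    rw [hFs, hgs s]
    by_cases hs : ∃ i, s ∈ DyadicInterval.toSet ⟨N, i⟩
    · obtain ⟨i, hi⟩ := hs
      have h0 : ∀ j, j ≠ i → (indicator (DyadicInterval.toSet ⟨N, j⟩) 1 s : ℝ) = 0 := fun j hj =>
        indicator_of_notMem (fun h' => hj (hdisj s j i h' hi)) _
      rw [Finset.sum_eq_single i (fun j _ hj => by rw [h0 j hj]; simp) (by simp),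
        Finset.sum_eq_single i (fun j _ hj => by rw [h0 j hj]; simp) (by simp), abs_mul]
      have : |v i| = 1 := by
        rcases hv i (mem_univ i) with h' | h'
        · rw [h']; simp
        · rw [mem_singleton_iff.1 h']; simp
      rw [this, one_mul]
    · push Not at hs
      rw [Finset.sum_eq_zero fun i _ => by rw [indicator_of_notMem (hs i)]; simp,
        Finset.sum_eq_zero fun i _ => by rw [indicator_of_notMem (hs i)]; simp]
  let v : Fin (2 ^ N) → ℝ := fun i => (f : ℝ → ℝ) (p i) / (g : ℝ → ℝ) (p i)
  have hv : v ∈ convexHull ℝ (univ.pi fun _ : Fin (2 ^ N) => ({-1, 1} : Set ℝ)) := by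
    rw [convexHull_pi]
    intro i _
    rw [convexHull_pair, segment_eq_Icc (by norm_num)]
    change v i ∈ Icc (-1 : ℝ) 1
    rw [mem_Icc, ← abs_le, abs_div]
    exact div_le_one_of_le₀ (h _) (abs_nonneg _)
  have hfF : F v = f := by
    ext s
    rw [hFs, congrFun hm.eq_sum s, Finset.sum_apply]
    refine Finset.sum_congr rfl fun i _ => ?_
    simp only [Pi.smul_apply, smul_eq_mul, v]
    rw [← mul_assoc]
    congr 1
    by_cases hg : (g : ℝ → ℝ) (p i) = 0
    · have : (f : ℝ → ℝ) (p i) = 0 := by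
        have := h (p i)
        rw [hg, abs_zero] at this
        exact abs_nonpos_iff.1 this
      rw [hg, mul_zero]
      exact this.symm
    · exact div_mul_cancel₀ _ hg
  have := hsub hv
  rwa [mem_preimage, Seminorm.mem_closedBall, sub_zero, hfF] at this

/-! ### Haar system Hardy spaces -/

/-- The set `ℛ`, consisting of the independent family `(r_{ι(I)})_{I ∈ 𝒟⁺}` and of the
constant family `(r_0)_{I ∈ 𝒟⁺}`. -/
def rademacherFamilies : Set (Option DyadicInterval → ℝ → ℝ) :=
  {fun I => rademacher (dyadicIndex I), fun _ => rademacher 0}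

/-- For `f = ∑ a_I h_I`, the function `s ↦ ∫₀¹ |∑ r_I(u) a_I h_I(s)| du`. -/
def hardyFun (r : Option DyadicInterval → ℝ → ℝ) (f : haarSpan) : ℝ → ℝ :=
  fun s => ∫ u in (0 : ℝ)..1, |(haarBasis.repr f).sum fun I a => r I u * a * haarFun I s|

theorem hardyFun_mem (r : Option DyadicInterval → ℝ → ℝ) (f : haarSpan) : hardyFun r f ∈ haarSpan := by
  rw [mem_haarSpan_iff]
  refine ⟨(haarBasis.repr f).support.sup haarGen, ?_, ?_⟩
  · intro s hs
    have h0 : ∀ I, haarFun I s = 0 := fun I => (isDyadicStep_haarFun I).1 s hs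
    simp [hardyFun, h0]
  · intro s hs t ht h
    have h0 : ∀ I ∈ (haarBasis.repr f).support, haarFun I s = haarFun I t := fun I hI =>
      (isDyadicStep_mono (Finset.le_sup hI) (isDyadicStep_haarFun I)).2 s hs t ht h
    simp only [hardyFun, Finsupp.sum]
    congr 1
    funext u
    congr 1
    exact Finset.sum_congr rfl fun I hI => by rw [h0 I hI]

theorem intervalIntegrable_rademacher (n : ℕ) :
    IntervalIntegrable (rademacher n) volume 0 1 := by
  have hind : ∀ I : DyadicInterval, Integrable (indicator I.toSet (1 : ℝ → ℝ)) := by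
    intro I
    refine (integrable_indicator_iff measurableSet_Ico).2 ?_
    exact (integrableOn_const_iff (C := (1 : ℝ))).2 (Or.inr measure_Ico_lt_top)
  have : Integrable (rademacher n) :=
    integrable_finsetSum _ fun I _ => (hind I.left).sub (hind I.right)
  exact this.intervalIntegrable

theorem hardyFun_add_le (r : rademacherFamilies) (f g : haarSpan) (s : ℝ) :
    hardyFun r (f + g) s ≤ hardyFun r f s + hardyFun r g s := by
  have hr : ∀ I, IntervalIntegrable (r.1 I) volume 0 1 := by
    intro I
    rcases r.2 with h | h
    · rw [h]; exact intervalIntegrable_rademacher _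
    · rw [mem_singleton_iff.1 h]; exact intervalIntegrable_rademacher _
  have hi : ∀ a : Option DyadicInterval →₀ ℝ, IntervalIntegrable
      (fun u => |a.sum fun I a => r.1 I u * a * haarFun I s|) volume 0 1 := by
    intro a
    refine IntervalIntegrable.abs ?_
    simp only [Finsupp.sum]
    have := IntervalIntegrable.sum (μ := volume) (a := (0 : ℝ)) (b := 1) a.support
      (f := fun I u => r.1 I u * a I * haarFun I s)
      (fun I _ => ((hr I).mul_const _).mul_const _)
    have he : (∑ I ∈ a.support, fun u => r.1 I u * a I * haarFun I s) =
        fun u => ∑ I ∈ a.support, r.1 I u * a I * haarFun I s := by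
      funext u
      rw [Finset.sum_apply]
    rwa [he] at this
  simp only [hardyFun]
  rw [← intervalIntegral.integral_add (hi _) (hi _)]
  refine intervalIntegral.integral_mono_on zero_le_one (hi _) ((hi _).add (hi _)) ?_
  intro u _
  rw [map_add, Finsupp.sum_add_index' (by simp) (by intros; ring)]
  exact abs_add_le _ _

theorem hardyFun_smul (r : rademacherFamilies) (c : ℝ) (f : haarSpan) (s : ℝ) :
    hardyFun r (c • f) s = |c| * hardyFun r f s := by
  simp only [hardyFun]
  rw [← intervalIntegral.integral_const_mul]
  congr 1
  funext u
  rw [← abs_mul, map_smul, Finsupp.sum_smul_index' (by simp), Finsupp.mul_sum]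
  congr 1
  refine Finset.sum_congr rfl fun I _ => ?_
  simp only [smul_eq_mul]
  ring

theorem hardyFun_nonneg (r : Option DyadicInterval → ℝ → ℝ) (f : haarSpan) (s : ℝ) :
    0 ≤ hardyFun r f s :=
  intervalIntegral.integral_nonneg zero_le_one fun _ _ => abs_nonneg _

/-- The norm of `X(𝐫)` on `H`:
`‖∑ a_I h_I‖_{X(𝐫)} = ‖s ↦ ∫₀¹ |∑ r_I(u) a_I h_I(s)| du‖_X`. -/
def hardyNorm (X : HaarSystemNorm) (r : rademacherFamilies) : Seminorm ℝ haarSpan :=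
  Seminorm.of (fun f => X.toSeminorm ⟨hardyFun r f, hardyFun_mem r f⟩)
    (fun f g => by
      refine le_trans (X.mono _ (⟨hardyFun r f, hardyFun_mem r f⟩ +
        ⟨hardyFun r g, hardyFun_mem r g⟩) ?_) (map_add_le_add X.toSeminorm _ _)
      intro s
      simp only [Submodule.coe_add, Pi.add_apply]
      rw [abs_of_nonneg (hardyFun_nonneg _ _ _),
        abs_of_nonneg (add_nonneg (hardyFun_nonneg _ _ _) (hardyFun_nonneg _ _ _))]
      exact hardyFun_add_le r f g s)
    (fun c f => by
      have : (⟨hardyFun r (c • f), hardyFun_mem r _⟩ : haarSpan) =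
          |c| • ⟨hardyFun r f, hardyFun_mem r f⟩ := by
        ext s
        exact hardyFun_smul r c f s
      rw [this, map_smul_eq_mul]
      simp)

/-- The space `H`, equipped with the norm of `X(𝐫)`. -/
def HardyPre (_X : HaarSystemNorm) (_r : rademacherFamilies) : Type := haarSpan

instance (X : HaarSystemNorm) (r : rademacherFamilies) : AddCommGroup (HardyPre X r) :=
  inferInstanceAs (AddCommGroup haarSpan)

instance (X : HaarSystemNorm) (r : rademacherFamilies) : Module ℝ (HardyPre X r) :=
  inferInstanceAs (Module ℝ haarSpan)

instance (X : HaarSystemNorm) (r : rademacherFamilies) : Norm (HardyPre X r) :=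
  ⟨fun f => hardyNorm X r f⟩

theorem hardyPre_core (X : HaarSystemNorm) (r : rademacherFamilies) :
    SeminormedSpace.Core ℝ (HardyPre X r) where
  norm_nonneg f := apply_nonneg (hardyNorm X r) f
  norm_smul c f := map_smul_eq_mul (hardyNorm X r) c f
  norm_triangle f g := map_add_le_add (hardyNorm X r) f g

instance (X : HaarSystemNorm) (r : rademacherFamilies) : SeminormedAddCommGroup (HardyPre X r) :=
  SeminormedAddCommGroup.ofCore (hardyPre_core X r)

instance (X : HaarSystemNorm) (r : rademacherFamilies) : NormedSpace ℝ (HardyPre X r) where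
  norm_smul_le c f := ((hardyPre_core X r).norm_smul c f).le

/-- The Haar system Hardy space `X(𝐫)`, the completion of `H` under the norm of `X(𝐫)`. -/
abbrev HardySpace (X : HaarSystemNorm) (r : rademacherFamilies) : Type :=
  UniformSpace.Completion (HardyPre X r)

/-- The canonical map from `H` to `X(𝐫)`. -/
def toHardy (X : HaarSystemNorm) (r : rademacherFamilies) : haarSpan →ₗ[ℝ] HardySpace X r :=
  (UniformSpace.Completion.toComplL (𝕜 := ℝ) (E := HardyPre X r)).toLinearMap

/-- The space `X_0(𝐫)`, the closure in `X(𝐫)` of `H_0 = span {h_I : I ∈ 𝒟}`. -/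
def hardyZero (X : HaarSystemNorm) (r : rademacherFamilies) : Submodule ℝ (HardySpace X r) :=
  (Submodule.span ℝ (range fun I : DyadicInterval => toHardy X r (haarBasis (some I)))).topologicalClosure

/-- The Haar function `h_I`, `I ∈ 𝒟`, as an element of `X_0(𝐫)`. -/
def haarVec (X : HaarSystemNorm) (r : rademacherFamilies) (I : DyadicInterval) : hardyZero X r :=
  ⟨toHardy X r (haarBasis (some I)),
    Submodule.le_topologicalClosure _ (Submodule.subset_span ⟨I, rfl⟩)⟩

/-- The standard Rademacher function `r_n = ∑_{I ∈ 𝒟_n} h_I` as an element of `X_0(𝐫)`. -/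
def rademacherVec (X : HaarSystemNorm) (r : rademacherFamilies) (n : ℕ) : hardyZero X r :=
  ∑ I ∈ DyadicInterval.level n, haarVec X r I

/-- A sequence in a real normed space is weakly null. -/
def IsWeaklyNull {E : Type*} [NormedAddCommGroup E] [NormedSpace ℝ E] (x : ℕ → E) : Prop :=
  ∀ φ : StrongDual ℝ E, Tendsto (fun n => φ (x n)) atTop (𝓝 0)

/-! ### Independent sums -/

/-- The index set `𝒟_ω` of pairs `(n, I)` with `n ∈ ℕ₀` and `I ∈ 𝒟_{≤ n}`. -/
def DyadicOmega : Type := {p : ℕ × DyadicInterval // p.2.1 ≤ p.1}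

/-- The pair `(n, ι(I))`, which determines `(n, I)`. -/
def dyadicOmegaKey (p : DyadicOmega) : ℕ ×ₗ ℕ := toLex (p.1.1, dyadicIndex (some p.1.2))

theorem dyadicIndex_some_injective : Function.Injective fun I : DyadicInterval => dyadicIndex (some I) := by
  rintro ⟨k, i⟩ ⟨l, j⟩ h
  simp only [dyadicIndex] at h
  have hi := i.isLt
  have hj := j.isLt
  have hkl : k = l := by
    rcases lt_trichotomy k l with hlt | heq | hlt
    · have := Nat.pow_le_pow_right (n := 2) (by norm_num) (Nat.succ_le_of_lt hlt)
      rw [pow_succ] at this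
      omega
    · exact heq
    · have := Nat.pow_le_pow_right (n := 2) (by norm_num) (Nat.succ_le_of_lt hlt)
      rw [pow_succ] at this
      omega
  subst hkl
  have : i = j := Fin.ext (by omega)
  rw [this]

theorem dyadicOmegaKey_injective : Function.Injective dyadicOmegaKey := by
  rintro ⟨⟨n, I⟩, hI⟩ ⟨⟨m, J⟩, hJ⟩ h
  have h' := toLex.injective h
  simp only [Prod.mk.injEq] at h'
  obtain ⟨rfl, h2⟩ := h'
  have := dyadicIndex_some_injective h2
  subst this
  rfl

/-- The linear order on `𝒟_ω`: `(n, I) ≺ (m, J)` iff `n < m`, or `n = m` and `ι(I) < ι(J)`. -/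
instance : LinearOrder DyadicOmega := LinearOrder.lift' dyadicOmegaKey dyadicOmegaKey_injective

theorem dyadicOmega_finite_Icc (a b : DyadicOmega) : (Icc a b).Finite := by
  have hfin : (⋃ n ∈ Finset.range (b.1.1 + 1), ⋃ k ∈ Finset.range (b.1.1 + 1),
      {p : DyadicOmega | p.1.1 = n ∧ p.1.2 ∈ DyadicInterval.level k}).Finite := by
    refine Set.Finite.biUnion (Finset.finite_toSet _) fun n _ =>
      Set.Finite.biUnion (Finset.finite_toSet _) fun k _ => ?_
    refine Set.Finite.of_finite_image (f := fun p : DyadicOmega => p.1)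
      (((Set.finite_singleton n).prod (Finset.finite_toSet (DyadicInterval.level k))).subset ?_)
      (Subtype.val_injective.injOn)
    rintro _ ⟨p, ⟨h1, h2⟩, rfl⟩
    exact ⟨h1, h2⟩
  refine hfin.subset ?_
  rintro p ⟨_, hp⟩
  have hle : p.1.1 ≤ b.1.1 := by
    have h : dyadicOmegaKey p ≤ dyadicOmegaKey b := hp
    rcases (Prod.Lex.le_iff).1 h with h | h
    · exact h.le
    · exact h.1.le
  have := p.2
  simp only [mem_iUnion, Finset.mem_range, mem_ofPred_eq]
  refine ⟨p.1.1, by omega, p.1.2.1, by omega, rfl, ?_⟩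
  exact Finset.mem_map.2 ⟨p.1.2.2, Finset.mem_univ _, rfl⟩

instance : LocallyFiniteOrder DyadicOmega := LocallyFiniteOrder.ofFiniteIcc dyadicOmega_finite_Icc

open Classical in
/-- The collections `ℬ_I` of the finite faithful Haar system with frequencies `k 0 < k 1 < ⋯`,
where `I = [i/2^j, (i+1)/2^j)` is given by `j` and `i`: `ℬ_{[0,1)} = 𝒟_{k 0}`, and
`ℬ_{I^±} = {K ∈ 𝒟_{k (j+1)} : K ⊆ [ĥ_I = ±1]}` for `I ∈ 𝒟_j`, where `ĥ_I = ∑_{L ∈ ℬ_I} h_L`.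
The interval `[i/2^{j+1}, (i+1)/2^{j+1})` is a half of `[⌊i/2⌋/2^j, (⌊i/2⌋+1)/2^j)`, the left one
(the half with sign `+`) iff `i` is even. -/
def faithfulBlock (k : ℕ → ℕ) : ℕ → ℕ → Finset DyadicInterval
  | 0, _ => DyadicInterval.level (k 0)
  | j + 1, i => (DyadicInterval.level (k (j + 1))).filter fun K =>
      ∀ s ∈ K.toSet, ∑ L ∈ faithfulBlock k j (i / 2), haarFun (some L) s = if Even i then 1 else -1

/-- The elements of a finite set of natural numbers in increasing order, counted from `0`. -/
def frequencies (t : Finset ℕ) (j : ℕ) : ℕ := Nat.nth (fun m => m ∈ t) j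

/-- The function `h_I^n`, as an element of `X_0(𝐫)`: the member with index `I` of the finite faithful
Haar system whose frequencies are the elements of `τ_n` in increasing order. -/
def omegaHaar (X : HaarSystemNorm) (r : rademacherFamilies) (τ : ℕ → Finset ℕ) (p : DyadicOmega) :
    hardyZero X r :=
  ∑ K ∈ faithfulBlock (frequencies (τ p.1.1)) p.1.2.1 p.1.2.2, haarVec X r K

/-- The independent sum `Y_ω` of `Y = X_0(𝐫)`: the closure in `Y` of the span of the `h_I^n`. -/
def independentSum (X : HaarSystemNorm) (r : rademacherFamilies) (τ : ℕ → Finset ℕ) :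
    Submodule ℝ (hardyZero X r) :=
  (Submodule.span ℝ (range (omegaHaar X r τ))).topologicalClosure

/-! ### Factorization -/

/-- The identity of `E` factors through `T`. -/
def IdFactorsThrough {E : Type*} [NormedAddCommGroup E] [NormedSpace ℝ E] (T : E →L[ℝ] E) : Prop :=
  ∃ A B : E →L[ℝ] E, A ∘L T ∘L B = ContinuousLinearMap.id ℝ E

/-- The primary factorization property of `E`. -/
def HasPrimaryFactorizationProperty (E : Type*) [NormedAddCommGroup E] [NormedSpace ℝ E] : Prop :=
  ∀ T : E →L[ℝ] E, IdFactorsThrough T ∨ IdFactorsThrough (ContinuousLinearMap.id ℝ E - T)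

/-- `T` has large diagonal with respect to the basis `b`. -/
def HasLargeDiagonal {β E : Type*} [NormedAddCommGroup E] [NormedSpace ℝ E]
    {L : SummationFilter β} (b : GeneralSchauderBasis β ℝ E L) (T : E →L[ℝ] E) : Prop :=
  ∃ δ : ℝ, 0 < δ ∧ ∀ j, δ ≤ |b.coord j (T (b.basis j))|

/-- The factorization property of the basis `b`. -/
def HasFactorizationProperty {β E : Type*} [NormedAddCommGroup E] [NormedSpace ℝ E]
    {L : SummationFilter β} (b : GeneralSchauderBasis β ℝ E L) : Prop :=
  ∀ T : E →L[ℝ] E, HasLargeDiagonal b T → IdFactorsThrough T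

/-- The set `ℳ_E` of all bounded operators through which the identity of `E` does not factor. -/
def nonFactoringOperators (E : Type*) [NormedAddCommGroup E] [NormedSpace ℝ E] :
    Set (E →L[ℝ] E) :=
  {T | ∀ A B : E →L[ℝ] E, ContinuousLinearMap.id ℝ E ≠ A ∘L T ∘L B}

/-- `M` is the largest proper two-sided ideal of the ring `R`. -/
def IsLargestIdeal {R : Type*} [Ring R] (M : Set R) : Prop :=
  ∃ J : TwoSidedIdeal R, (J : Set R) = M ∧ IsGreatest {J' : TwoSidedIdeal R | J' ≠ ⊤} J

end

/-!
The binary digits of `s` are independent fair bits, and `r_n`, `h_I` are simple functions of them.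
Since the norm of `X` depends on distributions only, the norm of a linear combination of the
vectors `h_I^n` can be computed on a finite cube: if `x` has the bits `x_{n,k}`, the interval with
the bits `x_{n,0}, …, x_{n,k-1}` is denoted by `I(x,n,k)`, and `ε` is a vector of random signs (or
constant), then `‖∑ c_{n,I} h_I^n‖` is the norm of `x ↦ 𝔼_ε |∑ ε_{n,k} x_{n,k} c_{n,I(x,n,k)}|`
(`norm_linearCombination_omegaHaar`). All further arguments use only this formula, through the
structure `IsOmegaModel`. In particular each block is a finite part of the Haar basis of `Y`, and
the blocks are independent.

The operators `A` and `B` come from couplings of two cubes. Let a set of dyadic intervals with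
signs be selected in one block. Along a path, the bits at the selected intervals, multiplied by the
signs, form a new path, which maps the selected intervals to dyadic intervals. The linear
combination in which `h_I` is replaced by the signed sum of the selected intervals with image `I`
is a conditional expectation of the original one, and averaging the coefficients over the selected
intervals with image `I` is a conditional expectation too; both are therefore contractions
(`BitCoupling.cubeHardyNorm_le_of_pullback`, `BitCoupling.cubeHardyNorm_le_of_pushforward`,
`IsOmegaModel.exists_selection_operators`). The matrix of `A T B` consists of signed averages of
the entries of `T`. Special couplings show that signed sums of disjoint Haar functions have norm at
most `1`, that the projections onto the levels are bounded, and that the vectors `h_I^n` form a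
Schauder basis (`IsOmegaModel.hasSum_coord`).

With random signs, the off-diagonal entries of `A T B` have mean zero, and their second moments are
bounded by weighted Hilbert-Schmidt sums of the entries of `T` between families of disjoint short
intervals. These sums are small (`IsOmegaModel.exists_entrySum_le`); depending on whether `‖χ_I‖`
stays away from zero, is comparable to `|I|`, or neither, one sums along rows, along columns, or
both. The diagonal entries are concentrated about the averages of the diagonal of `T` over the
layers of the selection (`expect_sq_diagonal_le`), and by the pigeonhole principle many layers have
almost the same average. Hence on some block `T` is almost scalar
(`IsOmegaModel.exists_almost_scalar`).

Weak nullity of the Rademacher functions enters as follows: by Mazur's theorem and averaging over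
cyclic shifts, the norm of `r_0 + ⋯ + r_{m-1}` is at most `κ m` for suitable `m`
(`exists_rademacherNorm_le`). A functional is thus small on all but boundedly many levels of each
block, and after removing these levels the chosen copies of different blocks are almost decoupled.
Choosing blocks inductively, `A T B` becomes a small perturbation of a multiple of the identity,
which is nonzero as soon as the diagonal averages of `T` are bounded below on sufficiently many
layers (`IsOmegaModel.idFactorsThrough_of_hasLargeAverages`).

This condition holds for `T` or `id - T` because the averages over a level add up to `1`
(`IsOmegaModel.hasLargeAverages_or_id_sub`), and for `T` or `-T` if the diagonal entries are
bounded away from zero because on half of the paths half of the entries have the same sign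
(`IsOmegaModel.hasLargeAverages_or_neg`). The statement about ideals is a formal consequence of the
primary factorization property (`isLargestIdeal_nonFactoringOperators`).
-/

open scoped BigOperators

noncomputable section

/-! ### Paths through the dyadic tree -/

namespace DyadicInterval

/-- The half of `I` selected by a bit: the left half for `false`, the right half for `true`. -/
def child (I : DyadicInterval) (b : Bool) : DyadicInterval := if b then I.right else I.left

theorem child_level (I : DyadicInterval) (b : Bool) : (I.child b).1 = I.1 + 1 := by
  cases b <;> rfl

theorem child_index (I : DyadicInterval) (b : Bool) :
    ((I.child b).2 : ℕ) = 2 * (I.2 : ℕ) + b.toNat := by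
  cases b <;> rfl

theorem ext_nat {I J : DyadicInterval} (h1 : I.1 = J.1) (h2 : (I.2 : ℕ) = J.2) : I = J := by
  obtain ⟨k, i⟩ := I
  obtain ⟨l, j⟩ := J
  obtain rfl : k = l := h1
  exact congrArg (Sigma.mk k) (Fin.ext h2)

theorem child_injective {I J : DyadicInterval} {b c : Bool} (h : I.child b = J.child c) :
    I = J ∧ b = c := by
  have h1 := congrArg (fun K : DyadicInterval => K.1) h
  have h2 := congrArg (fun K : DyadicInterval => (K.2 : ℕ)) h
  simp only [child_level, child_index] at h1 h2
  refine ⟨ext_nat (by omega) ?_, ?_⟩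
  · cases b <;> cases c <;> simp at h2 <;> omega
  · cases b <;> cases c <;> simp at h2 ⊢ <;> omega

/-- The dyadic interval of length `2^{-k}` reached from `[0,1)` by following the bits
`x 0, …, x (k-1)`. -/
def node (x : ℕ → Bool) : ℕ → DyadicInterval
  | 0 => ⟨0, ⟨0, by norm_num⟩⟩
  | k + 1 => (node x k).child (x k)

@[simp] theorem node_level (x : ℕ → Bool) (k : ℕ) : (node x k).1 = k := by
  induction k with
  | zero => rfl
  | succ k ih => rw [node, child_level, ih]

theorem node_congr {x y : ℕ → Bool} {k : ℕ} (h : ∀ i < k, x i = y i) : node x k = node y k := by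
  induction k with
  | zero => rfl
  | succ k ih =>
    rw [node, node, ih fun i hi => h i (by omega), h k (by omega)]

theorem node_inj {x y : ℕ → Bool} {k : ℕ} (h : node x k = node y k) : ∀ i < k, x i = y i := by
  induction k with
  | zero => intro i hi; omega
  | succ k ih =>
    rw [node, node] at h
    obtain ⟨h1, h2⟩ := child_injective h
    intro i hi
    rcases Nat.lt_succ_iff_lt_or_eq.1 hi with hi | rfl
    · exact ih h1 i hi
    · exact h2

theorem node_eq_iff {x y : ℕ → Bool} {k : ℕ} : node x k = node y k ↔ ∀ i < k, x i = y i :=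
  ⟨node_inj, node_congr⟩

theorem exists_node (I : DyadicInterval) : ∃ x, node x I.1 = I := by
  obtain ⟨k, i⟩ := I
  induction k with
  | zero =>
    refine ⟨fun _ => false, ext_nat rfl ?_⟩
    have := i.isLt
    simp only [pow_zero] at this
    change 0 = (i : ℕ)
    omega
  | succ k ih =>
    obtain ⟨x, hx⟩ := ih ⟨(i : ℕ) / 2, by have := i.isLt; have h2 := pow_succ 2 k; omega⟩
    refine ⟨fun j => if j < k then x j else decide ((i : ℕ) % 2 = 1), ?_⟩
    have h1 : node (fun j => if j < k then x j else decide ((i : ℕ) % 2 = 1)) k = node x k :=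
      node_congr fun j hj => by simp [hj]
    change (node _ k).child _ = _
    simp only at hx
    rw [h1, hx]
    refine ext_nat (by rw [child_level]) ?_
    rw [child_index]
    rcases Nat.mod_two_eq_zero_or_one (i : ℕ) with h | h <;> simp [h] <;> omega

/-- A path through the dyadic interval `I`. -/
def path (I : DyadicInterval) : ℕ → Bool := (exists_node I).choose

@[simp] theorem node_path (I : DyadicInterval) : node I.path I.1 = I := (exists_node I).choose_spec

theorem mem_level {I : DyadicInterval} {n : ℕ} : I ∈ level n ↔ I.1 = n := by
  constructor
  · intro h
    obtain ⟨i, _, rfl⟩ := Finset.mem_map.1 h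
    rfl
  · rintro rfl
    exact Finset.mem_map.2 ⟨I.2, Finset.mem_univ _, rfl⟩

theorem node_mem_level (x : ℕ → Bool) (k : ℕ) : node x k ∈ level k := mem_level.2 (node_level x k)

theorem card_level (n : ℕ) : (level n).card = 2 ^ n := by
  simp [level]

end DyadicInterval

open DyadicInterval

/-! ### Binary digits -/

/-- The value `1` or `-1` of a Haar function on the half selected by a bit. -/
def bitSign (b : Bool) : ℝ := if b then -1 else 1

@[simp] theorem bitSign_mul_self (b : Bool) : bitSign b * bitSign b = 1 := by
  cases b <;> simp [bitSign]

@[simp] theorem abs_bitSign (b : Bool) : |bitSign b| = 1 := by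
  cases b <;> simp [bitSign]

@[simp] theorem bitSign_not (b : Bool) : bitSign (!b) = -bitSign b := by
  cases b <;> simp [bitSign]

theorem bitSign_xor (a b : Bool) : bitSign (xor a b) = bitSign a * bitSign b := by
  cases a <;> cases b <;> simp [bitSign]

/-- The `k`-th binary digit of `s`, counted from `0`. -/
def binaryDigit (k : ℕ) (s : ℝ) : Bool := decide (⌊(2 : ℝ) ^ (k + 1) * s⌋₊ % 2 = 1)

theorem floor_two_pow_mul_div (k d : ℕ) (s : ℝ) :
    ⌊(2 : ℝ) ^ k * s⌋₊ = ⌊(2 : ℝ) ^ (k + d) * s⌋₊ / 2 ^ d := by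
  rw [← Nat.floor_div_natCast]
  congr 1
  push_cast
  field_simp
  ring

theorem mem_child_toSet (I : DyadicInterval) (b : Bool) (s : ℝ) :
    s ∈ (I.child b).toSet ↔ s ∈ I.toSet ∧ binaryDigit I.1 s = b := by
  have h := floor_two_pow_mul_div I.1 1 s
  rw [mem_toSet_iff, mem_toSet_iff, h, binaryDigit, child_index]
  have h1 : ⌊(2 : ℝ) ^ (I.child b).1 * s⌋₊ = ⌊(2 : ℝ) ^ (I.1 + 1) * s⌋₊ := by
    rw [child_level]
  rw [h1]
  generalize ⌊(2 : ℝ) ^ (I.1 + 1) * s⌋₊ = n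
  cases b
  · simp only [Bool.toNat_false, decide_eq_false_iff_not, and_assoc, pow_one]
    refine and_congr_right fun _ => ?_
    omega
  · simp only [Bool.toNat_true, decide_eq_true_eq, and_assoc, pow_one]
    refine and_congr_right fun _ => ?_
    omega

theorem mem_node_toSet (x : ℕ → Bool) (k : ℕ) (s : ℝ) :
    s ∈ (node x k).toSet ↔ s ∈ Ico (0 : ℝ) 1 ∧ ∀ i < k, binaryDigit i s = x i := by
  induction k with
  | zero => simp [node, toSet]
  | succ k ih =>
    rw [node, mem_child_toSet, ih, node_level]
    constructor
    · rintro ⟨⟨h0, h1⟩, h2⟩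
      refine ⟨h0, fun i hi => ?_⟩
      rcases Nat.lt_succ_iff_lt_or_eq.1 hi with hi | rfl
      · exact h1 i hi
      · exact h2
    · rintro ⟨h0, h1⟩
      exact ⟨⟨h0, fun i hi => h1 i (by omega)⟩, h1 k (by omega)⟩

/-- The binary digits of `s` form the path of dyadic intervals containing `s`. -/
theorem mem_toSet_iff_node (I : DyadicInterval) {s : ℝ} (hs : s ∈ Ico (0 : ℝ) 1) :
    s ∈ I.toSet ↔ I = node (fun k => binaryDigit k s) I.1 := by
  conv_lhs => rw [← node_path I]
  conv_rhs => lhs; rw [← node_path I]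
  rw [mem_node_toSet, node_eq_iff]
  simp only [hs, true_and]
  exact forall₂_congr fun i _ => eq_comm

theorem haarFun_some (I : DyadicInterval) {s : ℝ} (hs : s ∈ Ico (0 : ℝ) 1) :
    haarFun (some I) s =
      if I = node (fun k => binaryDigit k s) I.1 then bitSign (binaryDigit I.1 s) else 0 := by
  have h0 := mem_child_toSet I false s
  have h1 := mem_child_toSet I true s
  rw [show I.child false = I.left from rfl] at h0
  rw [show I.child true = I.right from rfl] at h1
  have h2 := mem_toSet_iff_node I hs
  by_cases h : s ∈ I.toSet
  · rw [if_pos (h2.1 h)]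
    cases hb : binaryDigit I.1 s <;> simp [haarFun, indicator, h0, h1, h, hb, bitSign]
  · rw [if_neg fun h' => h (h2.2 h')]
    simp [haarFun, indicator, h0, h1, h]

theorem rademacher_eq (n : ℕ) {s : ℝ} (hs : s ∈ Ico (0 : ℝ) 1) :
    rademacher n s = bitSign (binaryDigit n s) := by
  rw [rademacher, Finset.sum_eq_single (node (fun k => binaryDigit k s) n)]
  · rw [haarFun_some _ hs]
    simp
  · intro I hI hne
    rw [haarFun_some _ hs, if_neg]
    rw [mem_level.1 hI]
    exact hne
  · intro h
    exact absurd (node_mem_level _ _) h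

theorem measurable_binaryDigit (k : ℕ) : Measurable (binaryDigit k) := by
  have h : Measurable fun s : ℝ => ⌊(2 : ℝ) ^ (k + 1) * s⌋₊ :=
    Nat.measurable_floor.comp (measurable_const_mul _)
  exact (measurable_from_top (f := fun n : ℕ => decide (n % 2 = 1))).comp h

theorem volume_node (x : ℕ → Bool) (k : ℕ) :
    volume.real (node x k).toSet = ((2 : ℝ) ^ k)⁻¹ := by
  rw [toSet, Real.volume_real_Ico_of_le (by gcongr; linarith), ← sub_div, add_sub_cancel_left,
    one_div]
  congr 2
  exact node_level x k

/-! ### Uniform maps between finite cubes -/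

/-- A map between finite sets is uniform if it maps the uniform distribution to the uniform
distribution. -/
def IsUniform {α β : Type*} [Fintype α] [Fintype β] (π : α → β) : Prop :=
  ∀ f : β → ℝ, 𝔼 a, f (π a) = 𝔼 b, f b

theorem IsUniform.comp {α β γ : Type*} [Fintype α] [Fintype β] [Fintype γ] {ρ : β → γ}
    {π : α → β} (hρ : IsUniform ρ) (hπ : IsUniform π) : IsUniform (ρ ∘ π) := fun f =>
  (hπ (f ∘ ρ)).trans (hρ f)

theorem isUniform_of_bijective {α β : Type*} [Fintype α] [Fintype β] {π : α → β}
    (h : Function.Bijective π) : IsUniform π := fun _ =>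
  Fintype.expect_bijective π h _ _ fun _ => rfl

theorem isUniform_fst {α β : Type*} [Fintype α] [Fintype β] [Nonempty β] :
    IsUniform (Prod.fst : α × β → α) := by
  intro f
  rw [← Finset.univ_product_univ, Finset.expect_product]
  simp

theorem isUniform_snd {α β : Type*} [Fintype α] [Fintype β] [Nonempty α] :
    IsUniform (Prod.snd : α × β → β) := by
  intro f
  rw [← Finset.univ_product_univ, Finset.expect_product]
  simp

theorem expect_prod {α β : Type*} [Fintype α] [Fintype β] (f : α × β → ℝ) :
    𝔼 p, f p = 𝔼 a, 𝔼 b, f (a, b) := by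
  rw [← Finset.univ_product_univ, Finset.expect_product]

theorem xor_bijective {Q : Type*} (z : Q → Bool) :
    Function.Bijective fun x : Q → Bool => fun q => xor (x q) (z q) :=
  Function.Involutive.bijective fun x => by funext q; simp

/-- Restricting to a subset of the coordinates is a uniform map. -/
theorem isUniform_restrict {Q Q' : Type*} [Fintype Q] [Fintype Q'] [DecidableEq Q]
    [DecidableEq Q'] {j : Q → Q'}
    (hj : Function.Injective j) : IsUniform fun x : Q' → Bool => fun q => x (j q) := by
  intro f
  have h1 : ∀ z : Q → Bool, 𝔼 x : Q' → Bool, f (fun q => x (j q)) =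
      𝔼 x : Q' → Bool, f (fun q => xor (x (j q)) (z q)) := by
    intro z
    refine (Fintype.expect_bijective _ (xor_bijective (Function.extend j z fun _ => false)) _ _
      fun x => ?_).symm
    congr 1
    funext q
    simp only [hj.extend_apply]
  calc 𝔼 x : Q' → Bool, f (fun q => x (j q))
      = 𝔼 _z : Q → Bool, 𝔼 x : Q' → Bool, f (fun q => x (j q)) := by simp
    _ = 𝔼 z : Q → Bool, 𝔼 x : Q' → Bool, f (fun q => xor (x (j q)) (z q)) :=
        Finset.expect_congr rfl fun z _ => h1 z
    _ = 𝔼 x : Q' → Bool, 𝔼 z : Q → Bool, f (fun q => xor (x (j q)) (z q)) :=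
        Finset.expect_comm _ _ _
    _ = 𝔼 _x : Q' → Bool, 𝔼 z : Q → Bool, f z := by
        refine Finset.expect_congr rfl fun x _ => ?_
        refine Fintype.expect_bijective _ (xor_bijective fun q => x (j q)) _ _ fun z => ?_
        congr 1
        funext q
        rw [Bool.xor_comm]
    _ = 𝔼 z : Q → Bool, f z := by simp

/-- Flipping a bit preserves averages. -/
theorem expect_flip {Q : Type*} [Fintype Q] [DecidableEq Q] (q : Q) (f : (Q → Bool) → ℝ) :
    𝔼 x : Q → Bool, f (Function.update x q (!x q)) = 𝔼 x, f x := by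
  refine Fintype.expect_bijective _ (Function.Involutive.bijective fun x => ?_) _ _ fun _ => rfl
  simp

/-- A bit, read as a sign, is orthogonal to the functions which do not depend on it. -/
theorem expect_bitSign_mul_eq_zero {Q : Type*} [Fintype Q] [DecidableEq Q] (q : Q)
    (f : (Q → Bool) → ℝ) (hf : ∀ x, f (Function.update x q (!x q)) = f x) :
    𝔼 x : Q → Bool, bitSign (x q) * f x = 0 := by
  have h := expect_flip q fun x : Q → Bool => bitSign (x q) * f x
  simp only [Function.update_self, bitSign_not, hf, neg_mul, Finset.expect_neg_distrib] at h
  linarith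

/-! ### Binary digits are independent and uniform -/

theorem integral_binaryDigit_fin (m : ℕ) (g : (Fin m → Bool) → ℝ) :
    ∫ s in Ico (0 : ℝ) 1, g (fun q => binaryDigit q s) = 𝔼 x, g x := by
  have hmeas : Measurable fun s : ℝ => fun q : Fin m => binaryDigit q s :=
    measurable_pi_lambda _ fun q => measurable_binaryDigit q
  rw [← integral_map (φ := fun s : ℝ => fun q : Fin m => binaryDigit q s) hmeas.aemeasurable
    (measurable_of_finite g).aestronglyMeasurable]
  rw [integral_fintype (Integrable.of_finite), Fintype.expect_eq_sum_div_card, Finset.sum_div]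
  refine Finset.sum_congr rfl fun v _ => ?_
  have hv : (Measure.map (fun s : ℝ => fun q : Fin m => binaryDigit q s)
      (volume.restrict (Ico (0 : ℝ) 1))).real {v} = ((2 : ℝ) ^ m)⁻¹ := by
    rw [map_measureReal_apply hmeas (measurableSet_singleton _),
      measureReal_restrict_apply (hmeas (measurableSet_singleton _)),
      ← volume_node (fun k => if h : k < m then v ⟨k, h⟩ else false) m]
    congr 1
    ext s
    rw [mem_node_toSet]
    simp only [mem_inter_iff, mem_preimage, mem_singleton_iff, funext_iff]
    constructor
    · rintro ⟨h1, h2⟩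
      exact ⟨h2, fun i hi => by rw [dif_pos hi, ← h1 ⟨i, hi⟩]⟩
    · rintro ⟨h1, h2⟩
      exact ⟨fun i => by rw [h2 i i.2, dif_pos i.2], h1⟩
  rw [hv, smul_eq_mul]
  simp
  ring

/-- The binary digits at distinct positions are independent and uniformly distributed. -/
theorem integral_binaryDigit {Q : Type*} [Fintype Q] [DecidableEq Q] {i : Q → ℕ}
    (hi : Function.Injective i) (g : (Q → Bool) → ℝ) :
    ∫ s in Ico (0 : ℝ) 1, g (fun q => binaryDigit (i q) s) = 𝔼 x, g x := by
  set m := Finset.univ.sup i + 1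
  have hm : ∀ q, i q < m := fun q => Nat.lt_succ_of_le (Finset.le_sup (Finset.mem_univ q))
  have hj : Function.Injective fun q => (⟨i q, hm q⟩ : Fin m) := fun a b h =>
    hi (Fin.mk.inj_iff.1 h)
  rw [← isUniform_restrict hj g]
  exact integral_binaryDigit_fin m fun x => g fun q => x ⟨i q, hm q⟩

/-- The function on `[0,1)` whose value at `s` is the value of `f` at the binary digits of `s`
at the positions `i q`. -/
def digitFun {Q : Type*} (i : Q → ℕ) (f : (Q → Bool) → ℝ) : ℝ → ℝ :=
  indicator (Ico 0 1) fun s => f fun q => binaryDigit (i q) s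

theorem digitFun_mem {Q : Type*} [Fintype Q] (i : Q → ℕ) (f : (Q → Bool) → ℝ) :
    digitFun i f ∈ haarSpan := by
  rw [mem_haarSpan_iff]
  refine ⟨Finset.univ.sup i + 1, fun s hs => indicator_of_notMem hs _, fun s hs t ht h => ?_⟩
  rw [digitFun, indicator_of_mem hs, indicator_of_mem ht]
  congr 1
  funext q
  have hq : i q + 1 ≤ Finset.univ.sup i + 1 :=
    Nat.succ_le_succ (Finset.le_sup (f := i) (Finset.mem_univ q))
  obtain ⟨d, hd⟩ := Nat.exists_eq_add_of_le hq
  rw [binaryDigit, binaryDigit, floor_two_pow_mul_div (i q + 1) d s,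
    floor_two_pow_mul_div (i q + 1) d t, ← hd, h]

theorem map_digitFun {Q : Type*} [Fintype Q] [DecidableEq Q] {i : Q → ℕ}
    (hi : Function.Injective i) (f : (Q → Bool) → ℝ) {A : Set ℝ} (hA : MeasurableSet A) :
    Measure.map (fun s => |digitFun i f s|) (volume.restrict (Ico (0 : ℝ) 1)) A =
      ENNReal.ofReal (𝔼 x, indicator A 1 |f x|) := by
  have hd : Measurable fun s : ℝ => fun q : Q => binaryDigit (i q) s :=
    measurable_pi_lambda _ fun q => measurable_binaryDigit (i q)
  have hf : Measurable (digitFun i f) :=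
    ((measurable_of_finite f).comp hd).indicator measurableSet_Ico
  have hf' : Measurable fun s => |digitFun i f s| := continuous_abs.measurable.comp hf
  rw [Measure.map_apply hf' hA, ← integral_binaryDigit hi fun x => indicator A 1 |f x|,
    ← ofReal_measureReal, ← integral_indicator_one (hf' hA)]
  congr 1
  refine setIntegral_congr_fun measurableSet_Ico fun s hs => ?_
  by_cases h : |f fun q => binaryDigit (i q) s| ∈ A
  · rw [indicator_of_mem (by rw [mem_preimage, digitFun, indicator_of_mem hs]; exact h)]
    simp only [indicator_of_mem h, Pi.one_apply]
  · rw [indicator_of_notMem (by rw [mem_preimage, digitFun, indicator_of_mem hs]; exact h)]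
    simp only [indicator_of_notMem h]

/-! ### The norm of a Haar system space on functions on finite cubes -/

/-- The step function on `[0,1)` with the same distribution as a function on a finite cube. -/
def cubeEmbed (Q : Type*) [Fintype Q] : ((Q → Bool) → ℝ) →ₗ[ℝ] haarSpan where
  toFun f := ⟨digitFun (fun q => (Fintype.equivFin Q q : ℕ)) f, digitFun_mem _ f⟩
  map_add' f g := by
    ext s
    simp only [digitFun, indicator, Submodule.coe_add, Pi.add_apply]
    split_ifs <;> simp
  map_smul' c f := by
    ext s
    simp only [digitFun, indicator, Submodule.coe_smul, Pi.smul_apply, RingHom.id_apply]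
    split_ifs <;> simp

/-- The norm of a Haar system space, transported to the functions on a finite cube. -/
def cubeNorm (X : HaarSystemNorm) (Q : Type*) [Fintype Q] : Seminorm ℝ ((Q → Bool) → ℝ) :=
  X.toSeminorm.comp (cubeEmbed Q)

/-- The norm depends on the distribution only, hence not on the positions of the digits which are
used, and it is invariant under uniform maps. -/
theorem norm_digitFun (X : HaarSystemNorm) {Q Q' : Type*} [Fintype Q] [DecidableEq Q] [Fintype Q']
    [DecidableEq Q'] {i : Q → ℕ} (hi : Function.Injective i) {i' : Q' → ℕ}
    (hi' : Function.Injective i') {π : (Q → Bool) → (Q' → Bool)} (hπ : IsUniform π)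
    (f : (Q' → Bool) → ℝ) :
    X.toSeminorm ⟨digitFun i (f ∘ π), digitFun_mem _ _⟩ =
      X.toSeminorm ⟨digitFun i' f, digitFun_mem _ _⟩ := by
  refine X.norm_eq_of_map_eq _ _ (Measure.ext fun A hA => ?_)
  refine (map_digitFun hi _ hA).trans (Eq.trans ?_ (map_digitFun hi' _ hA).symm)
  exact congrArg _ (hπ fun x => indicator A 1 |f x|)

theorem equivFin_val_injective (Q : Type*) [Fintype Q] :
    Function.Injective fun q : Q => (Fintype.equivFin Q q : ℕ) := fun _ _ h =>
  (Fintype.equivFin Q).injective (Fin.ext h)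

theorem norm_digitFun_eq_cubeNorm (X : HaarSystemNorm) {Q : Type*} [Fintype Q] [DecidableEq Q]
    {i : Q → ℕ} (hi : Function.Injective i) (f : (Q → Bool) → ℝ) :
    X.toSeminorm ⟨digitFun i f, digitFun_mem _ _⟩ = cubeNorm X Q f :=
  norm_digitFun X hi (equivFin_val_injective Q) (isUniform_of_bijective Function.bijective_id) f

theorem cubeNorm_comp (X : HaarSystemNorm) {Q Q' : Type*} [Fintype Q] [DecidableEq Q]
    [Fintype Q'] [DecidableEq Q'] {π : (Q → Bool) → (Q' → Bool)} (hπ : IsUniform π)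
    (f : (Q' → Bool) → ℝ) : cubeNorm X Q (fun x => f (π x)) = cubeNorm X Q' f :=
  norm_digitFun X (equivFin_val_injective Q) (equivFin_val_injective Q') hπ f

theorem cubeNorm_mono (X : HaarSystemNorm) {Q : Type*} [Fintype Q] {f g : (Q → Bool) → ℝ}
    (h : ∀ x, |f x| ≤ |g x|) : cubeNorm X Q f ≤ cubeNorm X Q g := by
  refine X.mono _ _ fun s => ?_
  simp only [cubeEmbed, digitFun, indicator, LinearMap.coe_mk, AddHom.coe_mk]
  split_ifs
  · exact h _
  · simp

theorem cubeNorm_one (X : HaarSystemNorm) (Q : Type*) [Fintype Q] :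
    cubeNorm X Q (fun _ => 1) = 1 := by
  refine Eq.trans (congrArg X.toSeminorm (Subtype.ext ?_)) X.norm_one
  exact (congrArg Subtype.val (Module.Basis.span_apply linearIndependent_haarFun none)).symm

theorem cubeNorm_expect_le (X : HaarSystemNorm) {Q α : Type*} [Fintype Q] [Fintype α]
    [Nonempty α] {f : α → (Q → Bool) → ℝ} {C : ℝ} (h : ∀ a, cubeNorm X Q (f a) ≤ C) :
    cubeNorm X Q (fun x => 𝔼 a, f a x) ≤ C := by
  have hcard : (0 : ℝ) < Fintype.card α := by exact_mod_cast Fintype.card_pos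
  have he : (fun x => 𝔼 a, f a x) = ((Fintype.card α : ℝ)⁻¹) • ∑ a, f a := by
    funext x
    simp only [Fintype.expect_eq_sum_div_card, Pi.smul_apply, Finset.sum_apply, smul_eq_mul]
    ring
  rw [he, map_smul_eq_mul, Real.norm_eq_abs, abs_of_pos (inv_pos.2 hcard)]
  calc _ ≤ (Fintype.card α : ℝ)⁻¹ * ∑ a, cubeNorm X Q (f a) := by
        gcongr
        exact Finset.le_sum_of_subadditive _ (map_zero _).le (map_add_le_add _) _ _
    _ ≤ (Fintype.card α : ℝ)⁻¹ * ∑ _a : α, C := by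
        gcongr with a
        exact h a
    _ = C := by
        simp [hcard.ne']

/-- Averaging a function over part of the coordinates does not increase the norm. -/
theorem cubeNorm_average_le (X : HaarSystemNorm) {Q Q' : Type*} [Fintype Q] [DecidableEq Q]
    [Fintype Q'] [DecidableEq Q'] {R : Type*} [Fintype R] [DecidableEq R]
    {π : (Q → Bool) × (R → Bool) → (Q' → Bool)} (hπ : IsUniform π) (f : (Q' → Bool) → ℝ) :
    cubeNorm X Q (fun x => 𝔼 z, f (π (x, z))) ≤ cubeNorm X Q' f := by
  let sp : (Q ⊕ R → Bool) → (Q → Bool) × (R → Bool) := Equiv.sumArrowEquivProdArrow Q R Bool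
  have hsp : IsUniform sp := isUniform_of_bijective (Equiv.bijective _)
  -- On the larger cube `Q ⊕ R` the average over `z` becomes an average over translations by
  -- `z`, and translations preserve the norm.
  rw [← cubeNorm_comp X (isUniform_fst.comp hsp) fun x => 𝔼 z, f (π (x, z))]
  have h1 : ∀ w : Q ⊕ R → Bool, 𝔼 z : R → Bool, f (π ((sp w).1, z)) =
      𝔼 z : R → Bool, f (π (sp fun q => xor (w q) (Sum.elim (fun _ => false) z q))) := by
    intro w
    refine (Fintype.expect_bijective _ (xor_bijective (sp w).2) _ _ fun z => ?_).symm
    congr 2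
    refine Prod.ext ?_ ?_
    · funext q
      simp [sp]
    · funext q
      simp [sp, Bool.xor_comm]
  simp only [Function.comp_apply, h1]
  refine cubeNorm_expect_le X fun z => le_of_eq ?_
  exact cubeNorm_comp X ((hπ.comp hsp).comp (isUniform_of_bijective (xor_bijective _))) f

open DyadicInterval

/-! ### Couplings of finite cubes -/

/-- The sum `∑ p, η(ε p) x_p G_p(x)` over the coordinates of a finite cube, where the bits of `x`
and `ε` are read as signs; `η` is either the sign of a bit or constantly `1`. -/
def randomSum {Q : Type} [Fintype Q] (η : Bool → ℝ) (G : Q → (Q → Bool) → ℝ)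
    (x ε : Q → Bool) : ℝ := ∑ p, η (ε p) * bitSign (x p) * G p x

/-- The norm of the function `x ↦ 𝔼_ε |∑ p, η(ε p) x_p G_p(x)|` on a finite cube: for
predictable coefficients `G` this is the Haar system Hardy space norm. -/
def cubeHardyNorm (X : HaarSystemNorm) {Q : Type} [Fintype Q] [DecidableEq Q] (η : Bool → ℝ)
    (G : Q → (Q → Bool) → ℝ) : ℝ := cubeNorm X Q fun x => 𝔼 ε, |randomSum η G x ε|

theorem isUniform_elim {Q Q' R : Type} [Fintype Q] [Fintype Q'] [Fintype R] [DecidableEq Q]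
    [DecidableEq Q'] [DecidableEq R] {j : R → Q ⊕ Q'} (hj : Function.Injective j) :
    IsUniform fun w : (Q → Bool) × (Q' → Bool) => fun t => Sum.elim w.1 w.2 (j t) :=
  (isUniform_restrict hj).comp
    (isUniform_of_bijective (Equiv.sumArrowEquivProdArrow Q Q' Bool).symm.bijective)

/-- A coupling of the uniform distributions on two cubes: along a point `x` of the first cube
some coordinates `p` are assigned injectively to coordinates of the second cube. Whether and
where `p` is assigned may depend on the coordinates of `x` of lower rank only. The corresponding
coordinate of the second cube is `x p`, changed by `twist x p`. -/
structure BitCoupling (Q Q' : Type) where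
  pick : (Q → Bool) → Q → Option Q'
  twist : (Q → Bool) → Q → Bool
  rank : Q → ℕ
  predictable : ∀ x x' p, (∀ q, rank q < rank p → x q = x' q) →
    pick x p = pick x' p ∧ twist x p = twist x' p
  injective : ∀ x p q t, pick x p = some t → pick x q = some t → p = q

namespace BitCoupling

variable {Q Q' : Type} (c : BitCoupling Q Q')

open Classical in
/-- The point of the second cube coupled to `x`; the coordinates to which nothing is assigned
are taken from `z`. -/
def target (x : Q → Bool) (z : Q' → Bool) (t : Q') : Bool :=
  if h : ∃ p, c.pick x p = some t then xor (c.twist x h.choose) (x h.choose) else z t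

/-- The coordinates of `x` which are not assigned, completed by those coordinates of `z` which
are not used by `BitCoupling.target`. -/
def residue (x : Q → Bool) (z : Q' → Bool) (p : Q) : Bool :=
  match c.pick x p with
  | none => x p
  | some t => z t

theorem target_of_pick {x : Q → Bool} {p : Q} {t : Q'} (h : c.pick x p = some t) (z : Q' → Bool) :
    c.target x z t = xor (c.twist x p) (x p) := by
  have h' : ∃ p, c.pick x p = some t := ⟨p, h⟩
  rw [target, dif_pos h', c.injective x _ _ t h'.choose_spec h]

theorem target_of_not {x : Q → Bool} {t : Q'} (h : ¬∃ p, c.pick x p = some t) (z : Q' → Bool) :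
    c.target x z t = z t := dif_neg h

theorem residue_of_pick {x : Q → Bool} {p : Q} {t : Q'} (h : c.pick x p = some t)
    (z : Q' → Bool) : c.residue x z p = z t := by
  rw [residue, h]

theorem residue_of_none {x : Q → Bool} {p : Q} (h : c.pick x p = none)
    (z : Q' → Bool) : c.residue x z p = x p := by
  rw [residue, h]

/-- The exchange of the assigned coordinates between the two cubes. -/
def swap (w : (Q → Bool) × (Q' → Bool)) : (Q → Bool) × (Q' → Bool) :=
  (c.residue w.1 w.2, c.target w.1 w.2)

/-- The first component is recovered coordinate by coordinate, in the order of the rank. -/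
theorem swap_injective : Function.Injective c.swap := by
  rintro ⟨x, z⟩ ⟨x', z'⟩ h
  have hu : ∀ p, c.residue x z p = c.residue x' z' p := fun p => congrFun (congrArg Prod.fst h) p
  have hy : ∀ t, c.target x z t = c.target x' z' t := fun t => congrFun (congrArg Prod.snd h) t
  have hx : ∀ n p, c.rank p = n → x p = x' p := by
    intro n
    induction n using Nat.strong_induction_on with
    | _ n ih =>
      intro p hp
      -- By predictability `p` is assigned in the same way for both points, so `x p` can be
      -- read off from the residue or from the target.
      obtain ⟨h1, h2⟩ := c.predictable x x' p fun q hq => ih _ (hp ▸ hq) q rfl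
      cases hpick : c.pick x p with
      | none =>
        have := hu p
        rwa [c.residue_of_none hpick, c.residue_of_none (h1 ▸ hpick)] at this
      | some t =>
        have := hy t
        rwa [c.target_of_pick hpick, c.target_of_pick (h1 ▸ hpick), h2, Bool.xor_right_inj] at this
  obtain rfl : x = x' := funext fun p => hx _ p rfl
  have hz : z = z' := by
    funext t
    by_cases ht : ∃ p, c.pick x p = some t
    · obtain ⟨p, hp⟩ := ht
      have := hu p
      rwa [c.residue_of_pick hp, c.residue_of_pick hp] at this
    · have := hy t
      rwa [c.target_of_not ht, c.target_of_not ht] at this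
  rw [hz]

theorem swap_bijective [Finite Q] [Finite Q'] : Function.Bijective c.swap :=
  Finite.injective_iff_bijective.1 c.swap_injective

/-- The point of the first cube with residue `u` and target `y`. -/
def source [Finite Q] [Finite Q'] (u : Q → Bool) (y : Q' → Bool) : Q → Bool :=
  ((Equiv.ofBijective c.swap c.swap_bijective).symm (u, y)).1

theorem exists_swap_source [Finite Q] [Finite Q'] (u : Q → Bool) (y : Q' → Bool) :
    ∃ z, c.swap (c.source u y, z) = (u, y) :=
  ⟨((Equiv.ofBijective c.swap c.swap_bijective).symm (u, y)).2,
    (Equiv.ofBijective c.swap c.swap_bijective).apply_symm_apply (u, y)⟩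

theorem source_of_none [Finite Q] [Finite Q'] {u : Q → Bool} {y : Q' → Bool} {p : Q}
    (h : c.pick (c.source u y) p = none) : c.source u y p = u p := by
  obtain ⟨z, hz⟩ := c.exists_swap_source u y
  have : c.residue _ z p = u p := congrFun (congrArg Prod.fst hz) p
  rw [← this]
  exact (c.residue_of_none h z).symm

theorem source_of_pick [Finite Q] [Finite Q'] {u : Q → Bool} {y : Q' → Bool} {p : Q} {t : Q'}
    (h : c.pick (c.source u y) p = some t) :
    c.source u y p = xor (c.twist (c.source u y) p) (y t) := by
  obtain ⟨z, hz⟩ := c.exists_swap_source u y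
  have : c.target _ z t = y t := congrFun (congrArg Prod.snd hz) t
  rw [← this]
  rw [c.target_of_pick h z, ← Bool.xor_assoc, Bool.xor_self, Bool.false_xor]

/-- Changing the coordinate `p` of the residue changes only the coordinate `p` and coordinates of
larger rank of the point of the first cube. -/
theorem source_update [Finite Q] [Finite Q'] [DecidableEq Q] (u : Q → Bool) (y : Q' → Bool)
    (p : Q) (b : Bool) (q : Q) (hq : c.rank q ≤ c.rank p) (hqp : q ≠ p) :
    c.source (Function.update u p b) y q = c.source u y q := by
  have hx : ∀ n q, c.rank q = n → c.rank q ≤ c.rank p → q ≠ p →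
      c.source (Function.update u p b) y q = c.source u y q := by
    intro n
    induction n using Nat.strong_induction_on with
    | _ n ih =>
      intro q hn hq hqp
      obtain ⟨h1, h2⟩ := c.predictable (c.source (Function.update u p b) y) (c.source u y) q
        fun r hr => ih _ (hn ▸ hr) r rfl (by omega) (by rintro rfl; omega)
      cases hpick : c.pick (c.source u y) q with
      | none =>
        rw [c.source_of_none hpick, c.source_of_none (h1.trans hpick), Function.update_of_ne hqp]
      | some t => rw [c.source_of_pick hpick, c.source_of_pick (h1.trans hpick), h2]
  exact hx _ q rfl hq hqp

open Classical in
/-- Where a coordinate of the second cube comes from. -/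
def origin (x : Q → Bool) (t : Q') : Q ⊕ Q' :=
  if h : ∃ p, c.pick x p = some t then Sum.inl h.choose else Sum.inr t

theorem origin_of_pick {x : Q → Bool} {p : Q} {t : Q'} (h : c.pick x p = some t) :
    c.origin x t = Sum.inl p := by
  have h' : ∃ p, c.pick x p = some t := ⟨p, h⟩
  rw [origin, dif_pos h', c.injective x _ _ t h'.choose_spec h]

theorem origin_injective (x : Q → Bool) : Function.Injective (c.origin x) := by
  intro t t' h
  by_cases ht : ∃ p, c.pick x p = some t
  · obtain ⟨p, hp⟩ := ht
    rw [c.origin_of_pick hp] at h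
    by_cases ht' : ∃ p, c.pick x p = some t'
    · obtain ⟨p', hp'⟩ := ht'
      rw [c.origin_of_pick hp', Sum.inl.injEq] at h
      subst h
      rw [hp] at hp'
      exact Option.some.inj hp'
    · rw [origin, dif_neg ht'] at h
      exact absurd h (by simp)
  · by_cases ht' : ∃ p, c.pick x p = some t'
    · obtain ⟨p', hp'⟩ := ht'
      rw [c.origin_of_pick hp', origin, dif_neg ht] at h
      exact absurd h (by simp)
    · rw [origin, origin, dif_neg ht, dif_neg ht'] at h
      exact Sum.inr.inj h

/-- Where the sign attached to a coordinate of the first cube comes from. -/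
def destination (x : Q → Bool) (p : Q) : Q' ⊕ Q :=
  match c.pick x p with
  | none => Sum.inr p
  | some t => Sum.inl t

theorem destination_injective (x : Q → Bool) : Function.Injective (c.destination x) := by
  intro p q h
  simp only [destination] at h
  cases hp : c.pick x p with
  | none =>
    cases hq : c.pick x q with
    | none => simpa [hp, hq] using h
    | some t' => simp [hp, hq] at h
  | some t =>
    cases hq : c.pick x q with
    | none => simp [hp, hq] at h
    | some t' =>
      simp only [hp, hq, Sum.inl.injEq] at h
      subst h
      exact c.injective x p q t hp hq

variable [Fintype Q] [Fintype Q'] [DecidableEq Q] [DecidableEq Q']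

theorem isUniform_target : IsUniform fun w : (Q → Bool) × (Q' → Bool) => c.target w.1 w.2 :=
  isUniform_snd.comp (isUniform_of_bijective c.swap_bijective)

theorem isUniform_source : IsUniform fun w : (Q' → Bool) × (Q → Bool) => c.source w.2 w.1 :=
  isUniform_fst.comp ((isUniform_of_bijective
    (Equiv.ofBijective c.swap c.swap_bijective).symm.bijective).comp
      (isUniform_of_bijective (Equiv.prodComm _ _).bijective))

omit [DecidableEq Q] in
/-- The terms of the second cube which are not hit by the coupling average out; hence the sum
on the first cube is a conditional expectation of the sum on the second one. -/
theorem randomSum_eq_expect_target {η : Bool → ℝ} {G : Q → (Q → Bool) → ℝ}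
    {G' : Q' → (Q' → Bool) → ℝ}
    (hG' : ∀ t y, G' t (Function.update y t (!y t)) = G' t y)
    (hnone : ∀ x p, c.pick x p = none → G p x = 0)
    (hsome : ∀ x z p t, c.pick x p = some t →
      G p x = bitSign (c.twist x p) * G' t (c.target x z)) (x ε : Q → Bool) :
    randomSum η G x ε = 𝔼 z : Q' → Bool, 𝔼 ε' : Q' → Bool,
      randomSum η G' (c.target x z) fun t => Sum.elim ε ε' (c.origin x t) := by
  classical
  have key : ∀ t, 𝔼 z : Q' → Bool, 𝔼 ε' : Q' → Bool,
      η (Sum.elim ε ε' (c.origin x t)) * bitSign (c.target x z t) * G' t (c.target x z) =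
      ∑ p, if c.pick x p = some t then η (ε p) * bitSign (x p) * G p x else 0 := by
    intro t
    by_cases ht : ∃ p, c.pick x p = some t
    · obtain ⟨p, hp⟩ := ht
      rw [Finset.sum_eq_single p]
      · rw [if_pos hp]
        simp only [c.origin_of_pick hp, Sum.elim_inl]
        rw [Finset.expect_congr rfl (g := fun _ => η (ε p) * bitSign (x p) * G p x)]
        · simp
        · intro z _
          rw [Fintype.expect_const, c.target_of_pick hp, hsome x z p t hp, bitSign_xor]
          ring
      · intro q _ hq
        exact if_neg fun h => hq (c.injective x q p t h hp)
      · simp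
    · rw [Finset.sum_eq_zero fun p _ => if_neg fun h => ht ⟨p, h⟩, Finset.expect_comm]
      refine Finset.expect_eq_zero fun ε' _ => ?_
      -- If nothing is assigned to `t`, then flipping `z t` flips the coordinate `t` of the
      -- target, on which `G' t` does not depend.
      have h := expect_bitSign_mul_eq_zero t
        (fun z : Q' → Bool => η (ε' t) * G' t (c.target x z)) fun z => by
          have : c.target x (Function.update z t (!z t)) =
              Function.update (c.target x z) t (!c.target x z t) := by
            funext t'
            by_cases h' : t' = t
            · subst h'
              rw [c.target_of_not ht, c.target_of_not ht]
              simp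
            · rw [Function.update_of_ne h']
              by_cases ht' : ∃ p, c.pick x p = some t'
              · obtain ⟨p', hp'⟩ := ht'
                rw [c.target_of_pick hp', c.target_of_pick hp']
              · rw [c.target_of_not ht', c.target_of_not ht', Function.update_of_ne h']
          rw [this, hG']
      rw [← h]
      refine Finset.expect_congr rfl fun z _ => ?_
      rw [c.target_of_not ht, origin, dif_neg ht, Sum.elim_inr]
      ring
  simp only [randomSum, Finset.expect_sum_comm, key]
  rw [Finset.sum_comm]
  refine Finset.sum_congr rfl fun p _ => ?_
  cases hp : c.pick x p with
  | none => simp [hnone x p hp]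
  | some t => simp

/-- Coefficients transported from the second cube to the first one have a smaller norm. -/
theorem cubeHardyNorm_le_of_pullback (X : HaarSystemNorm) {η : Bool → ℝ}
    {G : Q → (Q → Bool) → ℝ} {G' : Q' → (Q' → Bool) → ℝ}
    (hG' : ∀ t y, G' t (Function.update y t (!y t)) = G' t y)
    (hnone : ∀ x p, c.pick x p = none → G p x = 0)
    (hsome : ∀ x z p t, c.pick x p = some t →
      G p x = bitSign (c.twist x p) * G' t (c.target x z)) :
    cubeHardyNorm X η G ≤ cubeHardyNorm X η G' := by
  refine le_trans (cubeNorm_mono X fun x => ?_)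
    (cubeNorm_average_le X c.isUniform_target fun y => 𝔼 δ, |randomSum η G' y δ|)
  rw [abs_of_nonneg (Finset.expect_nonneg fun _ _ => abs_nonneg _),
    abs_of_nonneg (Finset.expect_nonneg fun _ _ => Finset.expect_nonneg fun _ _ => abs_nonneg _)]
  calc 𝔼 ε, |randomSum η G x ε|
      ≤ 𝔼 ε : Q → Bool, 𝔼 z : Q' → Bool, 𝔼 ε' : Q' → Bool,
          |randomSum η G' (c.target x z) fun t => Sum.elim ε ε' (c.origin x t)| := by
        refine Finset.expect_le_expect fun ε _ => ?_
        rw [c.randomSum_eq_expect_target hG' hnone hsome x ε]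
        refine (Finset.abs_expect_le _ _).trans (Finset.expect_le_expect fun z _ => ?_)
        exact Finset.abs_expect_le _ _
    _ = 𝔼 z : Q' → Bool, 𝔼 ε : Q → Bool, 𝔼 ε' : Q' → Bool,
          |randomSum η G' (c.target x z) fun t => Sum.elim ε ε' (c.origin x t)| :=
        Finset.expect_comm _ _ _
    _ = 𝔼 z : Q' → Bool, 𝔼 δ, |randomSum η G' (c.target x z) δ| := by
        refine Finset.expect_congr rfl fun z _ => ?_
        rw [← isUniform_elim (c.origin_injective x) fun δ => |randomSum η G' (c.target x z) δ|,
          expect_prod]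
    _ ≤ _ := le_rfl

/-- The terms of the first cube which are not assigned average out; hence the sum on the second
cube is a conditional expectation of the sum on the first one. -/
theorem randomSum_eq_expect_source {η : Bool → ℝ} {G : Q → (Q → Bool) → ℝ}
    {G' : Q' → (Q' → Bool) → ℝ}
    (hG : ∀ p x x', (∀ q, c.rank q < c.rank p → x q = x' q) → G p x = G p x')
    (hG' : ∀ t y, G' t y = 𝔼 u : Q → Bool, ∑ p, if c.pick (c.source u y) p = some t then
      bitSign (c.twist (c.source u y) p) * G p (c.source u y) else 0) (y δ : Q' → Bool) :
    randomSum η G' y δ = 𝔼 u : Q → Bool, 𝔼 ε' : Q → Bool,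
      randomSum η G (c.source u y) fun p => Sum.elim δ ε' (c.destination (c.source u y) p) := by
  -- The summand of `p` is split according to whether `p` is assigned.
  have key : ∀ (u ε' : Q → Bool) p,
      η (Sum.elim δ ε' (c.destination (c.source u y) p)) * bitSign (c.source u y p) *
        G p (c.source u y) =
      bitSign (u p) * (if c.pick (c.source u y) p = none then η (ε' p) * G p (c.source u y)
        else 0) + ∑ t, η (δ t) * bitSign (y t) * if c.pick (c.source u y) p = some t then
          bitSign (c.twist (c.source u y) p) * G p (c.source u y) else 0 := by
    intro u ε' p
    cases hp : c.pick (c.source u y) p with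
    | none =>
      simp only [destination, hp, c.source_of_none hp, Sum.elim_inr, if_true, reduceCtorEq,
        if_false, mul_zero, Finset.sum_const_zero, add_zero]
      ring
    | some t =>
      simp only [destination, hp, c.source_of_pick hp, Sum.elim_inl, reduceCtorEq, if_false,
        mul_zero, zero_add, Option.some.injEq, bitSign_xor, mul_ite, Finset.sum_ite_eq,
        Finset.mem_univ, if_true]
      ring
  -- If `p` is not assigned, the summand contains the sign of `u p`, and the other factors
  -- depend on coordinates of smaller rank only.
  have hzero : ∀ (ε' : Q → Bool) p, 𝔼 u : Q → Bool, bitSign (u p) *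
      (if c.pick (c.source u y) p = none then η (ε' p) * G p (c.source u y) else 0) = 0 := by
    intro ε' p
    refine expect_bitSign_mul_eq_zero p (fun u : Q → Bool => if c.pick (c.source u y) p = none
      then η (ε' p) * G p (c.source u y) else 0) fun u => ?_
    have h : ∀ q, c.rank q < c.rank p →
        c.source (Function.update u p (!u p)) y q = c.source u y q := fun q hq =>
      c.source_update u y p _ q hq.le (by rintro rfl; exact lt_irrefl _ hq)
    rw [(c.predictable _ _ p h).1, hG p _ _ h]
  simp only [randomSum, key]
  simp only [Finset.sum_add_distrib, Finset.expect_add_distrib, Fintype.expect_const]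
  rw [Finset.expect_comm]
  simp only [Finset.expect_sum_comm, hzero, Finset.sum_const_zero, Finset.expect_const_zero,
    zero_add]
  rw [Finset.sum_comm]
  refine Finset.sum_congr rfl fun t _ => ?_
  rw [hG', Finset.mul_expect]
  simp only [Finset.mul_sum, Finset.expect_sum_comm]

/-- Conditional averages, transported from the first cube to the second one, have a smaller
norm. -/
theorem cubeHardyNorm_le_of_pushforward (X : HaarSystemNorm) {η : Bool → ℝ}
    {G : Q → (Q → Bool) → ℝ} {G' : Q' → (Q' → Bool) → ℝ}
    (hG : ∀ p x x', (∀ q, c.rank q < c.rank p → x q = x' q) → G p x = G p x')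
    (hG' : ∀ t y, G' t y = 𝔼 u : Q → Bool, ∑ p, if c.pick (c.source u y) p = some t then
      bitSign (c.twist (c.source u y) p) * G p (c.source u y) else 0) :
    cubeHardyNorm X η G' ≤ cubeHardyNorm X η G := by
  refine le_trans (cubeNorm_mono X fun y => ?_)
    (cubeNorm_average_le X c.isUniform_source fun x => 𝔼 ε, |randomSum η G x ε|)
  rw [abs_of_nonneg (Finset.expect_nonneg fun _ _ => abs_nonneg _),
    abs_of_nonneg (Finset.expect_nonneg fun _ _ => Finset.expect_nonneg fun _ _ => abs_nonneg _)]
  calc 𝔼 δ, |randomSum η G' y δ|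
      ≤ 𝔼 δ : Q' → Bool, 𝔼 u : Q → Bool, 𝔼 ε' : Q → Bool, |randomSum η G (c.source u y)
          fun p => Sum.elim δ ε' (c.destination (c.source u y) p)| := by
        refine Finset.expect_le_expect fun δ _ => ?_
        rw [c.randomSum_eq_expect_source hG hG' y δ]
        refine (Finset.abs_expect_le _ _).trans (Finset.expect_le_expect fun u _ => ?_)
        exact Finset.abs_expect_le _ _
    _ = 𝔼 u : Q → Bool, 𝔼 δ : Q' → Bool, 𝔼 ε' : Q → Bool, |randomSum η G (c.source u y)
          fun p => Sum.elim δ ε' (c.destination (c.source u y) p)| :=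
        Finset.expect_comm _ _ _
    _ = 𝔼 u : Q → Bool, 𝔼 ε, |randomSum η G (c.source u y) ε| := by
        refine Finset.expect_congr rfl fun u _ => ?_
        rw [← isUniform_elim (c.destination_injective (c.source u y)) fun ε =>
          |randomSum η G (c.source u y) ε|, expect_prod]

end BitCoupling

/-! ### Coefficients on the independent blocks -/

/-- The index `(n, I)` of a block `n` and a dyadic interval `I` of level at most `n`. -/
def DyadicOmega.mk (n : ℕ) (I : DyadicInterval) (h : I.1 ≤ n) : DyadicOmega := Subtype.mk (n, I) h

theorem DyadicOmega.level_le (p : DyadicOmega) : p.1.2.1 ≤ p.1.1 := p.2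

theorem DyadicOmega.ext_iff' {p q : DyadicOmega} : p = q ↔ p.1.1 = q.1.1 ∧ p.1.2 = q.1.2 := by
  rw [← Prod.ext_iff]
  exact Subtype.ext_iff

/-- A finite family of coefficients on `𝒟_ω`, extended by zero to all pairs `(n, I)`. -/
def coefAt (c : DyadicOmega →₀ ℝ) (n : ℕ) (I : DyadicInterval) : ℝ :=
  if h : I.1 ≤ n then c (DyadicOmega.mk n I h) else 0

theorem coefAt_of_le (c : DyadicOmega →₀ ℝ) {n : ℕ} {I : DyadicInterval} (h : I.1 ≤ n) :
    coefAt c n I = c (DyadicOmega.mk n I h) := dif_pos h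

theorem coefAt_of_lt (c : DyadicOmega →₀ ℝ) {n : ℕ} {I : DyadicInterval} (h : n < I.1) :
    coefAt c n I = 0 := dif_neg (not_le.2 h)

theorem coefAt_self (c : DyadicOmega →₀ ℝ) (p : DyadicOmega) : coefAt c p.1.1 p.1.2 = c p :=
  dif_pos p.2

theorem coefAt_add (c d : DyadicOmega →₀ ℝ) (n : ℕ) (I : DyadicInterval) :
    coefAt (c + d) n I = coefAt c n I + coefAt d n I := by
  unfold coefAt
  split_ifs <;> simp

theorem coefAt_smul (a : ℝ) (c : DyadicOmega →₀ ℝ) (n : ℕ) (I : DyadicInterval) :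
    coefAt (a • c) n I = a * coefAt c n I := by
  unfold coefAt
  split_ifs <;> simp

open Classical in
theorem coefAt_single (p : DyadicOmega) (a : ℝ) (n : ℕ) (I : DyadicInterval) :
    coefAt (Finsupp.single p a) n I = if p.1.1 = n ∧ p.1.2 = I then a else 0 := by
  unfold coefAt
  by_cases h : I.1 ≤ n
  · rw [dif_pos h, Finsupp.single_apply]
    exact if_congr DyadicOmega.ext_iff' rfl rfl
  · rw [dif_neg h, if_neg]
    rintro ⟨rfl, rfl⟩
    exact h p.2

open Classical in
theorem coefAt_filter (c : DyadicOmega →₀ ℝ) (P : DyadicOmega → Prop) (Q : ℕ → DyadicInterval → Prop)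
    (hPQ : ∀ p, P p ↔ Q p.1.1 p.1.2) (n : ℕ) (I : DyadicInterval) :
    coefAt (c.filter P) n I = if Q n I then coefAt c n I else 0 := by
  unfold coefAt
  by_cases h : I.1 ≤ n
  · rw [dif_pos h, dif_pos h, Finsupp.filter_apply]
    exact if_congr (hPQ _) rfl rfl
  · simp [dif_neg h]

/-- The `n`-th row of a point of the cube with `M × M` coordinates, as an infinite path. -/
def row {M : ℕ} (x : Fin M × Fin M → Bool) (n : Fin M) : ℕ → Bool := fun i =>
  if h : i < M then x (n, ⟨i, h⟩) else false

theorem row_apply {M : ℕ} (x : Fin M × Fin M → Bool) (p : Fin M × Fin M) : row x p.1 p.2 = x p := by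
  simp [row]

theorem node_row_congr {M : ℕ} {x y : Fin M × Fin M → Bool} {p : Fin M × Fin M}
    (h : ∀ q : Fin M × Fin M, q.1 = p.1 → q.2 < p.2 → x q = y q) :
    node (row x p.1) p.2 = node (row y p.1) p.2 := by
  refine node_congr fun i hi => ?_
  have hM : i < M := hi.trans p.2.2
  simp only [row, dif_pos hM]
  exact h _ rfl hi

/-- The coefficients on the first `M` blocks as functions on the cube with `M × M` coordinates:
the coordinate `(n, k)` carries the coefficient of the interval of level `k` in the block `n`
through the given point. -/
def treeCoef (M : ℕ) (c : DyadicOmega →₀ ℝ) (p : Fin M × Fin M) (x : Fin M × Fin M → Bool) : ℝ :=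
  coefAt c p.1 (node (row x p.1) p.2)

theorem treeCoef_congr {M : ℕ} (c : DyadicOmega →₀ ℝ) {p : Fin M × Fin M}
    {x y : Fin M × Fin M → Bool} (h : ∀ q : Fin M × Fin M, (q.2 : ℕ) < p.2 → x q = y q) :
    treeCoef M c p x = treeCoef M c p y := by
  rw [treeCoef, treeCoef, node_row_congr fun q _ hq => h q hq]

theorem treeCoef_update {M : ℕ} (c : DyadicOmega →₀ ℝ) (p : Fin M × Fin M)
    (x : Fin M × Fin M → Bool) (b : Bool) :
    treeCoef M c p (Function.update x p b) = treeCoef M c p x := by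
  refine treeCoef_congr c fun q hq => Function.update_of_ne ?_ _ _
  rintro rfl
  exact lt_irrefl _ hq

/-- A family of vectors indexed by `𝒟_ω` with dense linear span whose linear combinations have
the norm of the corresponding sum of independent blocks. -/
structure IsOmegaModel (X : HaarSystemNorm) (η : Bool → ℝ) {E : Type} [NormedAddCommGroup E]
    [NormedSpace ℝ E] (e : DyadicOmega → E) : Prop where
  dense : DenseRange (Finsupp.linearCombination ℝ e)
  norm_eq : ∀ (c : DyadicOmega →₀ ℝ) (M : ℕ), (∀ p ∈ c.support, p.1.1 < M) →
    ‖Finsupp.linearCombination ℝ e c‖ = cubeHardyNorm X η (treeCoef M c)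
  abs_sign : ∀ b, |η b| = 1

/-- The norm of a point mass on a finite cube with `k` coordinates; it is the norm of the Haar
functions of level `k`. -/
def pointNorm (X : HaarSystemNorm) (k : ℕ) : ℝ :=
  cubeNorm X (Fin k) fun x => if x = fun _ => false then 1 else 0

theorem exists_block_bound (c : DyadicOmega →₀ ℝ) : ∃ M₀, ∀ M ≥ M₀, ∀ p ∈ c.support, p.1.1 < M :=
  ⟨c.support.sup (fun p => p.1.1) + 1, fun _ hM _ hp =>
    lt_of_lt_of_le (Nat.lt_succ_of_le (Finset.le_sup (f := fun p : DyadicOmega => p.1.1) hp)) hM⟩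

namespace IsOmegaModel

variable {X : HaarSystemNorm} {η : Bool → ℝ} {E : Type} [NormedAddCommGroup E] [NormedSpace ℝ E]
  {e : DyadicOmega → E} (he : IsOmegaModel X η e)

include he

/-- A linear map on the span of the vectors of a model extends to the closure. -/
theorem exists_extension {F : Type} [NormedAddCommGroup F] [NormedSpace ℝ F] [CompleteSpace F]
    (v : DyadicOmega → F) (C : ℝ) (h : ∀ c, ‖Finsupp.linearCombination ℝ v c‖ ≤
      C * ‖Finsupp.linearCombination ℝ e c‖) :
    ∃ A : E →L[ℝ] F, (∀ c, A (Finsupp.linearCombination ℝ e c) = Finsupp.linearCombination ℝ v c) ∧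
      ∀ x, ‖A x‖ ≤ C * ‖x‖ :=
  ⟨(Finsupp.linearCombination ℝ v).extendOfNorm (Finsupp.linearCombination ℝ e),
    fun c => LinearMap.extendOfNorm_eq he.dense ⟨C, h⟩ c,
    fun x => LinearMap.norm_extendOfNorm_apply_le he.dense C h x⟩

/-- An operator which is given by finitely supported columns and is contractive on finite
families of coefficients. -/
theorem exists_contraction [CompleteSpace E] (a : DyadicOmega → DyadicOmega →₀ ℝ)
    (h : ∀ (c : DyadicOmega →₀ ℝ) (M₀ : ℕ), ∃ M ≥ M₀,
      cubeHardyNorm X η (treeCoef M (Finsupp.linearCombination ℝ a c)) ≤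
        cubeHardyNorm X η (treeCoef M c)) :
    ∃ A : E →L[ℝ] E, (∀ c, A (Finsupp.linearCombination ℝ e c) =
      Finsupp.linearCombination ℝ e (Finsupp.linearCombination ℝ a c)) ∧ ∀ x, ‖A x‖ ≤ ‖x‖ := by
  have hlin : ∀ c, Finsupp.linearCombination ℝ (fun p => Finsupp.linearCombination ℝ e (a p)) c =
      Finsupp.linearCombination ℝ e (Finsupp.linearCombination ℝ a c) := by
    intro c
    simp only [Finsupp.linearCombination_apply ℝ c, Finsupp.sum, map_sum, map_smul]
  obtain ⟨A, hA, hA'⟩ := he.exists_extension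
    (fun p => Finsupp.linearCombination ℝ e (a p)) 1 fun c => by
      obtain ⟨M₁, h1⟩ := exists_block_bound c
      obtain ⟨M₂, h2⟩ := exists_block_bound (Finsupp.linearCombination ℝ a c)
      obtain ⟨M, hM, hle⟩ := h c (max M₁ M₂)
      rw [hlin, one_mul, he.norm_eq c M (h1 M ((le_max_left _ _).trans hM)),
        he.norm_eq _ M (h2 M ((le_max_right _ _).trans hM))]
      exact hle
  exact ⟨A, fun c => (hA c).trans (hlin c), fun x => by simpa using hA' x⟩

open Classical in
/-- The projection onto the levels in a set of coordinates which is closed under passing to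
lower levels of the same block is a conditional expectation. -/
theorem norm_restrict_le (D : ℕ → ℕ → Prop) (hD : ∀ n k k', k' ≤ k → D n k → D n k')
    (c d : DyadicOmega →₀ ℝ) (hd : ∀ p, D p.1.1 p.1.2.1 → d p = c p)
    (hd' : ∀ p, ¬D p.1.1 p.1.2.1 → d p = 0) :
    ‖Finsupp.linearCombination ℝ e d‖ ≤ ‖Finsupp.linearCombination ℝ e c‖ := by
  obtain rfl : d = c.filter fun p => D p.1.1 p.1.2.1 := by
    ext p
    rw [Finsupp.filter_apply]
    split_ifs with h
    exacts [hd p h, hd' p h]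
  obtain ⟨M, h1⟩ := exists_block_bound c
  rw [he.norm_eq c M (h1 M le_rfl), he.norm_eq _ M fun p hp =>
    h1 M le_rfl p (by rw [Finsupp.support_filter, Finset.mem_filter] at hp; exact hp.1)]
  -- The coordinates outside of `D` are resampled.
  let C : BitCoupling (Fin M × Fin M) (Fin M × Fin M) :=
    { pick := fun _ p => if D p.1 p.2 then some p else none
      twist := fun _ _ => false
      rank := fun p => p.2
      predictable := fun _ _ _ _ => ⟨rfl, rfl⟩
      injective := fun x p q t hp hq => by
        split_ifs at hp hq
        simp only [Option.some.injEq] at hp hq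
        rw [hp, hq] }
  have hfilter : ∀ p x, treeCoef M (c.filter fun p => D p.1.1 p.1.2.1) p x =
      if D p.1 p.2 then treeCoef M c p x else 0 := by
    intro p x
    rw [treeCoef, coefAt_filter c _ (fun n I => D n I.1) (fun _ => Iff.rfl), node_level]
    rfl
  refine C.cubeHardyNorm_le_of_pullback X (fun p x => treeCoef_update c p x _) ?_ ?_
  · intro x p hp
    rw [hfilter, if_neg]
    intro h
    simp [C, h] at hp
  · intro x z p t ht
    have hDp : D p.1 p.2 := by
      by_contra h
      simp [C, h] at ht
    obtain rfl : p = t := by simpa [C, hDp] using ht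
    rw [hfilter, if_pos hDp]
    simp only [C, bitSign, Bool.false_eq_true, if_false, one_mul]
    rw [treeCoef, treeCoef]
    congr 1
    refine node_row_congr fun q hq1 hq2 => ?_
    have hDq : D q.1 q.2 := by
      rw [hq1]
      exact hD _ _ _ (Fin.val_fin_le.2 hq2.le) hDp
    exact ((C.target_of_pick (p := q) (t := q) (by simp [C, hDq]) z).trans (by simp [C])).symm

/-- The norm of a family of coefficients on one level of one block. -/
theorem norm_level_eq (c : DyadicOmega →₀ ℝ) {n k M : ℕ} (hk : k < M) (hn : n < M)
    (hc : ∀ p ∈ c.support, p.1.1 = n ∧ p.1.2.1 = k) :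
    ‖Finsupp.linearCombination ℝ e c‖ = cubeNorm X (Fin M × Fin M) fun x =>
      |treeCoef M c (⟨n, hn⟩, ⟨k, hk⟩) x| := by
  rw [he.norm_eq c M fun p hp => by rw [(hc p hp).1]; exact hn, cubeHardyNorm]
  congr 1
  funext x
  have h : ∀ ε, |randomSum η (treeCoef M c) x ε| = |treeCoef M c (⟨n, hn⟩, ⟨k, hk⟩) x| := by
    intro ε
    rw [randomSum, Finset.sum_eq_single (⟨n, hn⟩, ⟨k, hk⟩)]
    · rw [abs_mul, abs_mul, he.abs_sign, abs_bitSign, one_mul, one_mul]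
    · intro p _ hp
      rw [treeCoef]
      by_cases hle : (node (row x p.1) p.2).1 ≤ p.1
      · rw [coefAt_of_le c hle]
        by_cases h0 : c (DyadicOmega.mk p.1 (node (row x p.1) p.2) hle) = 0
        · rw [h0, mul_zero]
        · obtain ⟨h1, h2⟩ := hc _ (Finsupp.mem_support_iff.2 h0)
          simp only [DyadicOmega.mk, node_level] at h1 h2
          exact absurd (Prod.ext (Fin.ext h1) (Fin.ext h2)) hp
      · rw [coefAt_of_lt c (not_le.1 hle), mul_zero]
    · simp
  simp [h]

/-- The sign of a single Haar function is irrelevant, so that the norm is that of the indicator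
function of its support. -/
theorem norm_basis (p : DyadicOmega) : ‖e p‖ = pointNorm X p.1.2.1 := by
  classical
  have hn : p.1.1 < p.1.1 + 1 := Nat.lt_succ_self _
  have hk : p.1.2.1 < p.1.1 + 1 := Nat.lt_succ_of_le p.level_le
  have h := he.norm_level_eq (Finsupp.single p 1) (n := p.1.1) (k := p.1.2.1) hk hn fun q hq => by
    have := Finsupp.support_single_subset hq
    rw [Finset.mem_singleton] at this
    rw [this]
    exact ⟨rfl, rfl⟩
  rw [Finsupp.linearCombination_single, one_smul] at h
  rw [h, pointNorm]
  have hj : Function.Injective fun i : Fin p.1.2.1 =>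
      ((⟨p.1.1, hn⟩, ⟨i, i.2.trans hk⟩) : Fin (p.1.1 + 1) × Fin (p.1.1 + 1)) := by
    intro i i' hi
    simp only [Prod.mk.injEq, Fin.mk.injEq, true_and] at hi
    exact Fin.ext hi
  have hu : IsUniform fun x : Fin (p.1.1 + 1) × Fin (p.1.1 + 1) → Bool =>
      fun i : Fin p.1.2.1 => xor (x (⟨p.1.1, hn⟩, ⟨i, i.2.trans hk⟩)) (p.1.2.path i) :=
    (isUniform_of_bijective (xor_bijective fun i : Fin p.1.2.1 => p.1.2.path i)).comp
      (isUniform_restrict hj)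
  rw [← cubeNorm_comp X hu]
  congr 1
  funext x
  rw [treeCoef, coefAt_single]
  have hiff : (p.1.1 = ((⟨p.1.1, hn⟩ : Fin (p.1.1 + 1)) : ℕ) ∧
      p.1.2 = node (row x ⟨p.1.1, hn⟩) ((⟨p.1.2.1, hk⟩ : Fin (p.1.1 + 1)) : ℕ)) ↔
      (fun i : Fin p.1.2.1 => xor (x (⟨p.1.1, hn⟩, ⟨i, i.2.trans hk⟩)) (p.1.2.path i)) =
        fun _ => false := by
    have h1 : p.1.2 = node (row x ⟨p.1.1, hn⟩) p.1.2.1 ↔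
        node p.1.2.path p.1.2.1 = node (row x ⟨p.1.1, hn⟩) p.1.2.1 := by
      rw [node_path]
    simp only [true_and]
    rw [h1, node_eq_iff, funext_iff, Fin.forall_iff]
    refine forall₂_congr fun i hi => ?_
    have hi' : i < p.1.1 + 1 := hi.trans hk
    simp only [row, hi', dif_pos, bne_eq_false_iff_eq]
    exact eq_comm
  by_cases hc : (fun i : Fin p.1.2.1 => xor (x (⟨p.1.1, hn⟩, ⟨i, i.2.trans hk⟩))
      (p.1.2.path i)) = fun _ => false
  · rw [if_pos (hiff.2 hc), if_pos hc, abs_one]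
  · rw [if_neg fun h => hc (hiff.1 h), if_neg hc, abs_zero]

/-- The projection onto one level of one block is a difference of two conditional expectations. -/
theorem norm_restrict_level_le (n k : ℕ) (c d : DyadicOmega →₀ ℝ)
    (hd : ∀ p : DyadicOmega, p.1.1 = n ∧ p.1.2.1 = k → d p = c p)
    (hd' : ∀ p : DyadicOmega, ¬(p.1.1 = n ∧ p.1.2.1 = k) → d p = 0) :
    ‖Finsupp.linearCombination ℝ e d‖ ≤ 2 * ‖Finsupp.linearCombination ℝ e c‖ := by
  classical
  have h1 := he.norm_restrict_le (fun m j => m = n ∧ j ≤ k)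
    (fun m j j' hj h => ⟨h.1, hj.trans h.2⟩) c (c.filter fun p => p.1.1 = n ∧ p.1.2.1 ≤ k)
    (fun p hp => Finsupp.filter_apply_pos _ _ hp) fun p hp => Finsupp.filter_apply_neg _ _ hp
  have h2 := he.norm_restrict_le (fun m j => m = n ∧ j < k)
    (fun m j j' hj h => ⟨h.1, lt_of_le_of_lt hj h.2⟩) c (c.filter fun p => p.1.1 = n ∧ p.1.2.1 < k)
    (fun p hp => Finsupp.filter_apply_pos _ _ hp) fun p hp => Finsupp.filter_apply_neg _ _ hp
  have h3 : d =
      c.filter (fun p => p.1.1 = n ∧ p.1.2.1 ≤ k) - c.filter fun p => p.1.1 = n ∧ p.1.2.1 < k := by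
    ext p
    simp only [Finsupp.sub_apply, Finsupp.filter_apply]
    by_cases hp : p.1.1 = n ∧ p.1.2.1 = k
    · rw [hd p hp]
      simp [hp]
    · rw [hd' p hp]
      by_cases hn : p.1.1 = n
      · rcases lt_trichotomy p.1.2.1 k with h | h | h
        · simp [hn, h, h.le]
        · exact absurd ⟨hn, h⟩ hp
        · simp [hn, h.not_gt, h.not_ge]
      · simp [hn]
  rw [h3, map_sub, two_mul]
  exact (norm_sub_le _ _).trans (add_le_add h1 h2)

/-- On one level of one block the Haar functions are disjointly supported, so that the norm is
monotone in the absolute values of the coefficients. -/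
theorem norm_restrict_subset_level_le (n k : ℕ) (P : DyadicOmega → Prop)
    (hP : ∀ p, P p → p.1.1 = n ∧ p.1.2.1 = k) (c d : DyadicOmega →₀ ℝ)
    (hd : ∀ p, P p → d p = c p) (hd' : ∀ p, ¬P p → d p = 0) :
    ‖Finsupp.linearCombination ℝ e d‖ ≤ 2 * ‖Finsupp.linearCombination ℝ e c‖ := by
  classical
  refine le_trans ?_ (he.norm_restrict_level_le n k c (c.filter fun p => p.1.1 = n ∧ p.1.2.1 = k)
    (fun p hp => Finsupp.filter_apply_pos _ _ hp) fun p hp => Finsupp.filter_apply_neg _ _ hp)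
  have hn : n < max n k + 1 := Nat.lt_succ_of_le (le_max_left _ _)
  have hk : k < max n k + 1 := Nat.lt_succ_of_le (le_max_right _ _)
  rw [he.norm_level_eq d hk hn fun p hp => hP p (by
      by_contra h
      exact Finsupp.mem_support_iff.1 hp (hd' p h)),
    he.norm_level_eq (c.filter fun p => p.1.1 = n ∧ p.1.2.1 = k) hk hn fun p hp => by
      rw [Finsupp.support_filter, Finset.mem_filter] at hp; exact hp.2]
  refine cubeNorm_mono X fun x => ?_
  rw [abs_abs, abs_abs, treeCoef, treeCoef]
  set I := node (row x ((⟨n, hn⟩, ⟨k, hk⟩) : Fin (max n k + 1) × Fin (max n k + 1)).1)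
    ((⟨n, hn⟩, ⟨k, hk⟩) : Fin (max n k + 1) × Fin (max n k + 1)).2
  unfold coefAt
  split_ifs with h
  · rw [Finsupp.filter_apply]
    by_cases h1 : P (DyadicOmega.mk ((⟨n, hn⟩, ⟨k, hk⟩) :
      Fin (max n k + 1) × Fin (max n k + 1)).1 I h)
    · rw [if_pos (hP _ h1), hd _ h1]
    · rw [hd' _ h1, abs_zero]
      exact abs_nonneg _
  · exact le_rfl

/-- The case of a single index in `norm_restrict_subset_level_le`. -/
theorem abs_coef_mul_le (c : DyadicOmega →₀ ℝ) (p : DyadicOmega) :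
    |c p| * pointNorm X p.1.2.1 ≤ 2 * ‖Finsupp.linearCombination ℝ e c‖ := by
  have h := he.norm_restrict_subset_level_le p.1.1 p.1.2.1 (fun q => q = p)
    (by rintro q rfl; exact ⟨rfl, rfl⟩) c (Finsupp.single p (c p))
    (by rintro q rfl; exact Finsupp.single_eq_same)
    fun q hq => Finsupp.single_eq_of_ne hq
  rwa [Finsupp.linearCombination_single, norm_smul, he.norm_basis, Real.norm_eq_abs] at h

end IsOmegaModel

/-! ### The norms of point masses -/

theorem pointNorm_zero (X : HaarSystemNorm) : pointNorm X 0 = 1 := by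
  have : (fun x : Fin 0 → Bool => if x = fun _ => false then (1 : ℝ) else 0) = fun _ => 1 := by
    funext x
    rw [if_pos (funext fun i => i.elim0)]
  rw [pointNorm, this, cubeNorm_one]

theorem isUniform_castSucc (k : ℕ) :
    IsUniform fun x : Fin (k + 1) → Bool => fun i : Fin k => x i.castSucc :=
  isUniform_restrict (Fin.castSucc_injective k)

theorem pointNorm_succ_le (X : HaarSystemNorm) (k : ℕ) : pointNorm X (k + 1) ≤ pointNorm X k := by
  rw [pointNorm, pointNorm, ← cubeNorm_comp X (isUniform_castSucc k)]
  refine cubeNorm_mono X fun x => ?_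
  by_cases h : x = fun _ => false
  · subst h
    simp
  · rw [if_neg h, abs_zero]
    exact abs_nonneg _

theorem pointNorm_antitone (X : HaarSystemNorm) : Antitone (pointNorm X) :=
  antitone_nat_of_succ_le (pointNorm_succ_le X)

theorem pointNorm_nonneg (X : HaarSystemNorm) (k : ℕ) : 0 ≤ pointNorm X k := apply_nonneg _ _

/-- The indicator function of an interval is the sum of those of its halves. -/
theorem pointNorm_le_two_mul (X : HaarSystemNorm) (k : ℕ) :
    pointNorm X k ≤ 2 * pointNorm X (k + 1) := by
  have hflip : IsUniform fun x : Fin (k + 1) → Bool =>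
      fun i => xor (x i) (decide (i = Fin.last k)) :=
    isUniform_of_bijective (xor_bijective _)
  have h : (fun x : Fin (k + 1) → Bool =>
      if (fun i : Fin k => x i.castSucc) = fun _ => false then (1 : ℝ) else 0) =
      (fun x => if x = fun _ => false then 1 else 0) + fun x =>
        if (fun i => xor (x i) (decide (i = Fin.last k))) = fun _ => false then 1 else 0 := by
    funext x
    have h1 : (x = fun _ => false) ↔ (fun i : Fin k => x i.castSucc) = (fun _ => false) ∧
        x (Fin.last k) = false := by
      simp only [funext_iff]
      exact Fin.forall_fin_succ'
    have h2 : ((fun i => xor (x i) (decide (i = Fin.last k))) = fun _ => false) ↔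
        (fun i : Fin k => x i.castSucc) = (fun _ => false) ∧ x (Fin.last k) = true := by
      simp only [funext_iff]
      refine Fin.forall_fin_succ'.trans (and_congr (forall_congr' fun i => ?_) ?_)
      · simp [Fin.castSucc_ne_last]
      · simp
    simp only [Pi.add_apply, h1, h2]
    by_cases h3 : (fun i : Fin k => x i.castSucc) = fun _ => false
    · cases x (Fin.last k) <;> simp [h3]
    · simp [h3]
  rw [pointNorm, ← cubeNorm_comp X (isUniform_castSucc k), h]
  refine (map_add_le_add _ _ _).trans ?_
  rw [cubeNorm_comp X hflip fun x => if x = fun _ => false then 1 else 0, pointNorm]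
  exact le_of_eq (two_mul _).symm

/-- The sequence `2^k ‖χ_I‖`, `|I| = 2^{-k}`, is nondecreasing. -/
theorem two_pow_mul_pointNorm_monotone (X : HaarSystemNorm) :
    Monotone fun k => 2 ^ k * pointNorm X k := by
  refine monotone_nat_of_le_succ fun k => ?_
  have := pointNorm_le_two_mul X k
  rw [pow_succ, mul_assoc]
  gcongr

theorem one_le_two_pow_mul_pointNorm (X : HaarSystemNorm) (k : ℕ) : 1 ≤ 2 ^ k * pointNorm X k := by
  have := two_pow_mul_pointNorm_monotone X (Nat.zero_le k)
  simpa [pointNorm_zero] using this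

theorem pointNorm_pos (X : HaarSystemNorm) (k : ℕ) : 0 < pointNorm X k := by
  have := one_le_two_pow_mul_pointNorm X k
  by_contra h
  have h0 : pointNorm X k = 0 := le_antisymm (not_lt.1 h) (pointNorm_nonneg X k)
  rw [h0, mul_zero] at this
  linarith

theorem pointNorm_le_one (X : HaarSystemNorm) (k : ℕ) : pointNorm X k ≤ 1 :=
  (pointNorm_antitone X (Nat.zero_le k)).trans_eq (pointNorm_zero X)

/-! ### Selections of intervals inside the blocks -/

/-- The value of a family at `(n, I)`, and zero if `I` has level greater than `n`. -/
def atBlock {F : Type*} [Zero F] (v : DyadicOmega → F) (n : ℕ) (I : DyadicInterval) : F :=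
  if h : I.1 ≤ n then v (DyadicOmega.mk n I h) else 0

theorem atBlock_of_le {F : Type*} [Zero F] (v : DyadicOmega → F) {n : ℕ} {I : DyadicInterval}
    (h : I.1 ≤ n) : atBlock v n I = v (DyadicOmega.mk n I h) := dif_pos h

open Classical in
theorem coefAt_atBlock_single {m : ℕ} {K : DyadicInterval} (hK : K.1 ≤ m) (n : ℕ)
    (I : DyadicInterval) :
    coefAt (atBlock (fun q => Finsupp.single q (1 : ℝ)) m K) n I =
      if m = n ∧ K = I then 1 else 0 := by
  rw [atBlock_of_le _ hK, coefAt_single]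
  rfl

theorem coefAt_zero (n : ℕ) (I : DyadicInterval) : coefAt 0 n I = 0 := by
  unfold coefAt
  split_ifs <;> simp

theorem coefAt_sum {ι : Type*} (s : Finset ι) (f : ι → DyadicOmega →₀ ℝ) (n : ℕ)
    (I : DyadicInterval) : coefAt (∑ i ∈ s, f i) n I = ∑ i ∈ s, coefAt (f i) n I := by
  classical
  induction s using Finset.induction_on with
  | empty => simp [coefAt_zero]
  | insert a s ha ih => rw [Finset.sum_insert ha, Finset.sum_insert ha, coefAt_add, ih]

/-- A finite set `sel` of dyadic intervals of level at most `block`, with signs (`true` stands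
for `-1`). It is regarded as a part of the block with the number `block` of an independent sum. -/
structure BlockSelection where
  block : ℕ
  sel : Finset DyadicInterval
  le : ∀ K ∈ sel, K.1 ≤ block
  twist : DyadicInterval → Bool

namespace BlockSelection

variable (s : BlockSelection)

/-- The number of selected intervals of level less than `k` along the path `x`. -/
def depth (x : ℕ → Bool) (k : ℕ) : ℕ := Nat.count (fun i => node x i ∈ s.sel) k

/-- The interval reached after reading `k` bits of the path `x`, where only the bits at selected
intervals are used, and are changed by the twist. -/
def img (x : ℕ → Bool) : ℕ → DyadicInterval
  | 0 => node x 0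
  | k + 1 => if node x k ∈ s.sel then (img x k).child (xor (s.twist (node x k)) (x k))
      else img x k

theorem depth_zero (x : ℕ → Bool) : s.depth x 0 = 0 := Nat.count_zero _

theorem depth_succ (x : ℕ → Bool) (k : ℕ) :
    s.depth x (k + 1) = s.depth x k + if node x k ∈ s.sel then 1 else 0 := Nat.count_succ _ _

theorem depth_mono (x : ℕ → Bool) : Monotone (s.depth x) := Nat.count_monotone _

theorem img_level (x : ℕ → Bool) (k : ℕ) : (s.img x k).1 = s.depth x k := by
  induction k with
  | zero => rw [img, node_level, depth_zero]
  | succ k ih =>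
    rw [img, depth_succ]
    split_ifs
    · rw [child_level, ih]
    · exact ih

theorem depth_congr {x y : ℕ → Bool} {k : ℕ} (h : ∀ i < k, x i = y i) :
    s.depth x k = s.depth y k := by
  induction k with
  | zero => rfl
  | succ k ih =>
    rw [depth_succ, depth_succ, ih fun i hi => h i (by omega),
      node_congr fun i hi => h i (Nat.lt_succ_of_lt hi)]

theorem img_congr {x y : ℕ → Bool} {k : ℕ} (h : ∀ i < k, x i = y i) : s.img x k = s.img y k := by
  induction k with
  | zero => rfl
  | succ k ih =>
    rw [img, img, ih fun i hi => h i (by omega),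
      node_congr fun i hi => h i (Nat.lt_succ_of_lt hi), h k (Nat.lt_succ_self k)]

/-- The image of a dyadic interval under `BlockSelection.img`. -/
def image (K : DyadicInterval) : DyadicInterval := s.img K.path K.1

theorem image_node (x : ℕ → Bool) (k : ℕ) : s.image (node x k) = s.img x k := by
  have h : node (node x k).path k = node x k := by
    have := node_path (node x k)
    rwa [node_level] at this
  rw [image, node_level]
  exact s.img_congr (node_inj h)

open Classical in
/-- The selected intervals with image `I`. -/
def fiber (I : DyadicInterval) : Finset DyadicInterval := s.sel.filter fun K => s.image K = I

theorem mem_fiber {I K : DyadicInterval} : K ∈ s.fiber I ↔ K ∈ s.sel ∧ s.image K = I := by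
  rw [fiber, Finset.mem_filter]

/-- The signed sum, over the selected intervals with image `I`, of the vectors of the block. -/
def vec {F : Type*} [AddCommGroup F] [Module ℝ F] (v : DyadicOmega → F) (I : DyadicInterval) : F :=
  ∑ K ∈ s.fiber I, bitSign (s.twist K) • atBlock v s.block K

/-- The signed weighted average, over the selected intervals with image `I`, of the values of a
family on the block. -/
def average {F : Type*} [AddCommGroup F] [Module ℝ F] (a : DyadicOmega → F) (I : DyadicInterval) :
    F :=
  (2 : ℝ) ^ I.1 • ∑ K ∈ s.fiber I, ((2 ^ K.1)⁻¹ * bitSign (s.twist K)) • atBlock a s.block K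

theorem map_vec {F F' : Type*} [AddCommGroup F] [Module ℝ F] [AddCommGroup F'] [Module ℝ F']
    (f : F →ₗ[ℝ] F') (v : DyadicOmega → F) (I : DyadicInterval) :
    f (s.vec v I) = s.vec (fun p => f (v p)) I := by
  rw [vec, vec, map_sum]
  refine Finset.sum_congr rfl fun K hK => ?_
  have hle := s.le K (s.mem_fiber.1 hK).1
  rw [map_smul, atBlock_of_le _ hle, atBlock_of_le _ hle]

theorem map_average {F F' : Type*} [AddCommGroup F] [Module ℝ F] [AddCommGroup F'] [Module ℝ F']
    (f : F →ₗ[ℝ] F') (a : DyadicOmega → F) (I : DyadicInterval) :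
    f (s.average a I) = s.average (fun p => f (a p)) I := by
  rw [average, average, map_smul, map_sum]
  refine congrArg _ (Finset.sum_congr rfl fun K hK => ?_)
  have hle := s.le K (s.mem_fiber.1 hK).1
  rw [map_smul, atBlock_of_le _ hle, atBlock_of_le _ hle]

open Classical in
theorem coefAt_vec_single (I : DyadicInterval) (n : ℕ) (K : DyadicInterval) :
    coefAt (s.vec (fun q => Finsupp.single q (1 : ℝ)) I) n K =
      if s.block = n ∧ K ∈ s.sel ∧ s.image K = I then bitSign (s.twist K) else 0 := by
  rw [vec, coefAt_sum]
  have h : ∀ L ∈ s.fiber I, coefAt (bitSign (s.twist L) •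
      atBlock (fun q => Finsupp.single q (1 : ℝ)) s.block L) n K =
      if L = K then (if s.block = n then bitSign (s.twist K) else 0) else 0 := by
    intro L hL
    rw [coefAt_smul, coefAt_atBlock_single (s.le L (s.mem_fiber.1 hL).1)]
    by_cases hLK : L = K
    · subst hLK
      by_cases hn : s.block = n <;> simp [hn]
    · simp [hLK]
  rw [Finset.sum_congr rfl h, Finset.sum_ite_eq', if_congr s.mem_fiber rfl rfl]
  by_cases h1 : K ∈ s.sel ∧ s.image K = I <;> by_cases h2 : s.block = n <;> simp [h1, h2]

variable (β : ℕ → BlockSelection) (hβ : StrictMono fun l => (β l).block)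

open Classical in
/-- The coupling belonging to a sequence of selections in different blocks: a bit of the first cube
is assigned to the block `l` if it is the bit of the block `(β l).block` at a selected interval, and
the number of selected intervals above this interval is the level it is assigned to. -/
def coupling (M : ℕ) : BitCoupling (Fin M × Fin M) (Fin M × Fin M) where
  pick x p := if h : ∃ l : ℕ, (β l).block = p.1 ∧ node (row x p.1) p.2 ∈ (β l).sel ∧
      (β l).depth (row x p.1) p.2 ≤ l then
    have hM : h.choose < M := (hβ.le_apply.trans h.choose_spec.1.le).trans_lt p.1.2
    some (⟨h.choose, hM⟩, ⟨_, h.choose_spec.2.2.trans_lt hM⟩) else none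
  twist x p := if h : ∃ l : ℕ, (β l).block = p.1 then
    (β h.choose).twist (node (row x p.1) p.2) else false
  rank p := p.2
  predictable := by
    intro x x' p h
    have h1 : ∀ l, (β l).depth (row x p.1) p.2 = (β l).depth (row x' p.1) p.2 := fun l =>
      (β l).depth_congr (node_inj (node_row_congr fun q _ hq => h q hq))
    have h2 : node (row x p.1) p.2 = node (row x' p.1) p.2 := node_row_congr fun q _ hq => h q hq
    simp only [h1, h2, and_self]
  injective := by
    intro x p q t hp hq
    dsimp only at hp hq
    split_ifs at hp with hp'
    split_ifs at hq with hq'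
    simp only [Option.some.injEq] at hp hq
    rw [← hq] at hp
    simp only [Prod.mk.injEq, Fin.mk.injEq] at hp
    obtain ⟨h1, h2⟩ := hp
    have hpq : p.1 = q.1 := by
      ext
      rw [← hp'.choose_spec.1, ← hq'.choose_spec.1, h1]
    refine Prod.ext hpq (Fin.ext ?_)
    -- On one path, different selected intervals have different depths.
    have h3 := hq'.choose_spec.2.1
    rw [← h1, ← hpq] at h2 h3
    exact Nat.count_injective (p := fun i => node (row x p.1) i ∈ (β hp'.choose).sel)
      hp'.choose_spec.2.1 h3 h2

theorem coupling_pick_iff {M : ℕ} {x : Fin M × Fin M → Bool} {p t : Fin M × Fin M} :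
    (coupling β hβ M).pick x p = some t ↔ (β t.1).block = p.1 ∧
      node (row x p.1) p.2 ∈ (β t.1).sel ∧ (β t.1).depth (row x p.1) p.2 = t.2 ∧
      (t.2 : ℕ) ≤ t.1 := by
  simp only [coupling]
  constructor
  · intro h
    split_ifs at h with h'
    simp only [Option.some.injEq] at h
    subst h
    exact ⟨h'.choose_spec.1, h'.choose_spec.2.1, rfl, h'.choose_spec.2.2⟩
  · rintro ⟨h1, h2, h3, h4⟩
    have h : ∃ l : ℕ, (β l).block = p.1 ∧ node (row x p.1) p.2 ∈ (β l).sel ∧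
      (β l).depth (row x p.1) p.2 ≤ l := ⟨t.1, h1, h2, h3.trans_le h4⟩
    have hl : h.choose = t.1 := hβ.injective (h.choose_spec.1.trans h1.symm)
    rw [dif_pos h]
    simp only [Option.some.injEq]
    refine Prod.ext (Fin.ext hl) (Fin.ext ?_)
    rw [← h3]
    simp only [hl]

theorem coupling_twist {M : ℕ} {x : Fin M × Fin M → Bool} {p : Fin M × Fin M} {l : ℕ}
    (h : (β l).block = p.1) :
    (coupling β hβ M).twist x p = (β l).twist (node (row x p.1) p.2) := by
  have h' : ∃ l : ℕ, (β l).block = p.1 := ⟨l, h⟩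
  simp only [coupling]
  rw [dif_pos h', show h'.choose = l from hβ.injective (h'.choose_spec.trans h.symm)]

/-- Along coupled points, the image of an interval is the interval on the coupled path. -/
theorem img_eq_node_of_coupled {M : ℕ} {x y : Fin M × Fin M → Bool}
    (hxy : ∀ p t, (coupling β hβ M).pick x p = some t →
      y t = xor ((coupling β hβ M).twist x p) (x p))
    {n l : Fin M} (hn : (β l).block = n) {k : ℕ} (hk : k ≤ M)
    (hd : (β l).depth (row x n) k ≤ l + 1) :
    (β l).img (row x n) k = node (row y l) ((β l).depth (row x n) k) := by
  induction k with
  | zero => rw [depth_zero]; rfl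
  | succ k ih =>
    have hkM : k < M := hk
    rw [depth_succ] at hd ⊢
    rw [img]
    split_ifs with hsel
    · rw [if_pos hsel] at hd
      have hl : (β l).depth (row x n) k < M := by have := l.2; omega
      have hp := (coupling_pick_iff β hβ (x := x) (p := (n, ⟨k, hkM⟩))
        (t := (l, ⟨(β l).depth (row x n) k, hl⟩))).2 ⟨hn, hsel, rfl, by simp only; omega⟩
      rw [node, ih hkM.le (by omega)]
      congr 1
      have h1 := hxy _ _ hp
      rw [coupling_twist β hβ hn] at h1
      have h2 := row_apply y (l, ⟨(β l).depth (row x n) k, hl⟩)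
      have h3 := row_apply x (n, ⟨k, hkM⟩)
      dsimp only at h1 h2 h3
      rw [h2, h1, ← h3]
    · rw [if_neg hsel] at hd
      exact ih hkM.le (by omega)

theorem node_succ_eq_iff {x y : ℕ → Bool} {k : ℕ} :
    node x (k + 1) = node y (k + 1) ↔ node x k = node y k ∧ x k = y k := by
  rw [node_eq_iff, node_eq_iff]
  exact Nat.forall_lt_succ_right

open Classical in
/-- The conditional probability of an interval, given the coupled path. -/
theorem expect_node_source {M : ℕ} (y : Fin M × Fin M → Bool) {n l : Fin M}
    (hn : (β l).block = n) (w : ℕ → Bool) {k : ℕ} (hk : k ≤ M)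
    (hd : (β l).depth w k ≤ l + 1) :
    𝔼 u, (if node (row ((coupling β hβ M).source u y) n) k = node w k then (1 : ℝ) else 0) =
      2 ^ (β l).depth w k * (2 ^ k)⁻¹ *
        if (β l).img w k = node (row y l) ((β l).depth w k) then 1 else 0 := by
  set C := coupling β hβ M with hC
  induction k with
  | zero => simp [depth_zero, img, node]
  | succ k ih =>
    have hkM : k < M := hk
    have hd' : (β l).depth w k ≤ l + 1 := ((β l).depth_mono w (Nat.le_succ k)).trans hd
    specialize ih hkM.le hd'
    simp only [node_succ_eq_iff]
    have hrow : ∀ x : Fin M × Fin M → Bool, row x n k = x (n, ⟨k, hkM⟩) := fun x =>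
      row_apply x (n, ⟨k, hkM⟩)
    rw [depth_succ] at hd ⊢
    by_cases hsel : node w k ∈ (β l).sel
    · rw [if_pos hsel] at hd ⊢
      have hl : (β l).depth w k < M := by have := l.2; omega
      have h1 : ∀ u, node (row (C.source u y) n) k = node w k →
          row (C.source u y) n k = xor ((β l).twist (node w k)) (row y l ((β l).depth w k)) := by
        intro u hu
        have hp := (coupling_pick_iff β hβ (x := C.source u y) (p := (n, ⟨k, hkM⟩))
          (t := (l, ⟨(β l).depth w k, hl⟩))).2
          ⟨hn, by dsimp only; rw [hu]; exact hsel,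
            (β l).depth_congr (node_inj hu), by simp only; omega⟩
        have h2 := C.source_of_pick hp
        rw [hrow, h2, hC, coupling_twist β hβ hn]
        dsimp only
        rw [← hC, hu]
        exact congrArg _ (row_apply y (l, ⟨(β l).depth w k, hl⟩)).symm
      have h3 : ∀ u, (if node (row (C.source u y) n) k = node w k ∧
          row (C.source u y) n k = w k then (1 : ℝ) else 0) =
          (if node (row (C.source u y) n) k = node w k then (1 : ℝ) else 0) *
          if xor ((β l).twist (node w k)) (row y l ((β l).depth w k)) = w k then 1 else 0 := by
        intro u
        by_cases hu : node (row (C.source u y) n) k = node w k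
        · simp only [hu, true_and, if_true, one_mul, h1 u hu]
        · simp only [hu, false_and, if_false, zero_mul]
      simp only [h3]
      rw [← Finset.expect_mul, ih, img, if_pos hsel, node]
      -- The bit of the source at a selected interval is determined by `y`: depth and level
      -- both increase by one.
      have h4 : ((β l).img w k).child (xor ((β l).twist (node w k)) (w k)) =
          (node (row y l) ((β l).depth w k)).child (row y l ((β l).depth w k)) ↔
          (β l).img w k = node (row y l) ((β l).depth w k) ∧
          xor ((β l).twist (node w k)) (row y l ((β l).depth w k)) = w k := by
        constructor
        · intro h
          obtain ⟨h5, h6⟩ := child_injective h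
          exact ⟨h5, by rw [← h6, ← Bool.xor_assoc, Bool.xor_self, Bool.false_xor]⟩
        · rintro ⟨h5, h6⟩
          rw [h5, ← h6, ← Bool.xor_assoc, Bool.xor_self, Bool.false_xor]
      rw [if_congr h4 rfl rfl, pow_succ, pow_succ, mul_inv]
      by_cases h5 : (β l).img w k = node (row y l) ((β l).depth w k) <;>
      by_cases h6 : xor ((β l).twist (node w k)) (row y l ((β l).depth w k)) = w k <;>
      simp only [h5, h6, and_self, and_true, and_false, if_true, if_false,
        mul_one, mul_zero] <;> ring
    · rw [if_neg hsel] at hd ⊢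
      -- The bit of the source at an interval which is not selected is the free bit of `u`,
      -- which contributes the factor `1 / 2`.
      have hcongr : ∀ u b, node (row (C.source (Function.update u (n, ⟨k, hkM⟩) b) y) n) k =
          node (row (C.source u y) n) k := by
        intro u b
        refine node_row_congr (p := (n, ⟨k, hkM⟩)) fun q _ hq => ?_
        have hq' : C.rank q < C.rank (n, ⟨k, hkM⟩) := hq
        exact C.source_update u y _ b q hq'.le (by rintro rfl; exact lt_irrefl _ hq')
      have h1 : ∀ u, node (row (C.source u y) n) k = node w k →
          row (C.source u y) n k = u (n, ⟨k, hkM⟩) := by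
        intro u hu
        rw [hrow]
        refine C.source_of_none ?_
        rw [Option.eq_none_iff_forall_ne_some]
        intro t ht
        obtain ⟨h2, h3, -⟩ := (coupling_pick_iff β hβ).1 ht
        have : (t.1 : ℕ) = l := hβ.injective (h2.trans hn.symm)
        rw [this] at h3
        dsimp only at h3
        rw [hu] at h3
        exact hsel h3
      have h3 : ∀ u, (if node (row (C.source u y) n) k = node w k ∧
          row (C.source u y) n k = w k then (1 : ℝ) else 0) =
          (if node (row (C.source u y) n) k = node w k then (1 : ℝ) else 0) *
          if u (n, ⟨k, hkM⟩) = w k then 1 else 0 := by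
        intro u
        by_cases hu : node (row (C.source u y) n) k = node w k
        · simp only [hu, true_and, if_true, one_mul, h1 u hu]
        · simp only [hu, false_and, if_false, zero_mul]
      have h4 : 𝔼 u : Fin M × Fin M → Bool,
          (if node (row (C.source u y) n) k = node w k then (1 : ℝ) else 0) *
          (if u (n, ⟨k, hkM⟩) = w k then 1 else 0) +
          𝔼 u : Fin M × Fin M → Bool,
          (if node (row (C.source u y) n) k = node w k then (1 : ℝ) else 0) *
          (if u (n, ⟨k, hkM⟩) = w k then 1 else 0) =
          𝔼 u, (if node (row (C.source u y) n) k = node w k then (1 : ℝ) else 0) := by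
        rw [← expect_flip ((n, ⟨k, hkM⟩) : Fin M × Fin M) fun u : Fin M × Fin M → Bool =>
          (if node (row (C.source u y) n) k = node w k then (1 : ℝ) else 0) *
            (if u (n, ⟨k, hkM⟩) = w k then 1 else 0)]
        conv_lhs => arg 2; rw [expect_flip ((n, ⟨k, hkM⟩) : Fin M × Fin M)
          fun u : Fin M × Fin M → Bool =>
          (if node (row (C.source u y) n) k = node w k then (1 : ℝ) else 0) *
            (if u (n, ⟨k, hkM⟩) = w k then 1 else 0)]
        rw [← Finset.expect_add_distrib]
        refine Finset.expect_congr rfl fun u _ => ?_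
        simp only [hcongr, Function.update_self]
        rw [← mul_add]
        cases u (n, ⟨k, hkM⟩) <;> cases w k <;> simp
      simp only [h3]
      rw [img, if_neg hsel, add_zero, pow_succ, mul_inv]
      linear_combination (1 / 2 : ℝ) * h4 + (1 / 2 : ℝ) * ih

end BlockSelection

/-! ### Contractions defined by selections -/

namespace BlockSelection

variable (β : ℕ → BlockSelection) (hβ : StrictMono fun l => (β l).block)

include hβ in
theorem coefAt_linearCombination_vec (c : DyadicOmega →₀ ℝ) (l : ℕ) (K : DyadicInterval) :
    coefAt (Finsupp.linearCombination ℝ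
      (fun p : DyadicOmega => (β p.1.1).vec (fun q => Finsupp.single q (1 : ℝ)) p.1.2) c)
      (β l).block K =
    if K ∈ (β l).sel then bitSign ((β l).twist K) * coefAt c l ((β l).image K) else 0 := by
  classical
  induction c using Finsupp.induction_linear with
  | zero => simp [coefAt_zero]
  | add c d hc hd =>
    rw [map_add, coefAt_add, hc, hd, coefAt_add]
    split_ifs
    · ring
    · simp
  | single p a =>
    rw [Finsupp.linearCombination_single, coefAt_smul, coefAt_vec_single, coefAt_single]
    by_cases hl : p.1.1 = l
    · subst hl
      by_cases h1 : K ∈ (β p.1.1).sel <;> by_cases h2 : (β p.1.1).image K = p.1.2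
      · simp [h1, h2, mul_comm]
      · simp only [h1, h2, true_and, and_false, if_true, if_false, mul_zero]
        rw [if_neg fun h => h2 h.symm, mul_zero]
      · simp [h1]
      · simp [h1]
    · have : (β p.1.1).block ≠ (β l).block := fun h => hl (hβ.injective h)
      simp [hl, this]

theorem coefAt_linearCombination_vec_of_notMem (c : DyadicOmega →₀ ℝ) {n : ℕ}
    (hn : ∀ l, (β l).block ≠ n) (K : DyadicInterval) :
    coefAt (Finsupp.linearCombination ℝ
      (fun p : DyadicOmega => (β p.1.1).vec (fun q => Finsupp.single q (1 : ℝ)) p.1.2) c) n K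
      = 0 := by
  classical
  induction c using Finsupp.induction_linear with
  | zero => simp [coefAt_zero]
  | add c d hc hd => rw [map_add, coefAt_add, hc, hd, add_zero]
  | single p a =>
    rw [Finsupp.linearCombination_single, coefAt_smul, coefAt_vec_single]
    simp [hn]

open Classical in
/-- The columns of the left inverse, up to a diagonal operator, of `BlockSelection.vec`. -/
def dualColumn (q : DyadicOmega) : DyadicOmega →₀ ℝ :=
  if h : ∃ l, (β l).block = q.1.1 ∧ q.1.2 ∈ (β l).sel then
    (2 ^ ((β h.choose).image q.1.2).1 * (2 ^ q.1.2.1)⁻¹ * bitSign ((β h.choose).twist q.1.2)) •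
      atBlock (fun p => Finsupp.single p (1 : ℝ)) h.choose ((β h.choose).image q.1.2)
  else 0

include hβ in
theorem dualColumn_of_mem {q : DyadicOmega} {l : ℕ} (h1 : (β l).block = q.1.1)
    (h2 : q.1.2 ∈ (β l).sel) : dualColumn β q =
    (2 ^ ((β l).image q.1.2).1 * (2 ^ q.1.2.1)⁻¹ * bitSign ((β l).twist q.1.2)) •
      atBlock (fun p => Finsupp.single p (1 : ℝ)) l ((β l).image q.1.2) := by
  have h : ∃ l, (β l).block = q.1.1 ∧ q.1.2 ∈ (β l).sel := ⟨l, h1, h2⟩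
  have hl : h.choose = l := hβ.injective (h.choose_spec.1.trans h1.symm)
  rw [dualColumn, dif_pos h, hl]

theorem dualColumn_of_notMem {q : DyadicOmega} (h : ∀ l, (β l).block = q.1.1 → q.1.2 ∉ (β l).sel) :
    dualColumn β q = 0 := by
  rw [dualColumn, dif_neg]
  rintro ⟨l, h1, h2⟩
  exact h l h1 h2

open Classical in
include hβ in
/-- The coefficient is `2^j |K|` up to sign, where `K` is the interval of `q` and `j` is the level
of its image, if `K` is selected and has the image `I`. -/
theorem coefAt_dualColumn (q : DyadicOmega) {l : ℕ} {I : DyadicInterval} (hI : I.1 ≤ l) :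
    coefAt (dualColumn β q) l I =
      if (β l).block = q.1.1 ∧ q.1.2 ∈ (β l).sel ∧ (β l).image q.1.2 = I then
      2 ^ I.1 * (2 ^ q.1.2.1)⁻¹ * bitSign ((β l).twist q.1.2) else 0 := by
  by_cases h : ∃ l', (β l').block = q.1.1 ∧ q.1.2 ∈ (β l').sel
  · obtain ⟨l', h1, h2⟩ := h
    rw [dualColumn_of_mem β hβ h1 h2, coefAt_smul]
    by_cases hle : ((β l').image q.1.2).1 ≤ l'
    · rw [coefAt_atBlock_single hle]
      by_cases hl : l' = l
      · subst hl
        by_cases h3 : (β l').image q.1.2 = I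
        · rw [if_pos ⟨rfl, h3⟩, if_pos ⟨h1, h2, h3⟩, h3, mul_one]
        · rw [if_neg fun h => h3 h.2, if_neg fun h => h3 h.2.2, mul_zero]
      · have : (β l).block ≠ q.1.1 := fun h => hl (hβ.injective (h1.trans h.symm))
        simp [hl, this]
    · rw [atBlock, dif_neg hle, coefAt_zero, mul_zero, if_neg]
      rintro ⟨h3, h4⟩
      obtain rfl : l' = l := hβ.injective (h1.trans h3.symm)
      rw [h4.2] at hle
      exact hle hI
  · rw [dualColumn_of_notMem β fun l' h1 h2 => h ⟨l', h1, h2⟩, coefAt_zero, if_neg]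
    rintro ⟨h3, h4⟩
    exact h ⟨l, h3, h4.1⟩

include hβ in
/-- Replacing the basis vectors by the vectors of the selections does not increase the norm: the
new coefficients are obtained from the old ones by composition with the coupling. -/
theorem cubeHardyNorm_vec_le (X : HaarSystemNorm) (η : Bool → ℝ) (c : DyadicOmega →₀ ℝ) (M : ℕ) :
    cubeHardyNorm X η (treeCoef M (Finsupp.linearCombination ℝ
      (fun p : DyadicOmega => (β p.1.1).vec (fun q => Finsupp.single q (1 : ℝ)) p.1.2) c)) ≤
    cubeHardyNorm X η (treeCoef M c) := by
  refine (coupling β hβ M).cubeHardyNorm_le_of_pullback X (fun p x => treeCoef_update c p x _) ?_ ?_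
  · intro x p hp
    rw [treeCoef]
    by_cases h : ∃ l, (β l).block = p.1
    · obtain ⟨l, hl⟩ := h
      rw [← hl, coefAt_linearCombination_vec β hβ]
      split_ifs with hsel
      · by_cases hd : (β l).depth (row x p.1) p.2 ≤ l
        · have hlM : l < M := (hβ.le_apply.trans hl.le).trans_lt p.1.2
          have := (coupling_pick_iff β hβ (x := x) (p := p)
            (t := (⟨l, hlM⟩, ⟨_, hd.trans_lt hlM⟩))).2 ⟨hl, hsel, rfl, hd⟩
          rw [hp] at this
          simp at this
        · rw [image_node, coefAt_of_lt, mul_zero]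
          rw [img_level]
          exact not_le.1 hd
      · rfl
    · exact coefAt_linearCombination_vec_of_notMem β c (fun l hl => h ⟨l, hl⟩) _
  · intro x z p t ht
    obtain ⟨h1, h2, h3, h4⟩ := (coupling_pick_iff β hβ).1 ht
    have hrow := img_eq_node_of_coupled β hβ (x := x) (y := (coupling β hβ M).target x z)
      (fun p t h => (coupling β hβ M).target_of_pick h z) h1 (k := p.2) p.2.2.le (by omega)
    rw [treeCoef, treeCoef, coupling_twist β hβ h1, ← h1, coefAt_linearCombination_vec β hβ,
      if_pos h2, image_node, hrow, h3]

open Classical in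
/-- The dual columns are the conditional expectations of the basis vectors, given the coupled point
of the second cube. -/
theorem treeCoef_dualColumn {M : ℕ} (q : DyadicOmega) (hq : q.1.1 < M) (t : Fin M × Fin M)
    (y : Fin M × Fin M → Bool) :
    treeCoef M (dualColumn β q) t y = 𝔼 u, ∑ p,
      if (coupling β hβ M).pick ((coupling β hβ M).source u y) p = some t then
        bitSign ((coupling β hβ M).twist ((coupling β hβ M).source u y) p) *
          treeCoef M (Finsupp.single q 1) p ((coupling β hβ M).source u y) else 0 := by
  set C := coupling β hβ M with hC
  have hk : q.1.2.1 < M := q.level_le.trans_lt hq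
  have hsingle : ∀ (p : Fin M × Fin M) x, p ≠ (⟨q.1.1, hq⟩, ⟨q.1.2.1, hk⟩) →
      treeCoef M (Finsupp.single q 1) p x = 0 := by
    intro p x hp
    rw [treeCoef, coefAt_single, if_neg]
    rintro ⟨h1, h2⟩
    refine hp (Prod.ext (Fin.ext h1.symm) (Fin.ext ?_))
    have := congrArg Sigma.fst h2
    rw [node_level] at this
    exact this.symm
  have hsum : ∀ x, (∑ p, if C.pick x p = some t then
      bitSign (C.twist x p) * treeCoef M (Finsupp.single q 1) p x else 0) =
      (if (β t.1).block = q.1.1 ∧ q.1.2 ∈ (β t.1).sel ∧ (β t.1).depth q.1.2.path q.1.2.1 = t.2 ∧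
        (t.2 : ℕ) ≤ t.1 then bitSign ((β t.1).twist q.1.2) else 0) *
      if node (row x ⟨q.1.1, hq⟩) q.1.2.1 = node q.1.2.path q.1.2.1 then 1 else 0 := by
    intro x
    rw [Finset.sum_eq_single (⟨q.1.1, hq⟩, ⟨q.1.2.1, hk⟩)]
    rotate_left
    · intro p _ hp
      rw [hsingle p x hp]
      simp
    · simp
    rw [hC, if_congr (coupling_pick_iff β hβ) rfl rfl, treeCoef, coefAt_single]
    dsimp only
    by_cases hx : node (row x ⟨q.1.1, hq⟩) q.1.2.1 = node q.1.2.path q.1.2.1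
    · rw [if_pos hx, (β t.1).depth_congr (node_inj hx), hx, node_path,
        if_pos (show q.1.1 = q.1.1 ∧ q.1.2 = q.1.2 from ⟨rfl, rfl⟩)]
      split_ifs with h
      · rw [coupling_twist β hβ h.1]
        dsimp only
        rw [hx, node_path]
      · simp
    · rw [if_neg hx, mul_zero]
      rw [if_neg (fun h => hx (by rw [← h.2, node_path]) :
        ¬(q.1.1 = q.1.1 ∧ q.1.2 = node (row x ⟨q.1.1, hq⟩) q.1.2.1)), mul_zero, ite_self]
  simp only [hsum]
  rw [← Finset.mul_expect, treeCoef]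
  by_cases hI : (t.2 : ℕ) ≤ t.1
  swap
  · rw [coefAt_of_lt _ (by rw [node_level]; exact not_le.1 hI), if_neg fun h => hI h.2.2.2,
      zero_mul]
  rw [coefAt_dualColumn β hβ _ (by rwa [node_level]), node_level]
  by_cases h1 : (β t.1).block = q.1.1
  swap
  · rw [if_neg fun h => h1 h.1, if_neg fun h => h1 h.1, zero_mul]
  by_cases h2 : q.1.2 ∈ (β t.1).sel
  swap
  · rw [if_neg fun h => h2 h.2.1, if_neg fun h => h2 h.2.1, zero_mul]
  by_cases h3 : (β t.1).depth q.1.2.path q.1.2.1 = t.2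
  · rw [expect_node_source β hβ y (n := ⟨q.1.1, hq⟩) (l := t.1) h1 q.1.2.path hk.le (by omega),
      if_pos (show (β t.1).block = q.1.1 ∧ q.1.2 ∈ (β t.1).sel ∧
        (β t.1).depth q.1.2.path q.1.2.1 = t.2 ∧ (t.2 : ℕ) ≤ t.1 from ⟨h1, h2, h3, hI⟩), h3]
    by_cases h4 : (β t.1).img q.1.2.path q.1.2.1 = node (row y t.1) t.2
    · rw [if_pos (⟨h1, h2, h4⟩ : _ ∧ _ ∧ (β t.1).image q.1.2 = _), if_pos h4]
      ring
    · rw [if_neg fun h => h4 h.2.2, if_neg h4]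
      ring
  · rw [if_neg, if_neg fun h => h3 h.2.2.1, zero_mul]
    rintro ⟨-, -, h4⟩
    have := congrArg Sigma.fst h4
    rw [image, img_level, node_level] at this
    exact h3 this

include hβ in
/-- Replacing the basis vectors by the dual columns is a conditional expectation and does not
increase the norm. -/
theorem cubeHardyNorm_dualColumn_le (X : HaarSystemNorm) (η : Bool → ℝ) (c : DyadicOmega →₀ ℝ)
    {M : ℕ} (hM : ∀ p ∈ c.support, p.1.1 < M) :
    cubeHardyNorm X η (treeCoef M (Finsupp.linearCombination ℝ (dualColumn β) c)) ≤
      cubeHardyNorm X η (treeCoef M c) := by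
  classical
  refine (coupling β hβ M).cubeHardyNorm_le_of_pushforward X
    (fun p x x' h => treeCoef_congr c h) fun t y => ?_
  have hc : ∀ p x, treeCoef M c p x =
      ∑ q ∈ c.support, c q * treeCoef M (Finsupp.single q 1) p x := by
    intro p x
    conv_lhs => rw [← Finsupp.sum_single c]
    rw [treeCoef, Finsupp.sum, coefAt_sum]
    refine Finset.sum_congr rfl fun q _ => ?_
    rw [treeCoef, ← coefAt_smul, Finsupp.smul_single, smul_eq_mul, mul_one]
  have hd : treeCoef M (Finsupp.linearCombination ℝ (dualColumn β) c) t y =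
      ∑ q ∈ c.support, c q * treeCoef M (dualColumn β q) t y := by
    rw [treeCoef, Finsupp.linearCombination_apply, Finsupp.sum, coefAt_sum]
    refine Finset.sum_congr rfl fun q _ => ?_
    rw [treeCoef, coefAt_smul]
  rw [hd, Finset.sum_congr rfl fun q hq =>
    congrArg (c q * ·) (treeCoef_dualColumn β hβ q (hM q hq) t y)]
  simp only [hc, Finset.mul_expect]
  rw [← Finset.expect_sum_comm]
  refine Finset.expect_congr rfl fun u _ => ?_
  simp only [Finset.mul_sum]
  rw [Finset.sum_comm]
  refine Finset.sum_congr rfl fun p _ => ?_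
  split_ifs
  · exact Finset.sum_congr rfl fun q _ => by ring
  · simp

end BlockSelection

namespace BlockSelection

variable (β : ℕ → BlockSelection) (hβ : StrictMono fun l => (β l).block)

include hβ in
theorem coefAt_linearCombination_dualColumn (c : DyadicOmega →₀ ℝ) {l : ℕ} {I : DyadicInterval}
    (hI : I.1 ≤ l) : coefAt (Finsupp.linearCombination ℝ (dualColumn β) c) l I =
      (β l).average (fun q => c q) I := by
  classical
  have h : ∀ c : DyadicOmega →₀ ℝ, (β l).average (fun q => c q) I =
      2 ^ I.1 * ∑ K ∈ (β l).fiber I, (2 ^ K.1)⁻¹ * bitSign ((β l).twist K) *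
        coefAt c (β l).block K := fun _ => rfl
  rw [h]
  induction c using Finsupp.induction_linear with
  | zero => simp [coefAt_zero]
  | add c d hc hd =>
    rw [map_add, coefAt_add, hc, hd]
    simp only [coefAt_add, mul_add, Finset.sum_add_distrib]
  | single q a =>
    rw [Finsupp.linearCombination_single, coefAt_smul, coefAt_dualColumn β hβ q hI]
    simp only [coefAt_single]
    by_cases h1 : (β l).block = q.1.1
    swap
    · rw [if_neg fun h => h1 h.1, mul_zero, Finset.sum_eq_zero, mul_zero]
      intro K _
      rw [if_neg fun h => h1 h.1.symm, mul_zero]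
    by_cases h2 : q.1.2 ∈ (β l).fiber I
    · rw [if_pos ⟨h1, (β l).mem_fiber.1 h2⟩, Finset.sum_eq_single_of_mem q.1.2 h2,
        if_pos ⟨h1.symm, rfl⟩]
      · ring
      · intro K _ hK
        rw [if_neg fun h => hK h.2.symm, mul_zero]
    · rw [if_neg fun h => h2 ((β l).mem_fiber.2 h.2), mul_zero, Finset.sum_eq_zero, mul_zero]
      intro K hK
      rw [if_neg, mul_zero]
      rintro ⟨-, rfl⟩
      exact h2 hK

end BlockSelection

/-! ### Coordinate functionals -/

namespace IsOmegaModel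

variable {X : HaarSystemNorm} {η : Bool → ℝ} {E : Type} [NormedAddCommGroup E] [NormedSpace ℝ E]
  {e : DyadicOmega → E} (he : IsOmegaModel X η e)

include he in
theorem exists_coord (p : DyadicOmega) : ∃ f : StrongDual ℝ E,
    (∀ c, f (Finsupp.linearCombination ℝ e c) = c p) ∧
      ∀ x, |f x| * pointNorm X p.1.2.1 ≤ 2 * ‖x‖ := by
  classical
  have hpos := pointNorm_pos X p.1.2.1
  have hlin : ∀ c : DyadicOmega →₀ ℝ,
      Finsupp.linearCombination ℝ (fun q => if q = p then (1 : ℝ) else 0) c = c p := by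
    intro c
    rw [Finsupp.linearCombination_apply]
    simp only [smul_eq_mul, mul_ite, mul_one, mul_zero]
    rw [Finsupp.sum, Finset.sum_ite_eq']
    split_ifs with h
    · rfl
    · exact (Finsupp.notMem_support_iff.1 h).symm
  obtain ⟨f, h1, h2⟩ := he.exists_extension (fun q => if q = p then (1 : ℝ) else 0)
    (2 / pointNorm X p.1.2.1) fun c => by
      rw [hlin, Real.norm_eq_abs, div_mul_eq_mul_div, le_div_iff₀ hpos]
      exact he.abs_coef_mul_le c p
  refine ⟨f, fun c => (h1 c).trans (hlin c), fun x => ?_⟩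
  have := h2 x
  rwa [Real.norm_eq_abs, div_mul_eq_mul_div, le_div_iff₀ hpos] at this

/-- The coordinate functionals of the vectors of a model. -/
def coord (p : DyadicOmega) : StrongDual ℝ E := (he.exists_coord p).choose

theorem coord_linearCombination (p : DyadicOmega) (c : DyadicOmega →₀ ℝ) :
    he.coord p (Finsupp.linearCombination ℝ e c) = c p := (he.exists_coord p).choose_spec.1 c

theorem abs_coord_mul_le (p : DyadicOmega) (x : E) :
    |he.coord p x| * pointNorm X p.1.2.1 ≤ 2 * ‖x‖ := (he.exists_coord p).choose_spec.2 x

theorem coord_basis (p q : DyadicOmega) : he.coord p (e q) = if q = p then 1 else 0 := by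
  have := he.coord_linearCombination p (Finsupp.single q 1)
  rwa [Finsupp.linearCombination_single, one_smul, Finsupp.single_apply] at this

theorem abs_coord_le (p : DyadicOmega) (x : E) : |he.coord p x| ≤ 2 * 2 ^ p.1.2.1 * ‖x‖ := by
  have h1 := he.abs_coord_mul_le p x
  have h2 := one_le_two_pow_mul_pointNorm X p.1.2.1
  have h3 := mul_le_mul_of_nonneg_left h2 (abs_nonneg (he.coord p x))
  have h4 : (0 : ℝ) < 2 ^ p.1.2.1 := by positivity
  nlinarith

/-- A sequence of selections in different blocks defines a pair of contractions `A` and `B`: `B`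
replaces the basis vectors by signed sums over the selections, and the coordinates of `A x` are
signed averages of the coordinates of `x` over the selections. Hence the matrix of `A T B` consists
of averages of the entries of the matrix of `T`. -/
theorem exists_selection_operators [CompleteSpace E] (β : ℕ → BlockSelection)
    (hβ : StrictMono fun l => (β l).block) : ∃ A B : E →L[ℝ] E, (∀ x, ‖A x‖ ≤ ‖x‖) ∧
      (∀ x, ‖B x‖ ≤ ‖x‖) ∧ (∀ p, B (e p) = (β p.1.1).vec e p.1.2) ∧
      ∀ p x, he.coord p (A x) = (β p.1.1).average he.coord p.1.2 x := by
  obtain ⟨B, hB, hB'⟩ := he.exists_contraction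
    (fun p : DyadicOmega => (β p.1.1).vec (fun q => Finsupp.single q (1 : ℝ)) p.1.2)
    fun c M₀ => ⟨M₀, le_rfl, BlockSelection.cubeHardyNorm_vec_le β hβ X η c M₀⟩
  obtain ⟨A, hA, hA'⟩ := he.exists_contraction (BlockSelection.dualColumn β) fun c M₀ => by
    obtain ⟨M₁, h1⟩ := exists_block_bound c
    exact ⟨max M₀ M₁, le_max_left _ _, BlockSelection.cubeHardyNorm_dualColumn_le β hβ X η c
      (h1 _ (le_max_right _ _))⟩
  refine ⟨A, B, hA', hB', fun p => ?_, fun p => ?_⟩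
  · have h := hB (Finsupp.single p 1)
    rw [Finsupp.linearCombination_single, one_smul, Finsupp.linearCombination_single, one_smul] at h
    rw [h, BlockSelection.map_vec]
    simp
  · have h : (fun x => he.coord p (A x)) = (β p.1.1).average he.coord p.1.2 := by
      refine he.dense.equalizer (by fun_prop) (by fun_prop) (funext fun c => ?_)
      have h1 : (β p.1.1).average he.coord p.1.2 (Finsupp.linearCombination ℝ e c) =
          (β p.1.1).average (fun q => c q) p.1.2 := by
        have := (β p.1.1).map_average
          ((ContinuousLinearMap.apply ℝ ℝ (Finsupp.linearCombination ℝ e c)).toLinearMap :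
            StrongDual ℝ E →ₗ[ℝ] ℝ) he.coord p.1.2
        refine this.trans ?_
        congr 1
        funext q
        exact he.coord_linearCombination q c
      simp only [Function.comp_apply]
      rw [h1, hA, he.coord_linearCombination,
        ← BlockSelection.coefAt_linearCombination_dualColumn β hβ c p.level_le, coefAt_self]
    exact fun x => congrFun h x

end IsOmegaModel

/-! ### Sums over disjoint intervals of one block -/

/-- No path contains two members of the set; for a set of dyadic intervals this means that its
members are pairwise disjoint. -/
def PathDisjoint (P : Finset DyadicInterval) : Prop :=
  ∀ (x : ℕ → Bool) (i k : ℕ), i < k → node x i ∈ P → node x k ∉ P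

theorem eq_node_zero_of_level {I : DyadicInterval} (h : I.1 = 0) (x : ℕ → Bool) :
    I = node x 0 := by
  refine ext_nat h ?_
  have h1 := I.2.2
  have h2 := (node x 0).2.2
  have h3 : (node x 0).1 = 0 := node_level x 0
  have h4 : 2 ^ I.1 = 1 := by rw [h, pow_zero]
  have h5 : 2 ^ (node x 0).1 = 1 := by rw [h3, pow_zero]
  omega

/-- The norm of the sum of `m` Rademacher functions. -/
def rademacherNorm (X : HaarSystemNorm) (η : Bool → ℝ) (m : ℕ) : ℝ :=
  cubeHardyNorm X η fun (_ : Fin m) (_ : Fin m → Bool) => 1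

/-- The root of the tree of dyadic intervals, in the block `0`. -/
def DyadicOmega.bottom : DyadicOmega := DyadicOmega.mk 0 (node (fun _ => false) 0) le_rfl

instance : Nonempty DyadicOmega := ⟨DyadicOmega.bottom⟩

namespace BlockSelection

/-- Disjoint selected intervals of one block, mapped to the interval of the block `0`. -/
def ofDisjoint (N : ℕ) (P : Finset DyadicInterval) (hP : ∀ K ∈ P, K.1 ≤ N)
    (θ : DyadicInterval → Bool) (l : ℕ) : BlockSelection where
  block := N + l
  sel := if l = 0 then P else ∅
  le K hK := by
    split_ifs at hK
    · exact (hP K hK).trans (Nat.le_add_right _ _)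
    · simp at hK
  twist := θ

theorem fiber_ofDisjoint (N : ℕ) {P : Finset DyadicInterval} (hP : ∀ K ∈ P, K.1 ≤ N)
    (hd : PathDisjoint P) (θ : DyadicInterval → Bool) :
    (ofDisjoint N P hP θ 0).fiber DyadicOmega.bottom.1.2 = P := by
  ext K
  rw [mem_fiber]
  change K ∈ P ∧ _ ↔ K ∈ P
  refine and_iff_left_of_imp fun hK => ?_
  refine eq_node_zero_of_level ?_ fun _ => false
  rw [image, img_level, depth]
  refine Nat.count_of_forall_not fun i hi hiP => ?_
  change node K.path i ∈ P at hiP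
  exact hd K.path i K.1 hi hiP (by rwa [node_path])

end BlockSelection

namespace IsOmegaModel

variable {X : HaarSystemNorm} {η : Bool → ℝ} {E : Type} [NormedAddCommGroup E] [NormedSpace ℝ E]
  {e : DyadicOmega → E} (he : IsOmegaModel X η e)

include he in
/-- The operator `B` of a selection of disjoint intervals maps the basis vector of the root, which
has norm `1`, to their signed sum. -/
theorem norm_sum_disjoint_le [CompleteSpace E] (N : ℕ) {P : Finset DyadicInterval}
    (hP : ∀ K ∈ P, K.1 ≤ N) (hd : PathDisjoint P) (θ : DyadicInterval → Bool) :
    ‖∑ K ∈ P, bitSign (θ K) • atBlock e N K‖ ≤ 1 := by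
  obtain ⟨A, B, -, hB, hBe, -⟩ := he.exists_selection_operators
    (BlockSelection.ofDisjoint N P hP θ) fun a b hab => Nat.add_lt_add_left hab N
  have h1 := hBe DyadicOmega.bottom
  have h2 := hB (e DyadicOmega.bottom)
  have h0 : pointNorm X DyadicOmega.bottom.1.2.1 = 1 := pointNorm_zero X
  rw [h1, he.norm_basis, h0, BlockSelection.vec] at h2
  change ‖∑ K ∈ (BlockSelection.ofDisjoint N P hP θ 0).fiber DyadicOmega.bottom.1.2, _‖ ≤ 1 at h2
  rwa [BlockSelection.fiber_ofDisjoint N hP hd θ] at h2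

/-- The operator `A` of a selection of disjoint intervals maps `x` to a vector whose coordinate at
the root is the weighted sum of the coordinates of `x` with appropriate signs. -/
theorem abs_sum_coord_disjoint_le [CompleteSpace E] (N : ℕ) {P : Finset DyadicInterval}
    (hP : ∀ K ∈ P, K.1 ≤ N) (hd : PathDisjoint P) (x : E) :
    ∑ K ∈ P, (2 ^ K.1)⁻¹ * |atBlock he.coord N K x| ≤ 2 * ‖x‖ := by
  obtain ⟨A, B, hA, -, -, hcA⟩ := he.exists_selection_operators
    (BlockSelection.ofDisjoint N P hP fun K => decide (atBlock he.coord N K x < 0))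
    fun a b hab => Nat.add_lt_add_left hab N
  have h1 := hcA DyadicOmega.bottom x
  have h2 := he.abs_coord_mul_le DyadicOmega.bottom (A x)
  have h0 : pointNorm X DyadicOmega.bottom.1.2.1 = 1 := pointNorm_zero X
  rw [h0, mul_one, h1] at h2
  have h3 : (BlockSelection.ofDisjoint N P hP
      (fun K => decide (atBlock he.coord N K x < 0)) 0).average he.coord DyadicOmega.bottom.1.2 x =
      ∑ K ∈ P, (2 ^ K.1)⁻¹ * |atBlock he.coord N K x| := by
    rw [BlockSelection.average, BlockSelection.fiber_ofDisjoint N hP hd]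
    change ((2 : ℝ) ^ 0 • ∑ K ∈ P, _ : StrongDual ℝ E) x = _
    rw [pow_zero, one_smul, sum_apply]
    refine Finset.sum_congr rfl fun K _ => ?_
    change (2 ^ K.1)⁻¹ * bitSign (decide (atBlock he.coord N K x < 0)) *
      atBlock he.coord N K x = _
    rw [mul_assoc]
    congr 1
    by_cases h : atBlock he.coord N K x < 0
    · simp [bitSign, h, abs_of_neg]
    · simp only [bitSign, h, decide_false, Bool.false_eq_true, if_false, one_mul]
      exact (abs_of_nonneg (not_lt.1 h)).symm
  change |(BlockSelection.ofDisjoint N P hP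
      (fun K => decide (atBlock he.coord N K x < 0)) 0).average he.coord
        DyadicOmega.bottom.1.2 x| ≤ _ at h2
  rw [h3] at h2
  exact (le_abs_self _).trans (h2.trans (mul_le_mul_of_nonneg_left (hA x) zero_le_two))

include he in
/-- A sum of vectors of one block, at most one from each level, is a conditional expectation of
a restriction of a sum of Rademacher functions. -/
theorem norm_sum_levels_le (N : ℕ) {m : ℕ} (L : Fin m → DyadicInterval) (hL : ∀ t, (L t).1 ≤ N)
    (hinj : Function.Injective fun t => (L t).1) (θ : Fin m → Bool) :
    ‖∑ t, bitSign (θ t) • atBlock e N (L t)‖ ≤ rademacherNorm X η m := by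
  classical
  set c : DyadicOmega →₀ ℝ :=
    ∑ t, bitSign (θ t) • atBlock (fun q => Finsupp.single q (1 : ℝ)) N (L t) with hc
  have hcoef : ∀ n K, coefAt c n K = ∑ t, if N = n ∧ L t = K then bitSign (θ t) else 0 := by
    intro n K
    rw [hc, coefAt_sum]
    refine Finset.sum_congr rfl fun t _ => ?_
    rw [coefAt_smul, coefAt_atBlock_single (hL t)]
    split_ifs <;> simp
  have hlin : Finsupp.linearCombination ℝ e c = ∑ t, bitSign (θ t) • atBlock e N (L t) := by
    rw [hc, map_sum]
    refine Finset.sum_congr rfl fun t _ => ?_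
    rw [map_smul, atBlock_of_le _ (hL t), atBlock_of_le _ (hL t), Finsupp.linearCombination_single,
      one_smul]
  rw [← hlin, he.norm_eq c (N + 1) fun p hp => ?_]
  swap
  · by_contra h
    refine Finsupp.mem_support_iff.1 hp ?_
    rw [← coefAt_self, hcoef]
    exact Finset.sum_eq_zero fun t _ => if_neg fun h' => h (by omega)
  let C : BitCoupling (Fin (N + 1) × Fin (N + 1)) (Fin m) :=
    { pick := fun x p => if h : N = p.1 ∧ ∃ t, L t = node (row x p.1) p.2 then
        some h.2.choose else none
      twist := fun x p => if h : ∃ t, L t = node (row x p.1) p.2 then θ h.choose else false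
      rank := fun p => p.2
      predictable := by
        intro x x' p h
        rw [node_row_congr fun q _ hq => h q hq]
        exact ⟨rfl, rfl⟩
      injective := by
        intro x p q t hp hq
        split_ifs at hp with hp'
        split_ifs at hq with hq'
        simp only [Option.some.injEq] at hp hq
        have h1 := hp'.2.choose_spec
        have h2 := hq'.2.choose_spec
        rw [hp] at h1
        rw [hq] at h2
        have h3 := congrArg Sigma.fst (h1.symm.trans h2)
        rw [node_level, node_level] at h3
        exact Prod.ext (Fin.ext (hp'.1.symm.trans hq'.1)) (Fin.ext h3) }
  refine C.cubeHardyNorm_le_of_pullback X (fun _ _ => rfl) ?_ ?_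
  · intro x p hp
    rw [treeCoef, hcoef]
    refine Finset.sum_eq_zero fun t _ => if_neg fun h => ?_
    have h' : N = p.1 ∧ ∃ t, L t = node (row x p.1) p.2 := ⟨h.1, t, h.2⟩
    simp [C, dif_pos h'] at hp
  · intro x z p t ht
    have h' : N = p.1 ∧ ∃ t, L t = node (row x p.1) p.2 := by
      by_contra h
      simp [C, dif_neg h] at ht
    simp only [C, dif_pos h', Option.some.injEq] at ht
    have h1 := h'.2.choose_spec
    rw [ht] at h1
    simp only [C, dif_pos h'.2, mul_one, treeCoef, hcoef]
    rw [ht, Finset.sum_eq_single t, if_pos ⟨h'.1, h1⟩]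
    · intro t' _ hne
      rw [if_neg]
      rintro ⟨-, h2⟩
      exact hne (hinj (congrArg Sigma.fst (h2.trans h1.symm)))
    · simp

end IsOmegaModel

/-! ### The Schauder basis -/

namespace DyadicOmega

theorem le_iff {p q : DyadicOmega} : p ≤ q ↔ p.1.1 < q.1.1 ∨ p.1.1 = q.1.1 ∧
    dyadicIndex (some p.1.2) ≤ dyadicIndex (some q.1.2) := Prod.Lex.le_iff

theorem level_lt_of_index_le {I J : DyadicInterval} (h : I.1 < J.1) :
    dyadicIndex (some I) < dyadicIndex (some J) := by
  have h1 := I.2.2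
  have h2 := Nat.pow_le_pow_right (n := 2) (by norm_num) (Nat.succ_le_of_lt h)
  rw [pow_succ] at h2
  simp only [dyadicIndex]
  omega

theorem bottom_le (p : DyadicOmega) : bottom ≤ p := by
  rw [le_iff]
  rcases Nat.eq_zero_or_pos p.1.1 with h | h
  · refine Or.inr ⟨h.symm, ?_⟩
    have h0 : p.1.2.1 = 0 := Nat.le_zero.1 (p.level_le.trans h.le)
    exact (congrArg (fun I => dyadicIndex (some I)) (eq_node_zero_of_level h0 fun _ => false)).ge
  · exact Or.inl h

end DyadicOmega

namespace IsOmegaModel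

variable {X : HaarSystemNorm} {η : Bool → ℝ} {E : Type} [NormedAddCommGroup E] [NormedSpace ℝ E]
  {e : DyadicOmega → E} (he : IsOmegaModel X η e)

include he in
/-- An initial segment of the basis consists of complete levels and of a part of one more level. -/
theorem norm_initial_segment_le (b : DyadicOmega) (c d : DyadicOmega →₀ ℝ)
    (hd : ∀ p, p ≤ b → d p = c p) (hd' : ∀ p, ¬p ≤ b → d p = 0) :
    ‖Finsupp.linearCombination ℝ e d‖ ≤ 3 * ‖Finsupp.linearCombination ℝ e c‖ := by
  classical
  have h1 := he.norm_restrict_le (fun m j => m < b.1.1 ∨ m = b.1.1 ∧ j < b.1.2.1)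
    (fun m j j' hj h => h.imp_right fun h => ⟨h.1, lt_of_le_of_lt hj h.2⟩) c
    (c.filter fun p => p.1.1 < b.1.1 ∨ p.1.1 = b.1.1 ∧ p.1.2.1 < b.1.2.1)
    (fun p hp => Finsupp.filter_apply_pos _ _ hp) fun p hp => Finsupp.filter_apply_neg _ _ hp
  have h2 := he.norm_restrict_subset_level_le b.1.1 b.1.2.1
    (fun p => p ≤ b ∧ p.1.1 = b.1.1 ∧ p.1.2.1 = b.1.2.1) (fun p hp => hp.2) c
    (c.filter fun p => p ≤ b ∧ p.1.1 = b.1.1 ∧ p.1.2.1 = b.1.2.1)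
    (fun p hp => Finsupp.filter_apply_pos _ _ hp) fun p hp => Finsupp.filter_apply_neg _ _ hp
  have h3 : d = (c.filter fun p => p.1.1 < b.1.1 ∨ p.1.1 = b.1.1 ∧ p.1.2.1 < b.1.2.1) +
      c.filter fun p => p ≤ b ∧ p.1.1 = b.1.1 ∧ p.1.2.1 = b.1.2.1 := by
    ext p
    rw [Finsupp.add_apply, Finsupp.filter_apply, Finsupp.filter_apply]
    by_cases hp : p ≤ b
    · rw [hd p hp]
      by_cases hn : p.1.1 = b.1.1
      · rcases lt_trichotomy p.1.2.1 b.1.2.1 with h | h | h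
        · simp [hn, h, h.ne]
        · simp [hn, h, hp]
        · have := DyadicOmega.level_lt_of_index_le h
          rcases DyadicOmega.le_iff.1 hp with h' | h'
          · omega
          · omega
      · have : p.1.1 < b.1.1 := by
          rcases DyadicOmega.le_iff.1 hp with h' | h'
          · exact h'
          · exact absurd h'.1 hn
        simp [hn, this]
    · rw [hd' p hp, if_neg, if_neg fun h => hp h.1, add_zero]
      rintro (h | ⟨h, h'⟩)
      · exact hp (DyadicOmega.le_iff.2 (Or.inl h))
      · exact hp (DyadicOmega.le_iff.2 (Or.inr ⟨h, (DyadicOmega.level_lt_of_index_le h').le⟩))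
  rw [h3, map_add]
  refine (norm_add_le _ _).trans ?_
  linarith

theorem norm_sum_coord_Icc_le (b : DyadicOmega) (x : E) :
    ‖∑ q ∈ Finset.Icc DyadicOmega.bottom b, he.coord q x • e q‖ ≤ 3 * ‖x‖ := by
  classical
  refine he.dense.induction_on (p := fun x => ‖∑ q ∈ Finset.Icc DyadicOmega.bottom b,
    he.coord q x • e q‖ ≤ 3 * ‖x‖) x (isClosed_le (by fun_prop) (by fun_prop)) fun c => ?_
  refine le_trans (le_of_eq ?_) (he.norm_initial_segment_le b c (c.filter fun p => p ≤ b)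
    (fun p hp => Finsupp.filter_apply_pos _ _ hp) fun p hp => Finsupp.filter_apply_neg _ _ hp)
  simp only [he.coord_linearCombination]
  rw [Finsupp.linearCombination_apply, Finsupp.sum]
  congr 1
  symm
  refine Finset.sum_subset_zero_on_sdiff ?_ ?_ ?_
  · intro q hq
    rw [Finsupp.support_filter, Finset.mem_filter] at hq
    exact Finset.mem_Icc.2 ⟨q.bottom_le, hq.2⟩
  · intro q hq
    rw [Finset.mem_sdiff, Finset.mem_Icc, Finsupp.support_filter, Finset.mem_filter] at hq
    rw [Finsupp.notMem_support_iff.1 fun h => hq.2 ⟨h, hq.1.2⟩, zero_smul]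
  · intro q hq
    rw [Finsupp.support_filter, Finset.mem_filter] at hq
    rw [Finsupp.filter_apply_pos (fun p => p ≤ b) _ hq.2]

/-- The partial sums are uniformly bounded and converge on the linear span of the basis. The
convergence is along initial segments, since the index set has a least element. -/
theorem hasSum_coord (x : E) :
    HasSum (fun q => he.coord q x • e q) x (SummationFilter.conditional DyadicOmega) := by
  rw [HasSum, SummationFilter.conditional_filter, tendsto_map'_iff, Metric.tendsto_nhds]
  intro ε hε
  obtain ⟨y, hy⟩ := he.dense.exists_mem_open Metric.isOpen_ball
    ⟨x, Metric.mem_ball_self (x := x) (ε := ε / 4) (by positivity)⟩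
  set z := Finsupp.linearCombination ℝ e y with hz
  rw [Metric.mem_ball, dist_eq_norm] at hy
  obtain ⟨b₀, hb₀⟩ : ∃ b₀, ∀ q ∈ y.support, q ≤ b₀ :=
    Finset.exists_le y.support
  filter_upwards [prod_mem_prod (eventually_le_atBot DyadicOmega.bottom) (eventually_ge_atTop b₀)]
    with ab hab
  obtain ⟨h1, h2⟩ := hab
  have ha : ab.1 = DyadicOmega.bottom := le_antisymm h1 ab.1.bottom_le
  simp only [Function.comp_apply]
  rw [ha, dist_eq_norm]
  have h3 := he.norm_sum_coord_Icc_le ab.2 (x - z)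
  have h4 : ∑ q ∈ Finset.Icc DyadicOmega.bottom ab.2, he.coord q z • e q = z := by
    rw [hz, Finsupp.linearCombination_apply, Finsupp.sum]
    symm
    refine Finset.sum_subset_zero_on_sdiff ?_ ?_ ?_
    · intro q hq
      exact Finset.mem_Icc.2 ⟨q.bottom_le, (hb₀ q hq).trans h2⟩
    · intro q hq
      have := he.coord_linearCombination q y
      rw [Finsupp.linearCombination_apply, Finsupp.sum] at this
      rw [this, Finsupp.notMem_support_iff.1 (Finset.mem_sdiff.1 hq).2, zero_smul]
    · intro q _
      have := he.coord_linearCombination q y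
      rw [Finsupp.linearCombination_apply, Finsupp.sum] at this
      rw [this]
  have h5 : ∑ q ∈ Finset.Icc DyadicOmega.bottom ab.2, he.coord q x • e q - x =
      ∑ q ∈ Finset.Icc DyadicOmega.bottom ab.2, he.coord q (x - z) • e q + (z - x) := by
    simp only [map_sub, sub_smul, Finset.sum_sub_distrib, h4]
    abel
  rw [h5]
  have h6 := norm_add_le (∑ q ∈ Finset.Icc DyadicOmega.bottom ab.2, he.coord q (x - z) • e q) (z - x)
  rw [norm_sub_rev] at h3
  linarith

/-- The vectors of a model, as a Schauder basis. -/
def schauderBasis : GeneralSchauderBasis DyadicOmega ℝ E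
    (SummationFilter.conditional DyadicOmega) where
  basis := e
  coord := he.coord
  ortho i j := by
    rw [he.coord_basis]
    by_cases h : i = j
    · subst h
      simp
    · rw [if_neg (Ne.symm h)]
      simp [h]
  expansion := he.hasSum_coord

/-- The norm is at most the sum of the absolute values of the coordinates, since the basis vectors
have norm at most `1`. -/
theorem norm_le_of_sum_abs_coord_le {y : E} {C : ℝ}
    (h : ∀ F : Finset DyadicOmega, ∑ q ∈ F, |he.coord q y| ≤ C) : ‖y‖ ≤ C := by
  refine le_of_tendsto (he.hasSum_coord y).norm (Eventually.of_forall fun F => ?_)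
  refine (norm_sum_le _ _).trans (le_trans (Finset.sum_le_sum fun q _ => ?_) (h F))
  rw [norm_smul, Real.norm_eq_abs, he.norm_basis]
  exact mul_le_of_le_one_right (abs_nonneg _) (pointNorm_le_one X _)

end IsOmegaModel

/-! ### Random signs -/

/-- The probability that given coordinates have given values. -/
theorem expect_cylinder {Q : Type*} [Fintype Q] [DecidableEq Q] (F : Finset Q) (v : Q → Bool) :
    𝔼 x : Q → Bool, (if ∀ q ∈ F, x q = v q then (1 : ℝ) else 0) = (2 ^ F.card)⁻¹ := by
  induction F using Finset.induction_on with
  | empty => simp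
  | insert q F hq ih =>
    rw [Finset.card_insert_of_notMem hq, pow_succ, mul_inv, ← ih]
    set f : (Q → Bool) → ℝ := fun x => if ∀ r ∈ insert q F, x r = v r then 1 else 0 with hf
    have h : 𝔼 x, (f x + f (Function.update x q (!x q))) =
        𝔼 x : Q → Bool, (if ∀ r ∈ F, x r = v r then (1 : ℝ) else 0) := by
      refine Finset.expect_congr rfl fun x _ => ?_
      have h1 : (∀ r ∈ insert q F, x r = v r) ↔ x q = v q ∧ ∀ r ∈ F, x r = v r :=
        Finset.forall_mem_insert _ _ _
      have h2 : (∀ r ∈ insert q F, Function.update x q (!x q) r = v r) ↔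
          x q ≠ v q ∧ ∀ r ∈ F, x r = v r := by
        rw [Finset.forall_mem_insert, Function.update_self]
        refine and_congr ?_ (forall₂_congr fun r hr => ?_)
        · cases x q <;> cases v q <;> simp
        · rw [Function.update_of_ne]
          rintro rfl
          exact hq hr
      simp only [hf, h1, h2]
      by_cases h3 : x q = v q <;> simp [h3]
    rw [Finset.expect_add_distrib, expect_flip] at h
    linarith

/-- Sums of random signs with predictable coefficients are orthogonal. -/
theorem expect_sq_sum_bitSign {ι : Type*} [Fintype ι] [DecidableEq ι] {rank : ι → ℕ}
    (hrank : Function.Injective rank) (a : ι → (ι → Bool) → ℝ)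
    (ha : ∀ i θ θ', (∀ j, rank j < rank i → θ j = θ' j) → a i θ = a i θ') :
    𝔼 θ : ι → Bool, (∑ i, bitSign (θ i) * a i θ) ^ 2 = ∑ i, 𝔼 θ : ι → Bool, a i θ ^ 2 := by
  have key : ∀ i j, rank i < rank j →
      𝔼 θ : ι → Bool, bitSign (θ i) * a i θ * (bitSign (θ j) * a j θ) = 0 := by
    intro i j hij
    have h := expect_bitSign_mul_eq_zero j (fun θ : ι → Bool => bitSign (θ i) * a i θ * a j θ)
      fun θ => by
        have hne : ∀ k, rank k < rank j → k ≠ j := by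
          rintro k hk rfl
          exact lt_irrefl _ hk
        rw [Function.update_of_ne (hne i hij),
          ha i _ θ fun k hk => Function.update_of_ne (hne k (hk.trans hij)) _ _,
          ha j _ θ fun k hk => Function.update_of_ne (hne k hk) _ _]
    rw [← h]
    exact Finset.expect_congr rfl fun θ _ => by ring
  simp only [sq, Finset.sum_mul_sum, Finset.expect_sum_comm]
  refine Finset.sum_congr rfl fun i _ => ?_
  rw [Finset.sum_eq_single i]
  · refine Finset.expect_congr rfl fun θ _ => ?_
    have := bitSign_mul_self (θ i)
    linear_combination (a i θ * a i θ) * this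
  · intro j _ hj
    rcases lt_or_gt_of_ne (hrank.ne hj) with h | h
    · rw [← key j i h]
      exact Finset.expect_congr rfl fun θ _ => by ring
    · exact key i j h
  · simp

/-- The part of a random bilinear form below the diagonal is a sum of random signs with predictable
coefficients, and so is each of its rows. -/
theorem expect_sq_sum_lower_le {ι : Type*} [Fintype ι] [DecidableEq ι] {rank : ι → ℕ}
    (hrank : Function.Injective rank) (α β : ι → (ι → Bool) → ℝ)
    (hα : ∀ i θ θ', (∀ j, rank j < rank i → θ j = θ' j) → α i θ = α i θ')
    (hβ : ∀ i θ θ', (∀ j, rank j < rank i → θ j = θ' j) → β i θ = β i θ')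
    (hα1 : ∀ i θ, α i θ ^ 2 ≤ 1) (hβ1 : ∀ i θ, β i θ ^ 2 ≤ 1) (s : ι → ι → ℝ) :
    𝔼 θ : ι → Bool, (∑ i, bitSign (θ i) * (α i θ * ∑ j, bitSign (θ j) *
      (β j θ * if rank j < rank i then s i j else 0))) ^ 2 ≤ ∑ i, ∑ j, s i j ^ 2 := by
  rw [expect_sq_sum_bitSign hrank]
  · refine Finset.sum_le_sum fun i _ => ?_
    calc _ ≤ 𝔼 θ : ι → Bool, (∑ j, bitSign (θ j) *
          (β j θ * if rank j < rank i then s i j else 0)) ^ 2 := by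
          refine Finset.expect_le_expect fun θ _ => ?_
          rw [mul_pow]
          exact mul_le_of_le_one_left (sq_nonneg _) (hα1 i θ)
      _ = ∑ j, 𝔼 θ : ι → Bool, (β j θ * if rank j < rank i then s i j else 0) ^ 2 :=
          expect_sq_sum_bitSign hrank _ fun j θ θ' h => by rw [hβ j θ θ' h]
      _ ≤ _ := by
          refine Finset.sum_le_sum fun j _ => ?_
          refine Finset.expect_le Finset.univ_nonempty fun θ _ => ?_
          rw [mul_pow]
          refine (mul_le_of_le_one_left (sq_nonneg _) (hβ1 j θ)).trans ?_
          split_ifs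
          · exact le_rfl
          · simpa using sq_nonneg (s i j)
  · intro i θ θ' h
    rw [hα i θ θ' h]
    congr 1
    refine Finset.sum_congr rfl fun j _ => ?_
    by_cases hj : rank j < rank i
    · rw [h j hj, hβ j θ θ' fun k hk => h k (hk.trans hj)]
    · simp [hj]

/-- Second moment bound for the off-diagonal part of a random bilinear form. -/
theorem expect_sq_offDiag_le {ι : Type*} [Fintype ι] [DecidableEq ι] {rank : ι → ℕ}
    (hrank : Function.Injective rank) (α β : ι → (ι → Bool) → ℝ)
    (hα : ∀ i θ θ', (∀ j, rank j < rank i → θ j = θ' j) → α i θ = α i θ')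
    (hβ : ∀ i θ θ', (∀ j, rank j < rank i → θ j = θ' j) → β i θ = β i θ')
    (hα1 : ∀ i θ, α i θ ^ 2 ≤ 1) (hβ1 : ∀ i θ, β i θ ^ 2 ≤ 1) (s : ι → ι → ℝ) :
    𝔼 θ : ι → Bool, (∑ i, ∑ j, if i = j then 0 else
      bitSign (θ i) * bitSign (θ j) * (α i θ * β j θ * s i j)) ^ 2 ≤ 4 * ∑ i, ∑ j, s i j ^ 2 := by
  have h1 := expect_sq_sum_lower_le hrank α β hα hβ hα1 hβ1 s
  have h2 := expect_sq_sum_lower_le hrank β α hβ hα hβ1 hα1 fun i j => s j i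
  -- The form is the sum of its parts below and above the diagonal.
  have h3 : ∀ θ : ι → Bool, (∑ i, ∑ j, if i = j then 0 else
      bitSign (θ i) * bitSign (θ j) * (α i θ * β j θ * s i j)) =
      (∑ i, bitSign (θ i) * (α i θ * ∑ j, bitSign (θ j) *
        (β j θ * if rank j < rank i then s i j else 0))) +
      ∑ i, bitSign (θ i) * (β i θ * ∑ j, bitSign (θ j) *
        (α j θ * if rank j < rank i then s j i else 0)) := by
    intro θ
    simp only [Finset.mul_sum]
    rw [Finset.sum_comm (f := fun i j => bitSign (θ i) * (β i θ * (bitSign (θ j) *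
        (α j θ * if rank j < rank i then s j i else 0)))), ← Finset.sum_add_distrib]
    refine Finset.sum_congr rfl fun i _ => ?_
    rw [← Finset.sum_add_distrib]
    refine Finset.sum_congr rfl fun j _ => ?_
    by_cases hij : i = j
    · subst hij
      simp
    · rcases lt_or_gt_of_ne (hrank.ne hij) with h | h
      · rw [if_neg hij, if_neg h.not_gt, if_pos h]
        ring
      · rw [if_neg hij, if_neg h.not_gt, if_pos h]
        ring
  simp only [h3]
  rw [Finset.sum_comm] at h2
  calc _ ≤ 𝔼 θ : ι → Bool, (2 * (∑ i, bitSign (θ i) * (α i θ * ∑ j, bitSign (θ j) *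
        (β j θ * if rank j < rank i then s i j else 0))) ^ 2 +
      2 * (∑ i, bitSign (θ i) * (β i θ * ∑ j, bitSign (θ j) *
        (α j θ * if rank j < rank i then s j i else 0))) ^ 2) := by
        refine Finset.expect_le_expect fun θ _ => ?_
        rw [← mul_add]
        exact add_sq_le
    _ ≤ _ := by
        rw [Finset.expect_add_distrib, ← Finset.mul_expect, ← Finset.mul_expect]
        linarith

/-! ### The measure of disjoint unions of dyadic intervals -/

/-- A finite sequence of bits, as an infinite path. -/
def extendPath {M : ℕ} (x : Fin M → Bool) : ℕ → Bool := fun i => if h : i < M then x ⟨i, h⟩ else false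

theorem extendPath_of_lt {M : ℕ} (x : Fin M → Bool) {i : ℕ} (h : i < M) :
    extendPath x i = x ⟨i, h⟩ := dif_pos h

open Classical in
/-- A random path passes through `K` with probability `|K|`. -/
theorem expect_node_eq {M : ℕ} (K : DyadicInterval) (hK : K.1 ≤ M) :
    𝔼 x : Fin M → Bool, (if node (extendPath x) K.1 = K then (1 : ℝ) else 0) = (2 ^ K.1)⁻¹ := by
  have h := expect_cylinder (Finset.univ.map (Fin.castLEEmb hK)) fun q : Fin M => K.path q
  rw [Finset.card_map, Finset.card_univ, Fintype.card_fin] at h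
  rw [← h]
  refine Finset.expect_congr rfl fun x _ => ?_
  suffices hiff : node (extendPath x) K.1 = K ↔
      ∀ q ∈ Finset.univ.map (Fin.castLEEmb hK), x q = K.path q by
    split_ifs with h1 h2 h2
    · rfl
    · exact absurd (hiff.1 h1) h2
    · exact absurd (hiff.2 h2) h1
    · rfl
  have h1 : node (extendPath x) K.1 = K ↔ node (extendPath x) K.1 = node K.path K.1 := by
    rw [node_path]
  rw [h1, node_eq_iff]
  constructor
  · intro h2 q hq
    obtain ⟨i, -, rfl⟩ := Finset.mem_map.1 hq
    have := h2 i i.2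
    rwa [extendPath_of_lt x (i.2.trans_le hK)] at this
  · intro h2 i hi
    rw [extendPath_of_lt x (hi.trans_le hK)]
    exact h2 _ (Finset.mem_map.2 ⟨⟨i, hi⟩, Finset.mem_univ _, rfl⟩)

theorem PathDisjoint.subset {P P' : Finset DyadicInterval} (h : PathDisjoint P) (hs : P' ⊆ P) :
    PathDisjoint P' := fun x i k hik hi hk => h x i k hik (hs hi) (hs hk)

/-- Disjoint subintervals of an interval `W` of level `k₀` have total measure at most `|W|`. -/
theorem PathDisjoint.sum_le {P : Finset DyadicInterval} (hP : PathDisjoint P) {k₀ : ℕ}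
    {W : DyadicInterval} (hW : ∀ K ∈ P, k₀ ≤ K.1 ∧ node K.path k₀ = W) :
    ∑ K ∈ P, ((2 : ℝ) ^ K.1)⁻¹ ≤ (2 ^ k₀)⁻¹ := by
  classical
  rcases P.eq_empty_or_nonempty with rfl | ⟨K₀, hK₀⟩
  · simp
  have hWlev : W.1 = k₀ := by rw [← (hW K₀ hK₀).2, node_level]
  obtain ⟨M, hM⟩ : ∃ M, ∀ K ∈ P, K.1 ≤ M :=
    ⟨P.sup fun K => K.1, fun K hK => Finset.le_sup (f := fun K : DyadicInterval => K.1) hK⟩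
  have hW' := expect_node_eq (M := M) W (by rw [hWlev]; exact (hW K₀ hK₀).1.trans (hM K₀ hK₀))
  rw [hWlev] at hW'
  rw [← hW', Finset.sum_congr rfl fun K hK => (expect_node_eq K (hM K hK)).symm,
    ← Finset.expect_sum_comm]
  refine Finset.expect_le_expect fun x _ => ?_
  by_cases hx : ∃ K ∈ P, node (extendPath x) K.1 = K
  · obtain ⟨K, hK, hxK⟩ := hx
    have h1 : node (extendPath x) k₀ = W := by
      rw [← (hW K hK).2]
      refine node_congr fun i hi => ?_
      have h2 : node (extendPath x) K.1 = node K.path K.1 := by rw [node_path, hxK]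
      exact node_inj h2 i (hi.trans_le (hW K hK).1)
    rw [if_pos h1, Finset.sum_eq_single_of_mem K hK, if_pos hxK]
    intro L hL hLK
    rw [if_neg]
    intro hxL
    rcases lt_trichotomy K.1 L.1 with h | h | h
    · exact hP (extendPath x) _ _ h (by rwa [hxK]) (by rwa [hxL])
    · exact hLK (by rw [← hxL, ← h, hxK])
    · exact hP (extendPath x) _ _ h (by rwa [hxL]) (by rwa [hxK])
  · rw [Finset.sum_eq_zero fun K hK => if_neg fun h => hx ⟨K, hK, h⟩]
    split_ifs <;> norm_num

theorem PathDisjoint.sum_le_one {P : Finset DyadicInterval} (hP : PathDisjoint P) :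
    ∑ K ∈ P, ((2 : ℝ) ^ K.1)⁻¹ ≤ 1 := by
  have := hP.sum_le (k₀ := 0) (W := node (fun _ => false) 0) fun K _ =>
    ⟨Nat.zero_le _, rfl⟩
  simpa using this

/-! ### Matrix entries of operators -/

namespace IsOmegaModel

variable {X : HaarSystemNorm} {η : Bool → ℝ} {E : Type} [NormedAddCommGroup E] [NormedSpace ℝ E]
  {e : DyadicOmega → E} (he : IsOmegaModel X η e)

/-- The matrix entries of an operator in a single block. -/
def entry (T : E →L[ℝ] E) (N : ℕ) (K L : DyadicInterval) : ℝ :=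
  atBlock he.coord N K (T (atBlock e N L))

include he in
theorem norm_atBlock {N : ℕ} {L : DyadicInterval} (hL : L.1 ≤ N) :
    ‖atBlock e N L‖ = pointNorm X L.1 := by
  rw [atBlock_of_le _ hL, he.norm_basis]
  rfl

variable (T : E →L[ℝ] E) (N : ℕ)

/-- The entries are bounded by the ratio of the norms of the Haar functions. -/
theorem abs_entry_mul_le {K L : DyadicInterval} (hK : K.1 ≤ N) (hL : L.1 ≤ N) :
    |he.entry T N K L| * pointNorm X K.1 ≤ 2 * ‖T‖ * pointNorm X L.1 := by
  rw [entry, atBlock_of_le _ hK]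
  refine (he.abs_coord_mul_le (DyadicOmega.mk N K hK) _).trans ?_
  rw [mul_assoc, ← he.norm_atBlock hL]
  exact mul_le_mul_of_nonneg_left (T.le_opNorm _) zero_le_two

variable [CompleteSpace E]

/-- The sum of a row is the coordinate of the image of a signed sum of disjoint Haar functions. -/
theorem sum_abs_entry_row_le {K : DyadicInterval} (hK : K.1 ≤ N) {Q : Finset DyadicInterval}
    (hQ : ∀ L ∈ Q, L.1 ≤ N) (hd : PathDisjoint Q) :
    (∑ L ∈ Q, |he.entry T N K L|) * pointNorm X K.1 ≤ 2 * ‖T‖ := by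
  set θ : DyadicInterval → Bool := fun L => decide (he.entry T N K L < 0)
  have h1 := he.norm_sum_disjoint_le N hQ hd θ
  have h2 := he.abs_coord_mul_le (DyadicOmega.mk N K hK)
    (T (∑ L ∈ Q, bitSign (θ L) • atBlock e N L))
  have h3 : he.coord (DyadicOmega.mk N K hK) (T (∑ L ∈ Q, bitSign (θ L) • atBlock e N L)) =
      ∑ L ∈ Q, |he.entry T N K L| := by
    simp only [map_sum, map_smul]
    refine Finset.sum_congr rfl fun L _ => ?_
    have h4 : he.coord (DyadicOmega.mk N K hK) (T (atBlock e N L)) = he.entry T N K L := by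
      rw [entry, atBlock_of_le _ hK]
    rw [h4, smul_eq_mul]
    by_cases h : he.entry T N K L < 0
    · simp [θ, bitSign, h, abs_of_neg]
    · simp only [θ, bitSign, h, decide_false, Bool.false_eq_true, if_false, one_mul]
      exact (abs_of_nonneg (not_lt.1 h)).symm
  rw [h3, abs_of_nonneg (Finset.sum_nonneg fun _ _ => abs_nonneg _)] at h2
  refine h2.trans (mul_le_mul_of_nonneg_left ?_ zero_le_two)
  refine (T.le_opNorm _).trans ?_
  exact mul_le_of_le_one_right (norm_nonneg _) h1

/-- The weighted sum of a column is bounded by the norm of the image of a Haar function. -/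
theorem sum_abs_entry_col_le {L : DyadicInterval} (hL : L.1 ≤ N) {P : Finset DyadicInterval}
    (hP : ∀ K ∈ P, K.1 ≤ N) (hd : PathDisjoint P) :
    ∑ K ∈ P, (2 ^ K.1)⁻¹ * |he.entry T N K L| ≤ 2 * ‖T‖ * pointNorm X L.1 := by
  refine (he.abs_sum_coord_disjoint_le N hP hd _).trans ?_
  rw [mul_assoc, ← he.norm_atBlock hL]
  exact mul_le_mul_of_nonneg_left (T.le_opNorm _) zero_le_two

/-- The weighted Hilbert-Schmidt sum of the entries indexed by two families of disjoint
intervals. -/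
def entrySum (P Q : Finset DyadicInterval) : ℝ :=
  ∑ K ∈ P, ∑ L ∈ Q, ((2 ^ K.1)⁻¹ * he.entry T N K L) ^ 2

/-- If `‖χ_I‖` is bounded below, the row sums of the entries are bounded. -/
theorem entrySum_le_of_le_pointNorm {c : ℝ} (hc : 0 < c) (hφ : ∀ k, c ≤ pointNorm X k)
    {P Q : Finset DyadicInterval} (hP : ∀ K ∈ P, K.1 ≤ N) (hQ : ∀ L ∈ Q, L.1 ≤ N)
    (hPd : PathDisjoint P) (hQd : PathDisjoint Q) {k₀ : ℕ} (hP₀ : ∀ K ∈ P, k₀ ≤ K.1) :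
    he.entrySum T N P Q ≤ ‖T‖ ^ 2 * ((2 / c) ^ 2 * (2 ^ k₀)⁻¹) := by
  have hΓ := norm_nonneg T
  have hrow : ∀ K ∈ P, ∑ L ∈ Q, ((2 ^ K.1)⁻¹ * he.entry T N K L) ^ 2 ≤
      (2 ^ K.1)⁻¹ * ((2 ^ k₀)⁻¹ * (2 * ‖T‖ / c) ^ 2) := by
    intro K hK
    have h1 : ∑ L ∈ Q, |he.entry T N K L| ≤ 2 * ‖T‖ / c := by
      rw [le_div_iff₀ hc]
      exact (mul_le_mul_of_nonneg_left (hφ _) (Finset.sum_nonneg fun _ _ => abs_nonneg _)).trans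
        (he.sum_abs_entry_row_le T N (hP K hK) hQ hQd)
    have h2 : ∑ L ∈ Q, ((2 ^ K.1)⁻¹ * he.entry T N K L) ^ 2 ≤
        ∑ L ∈ Q, ((2 : ℝ) ^ K.1)⁻¹ * ((2 ^ k₀)⁻¹ * (2 * ‖T‖ / c) * |he.entry T N K L|) := by
      refine Finset.sum_le_sum fun L hL => ?_
      have h3 : |he.entry T N K L| ≤ 2 * ‖T‖ / c :=
        (Finset.single_le_sum (f := fun L => |he.entry T N K L|) (fun _ _ => abs_nonneg _) hL).trans
          h1
      have h4 : ((2 : ℝ) ^ K.1)⁻¹ ≤ (2 ^ k₀)⁻¹ := by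
        gcongr
        · norm_num
        · exact hP₀ K hK
      rw [mul_pow, ← sq_abs (he.entry T N K L), sq, sq, mul_assoc]
      refine mul_le_mul_of_nonneg_left ?_ (by positivity)
      rw [← mul_assoc]
      gcongr
    refine h2.trans ?_
    rw [← Finset.mul_sum, ← Finset.mul_sum]
    have : (2 ^ k₀)⁻¹ * (2 * ‖T‖ / c) * ∑ L ∈ Q, |he.entry T N K L| ≤
        (2 ^ k₀)⁻¹ * (2 * ‖T‖ / c) ^ 2 := by
      rw [sq, ← mul_assoc]
      gcongr
    gcongr
  refine (Finset.sum_le_sum hrow).trans ?_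
  rw [← Finset.sum_mul]
  refine (mul_le_of_le_one_left (by positivity) hPd.sum_le_one).trans (le_of_eq ?_)
  ring

/-- A bound which is small if `‖χ_I‖` tends to zero, but more slowly than `|I|`: the entries with
`|L| ≥ |K|` are summed along columns and the other ones along rows. -/
theorem entrySum_le_of_pos {P Q : Finset DyadicInterval} (hP : ∀ K ∈ P, K.1 ≤ N)
    (hQ : ∀ L ∈ Q, L.1 ≤ N) (hPd : PathDisjoint P) (hQd : PathDisjoint Q) {k₀ : ℕ}
    (hP₀ : ∀ K ∈ P, k₀ ≤ K.1) (hQ₀ : ∀ L ∈ Q, k₀ ≤ L.1) :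
    he.entrySum T N P Q ≤
      ‖T‖ ^ 2 * (4 * (pointNorm X k₀ + (2 ^ k₀ * pointNorm X k₀)⁻¹)) := by
  have hΓ := norm_nonneg T
  have hterm : ∀ K ∈ P, ∀ L ∈ Q, ((2 ^ K.1)⁻¹ * he.entry T N K L) ^ 2 ≤
      2 * ‖T‖ * (2 ^ L.1)⁻¹ * ((2 ^ K.1)⁻¹ * |he.entry T N K L|) +
      2 * ‖T‖ * ((2 ^ K.1)⁻¹ * (2 ^ K.1)⁻¹) * |he.entry T N K L| := by
    intro K hK L hL
    have hφ := pointNorm_pos X K.1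
    have hφ' := pointNorm_pos X L.1
    have h1 := he.abs_entry_mul_le T N (hP K hK) (hQ L hL)
    have ht := abs_nonneg (he.entry T N K L)
    rw [mul_pow, ← sq_abs (he.entry T N K L)]
    rcases le_total L.1 K.1 with h | h
    · -- here the entry is at most `2‖T‖ φ_l / φ_k`, and `2^k φ_k ≥ 2^l φ_l`
      have h2 := two_pow_mul_pointNorm_monotone X h
      dsimp only at h2
      have h3 : (2 ^ K.1)⁻¹ * |he.entry T N K L| ≤ 2 * ‖T‖ * (2 ^ L.1)⁻¹ := by
        rw [inv_mul_le_iff₀ (by positivity), ← mul_assoc, ← div_eq_mul_inv,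
          le_div_iff₀ (by positivity)]
        have h4 : |he.entry T N K L| * 2 ^ L.1 * pointNorm X L.1 ≤
            2 ^ K.1 * (2 * ‖T‖) * pointNorm X L.1 := by
          calc |he.entry T N K L| * 2 ^ L.1 * pointNorm X L.1
              = |he.entry T N K L| * (2 ^ L.1 * pointNorm X L.1) := by ring
            _ ≤ |he.entry T N K L| * (2 ^ K.1 * pointNorm X K.1) := by gcongr
            _ = 2 ^ K.1 * (|he.entry T N K L| * pointNorm X K.1) := by ring
            _ ≤ 2 ^ K.1 * (2 * ‖T‖ * pointNorm X L.1) := by gcongr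
            _ = _ := by ring
        exact le_of_mul_le_mul_right h4 hφ'
      have h5 : ((2 ^ K.1)⁻¹) ^ 2 * |he.entry T N K L| ^ 2 =
          (2 ^ K.1)⁻¹ * |he.entry T N K L| * ((2 ^ K.1)⁻¹ * |he.entry T N K L|) := by ring
      rw [h5]
      have h6 := mul_le_mul_of_nonneg_right h3
        (show (0 : ℝ) ≤ (2 ^ K.1)⁻¹ * |he.entry T N K L| by positivity)
      have h7 : 0 ≤ 2 * ‖T‖ * (((2 : ℝ) ^ K.1)⁻¹ * (2 ^ K.1)⁻¹) * |he.entry T N K L| := by positivity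
      linarith
    · -- here the entry is at most `2‖T‖`, since `φ_l ≤ φ_k`
      have h2 := pointNorm_antitone X h
      have h3 : |he.entry T N K L| ≤ 2 * ‖T‖ := by
        refine le_of_mul_le_mul_right (h1.trans ?_) hφ
        gcongr
      have h5 : ((2 ^ K.1)⁻¹) ^ 2 * |he.entry T N K L| ^ 2 =
          (2 ^ K.1)⁻¹ * (2 ^ K.1)⁻¹ * |he.entry T N K L| * |he.entry T N K L| := by ring
      have h6 : (2 ^ K.1)⁻¹ * (2 ^ K.1)⁻¹ * |he.entry T N K L| * |he.entry T N K L| ≤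
          (2 ^ K.1)⁻¹ * (2 ^ K.1)⁻¹ * (2 * ‖T‖) * |he.entry T N K L| := by gcongr
      have h7 : 0 ≤ 2 * ‖T‖ * ((2 : ℝ) ^ L.1)⁻¹ * ((2 ^ K.1)⁻¹ * |he.entry T N K L|) := by positivity
      rw [h5]
      linarith
  have hsum : he.entrySum T N P Q ≤
      ∑ L ∈ Q, 2 * ‖T‖ * (2 ^ L.1)⁻¹ * ∑ K ∈ P, (2 ^ K.1)⁻¹ * |he.entry T N K L| +
      ∑ K ∈ P, 2 * ‖T‖ * ((2 ^ K.1)⁻¹ * (2 ^ K.1)⁻¹) * ∑ L ∈ Q, |he.entry T N K L| := by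
    refine (Finset.sum_le_sum fun K hK => Finset.sum_le_sum (hterm K hK)).trans (le_of_eq ?_)
    simp only [Finset.mul_sum, Finset.sum_add_distrib]
    rw [Finset.sum_comm]
  have h1 : ∑ L ∈ Q, 2 * ‖T‖ * ((2 : ℝ) ^ L.1)⁻¹ * ∑ K ∈ P, (2 ^ K.1)⁻¹ * |he.entry T N K L| ≤
      4 * ‖T‖ ^ 2 * pointNorm X k₀ := by
    calc _ ≤ ∑ L ∈ Q, ((2 : ℝ) ^ L.1)⁻¹ * (4 * ‖T‖ ^ 2 * pointNorm X k₀) := by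
          refine Finset.sum_le_sum fun L hL => ?_
          have h2 := he.sum_abs_entry_col_le T N (hQ L hL) hP hPd
          have h3 := pointNorm_antitone X (hQ₀ L hL)
          calc _ ≤ 2 * ‖T‖ * ((2 : ℝ) ^ L.1)⁻¹ * (2 * ‖T‖ * pointNorm X k₀) := by
                gcongr
                exact h2.trans (by gcongr)
            _ = _ := by ring
      _ ≤ _ := by
          rw [← Finset.sum_mul]
          have := pointNorm_nonneg X k₀
          exact mul_le_of_le_one_left (by positivity) hQd.sum_le_one
  have h2 : ∑ K ∈ P, 2 * ‖T‖ * (((2 : ℝ) ^ K.1)⁻¹ * (2 ^ K.1)⁻¹) * ∑ L ∈ Q, |he.entry T N K L| ≤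
      4 * ‖T‖ ^ 2 * (2 ^ k₀ * pointNorm X k₀)⁻¹ := by
    have ha := pointNorm_pos X k₀
    calc _ ≤ ∑ K ∈ P, ((2 : ℝ) ^ K.1)⁻¹ * (4 * ‖T‖ ^ 2 * (2 ^ k₀ * pointNorm X k₀)⁻¹) := by
          refine Finset.sum_le_sum fun K hK => ?_
          have h3 := he.sum_abs_entry_row_le T N (hP K hK) hQ hQd
          have h4 := two_pow_mul_pointNorm_monotone X (hP₀ K hK)
          dsimp only at h4
          have hφ := pointNorm_pos X K.1
          rw [← le_div_iff₀ hφ] at h3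
          calc _ ≤ 2 * ‖T‖ * (((2 : ℝ) ^ K.1)⁻¹ * (2 ^ K.1)⁻¹) * (2 * ‖T‖ / pointNorm X K.1) := by
                gcongr
            _ = ((2 : ℝ) ^ K.1)⁻¹ * (4 * ‖T‖ ^ 2 * (2 ^ K.1 * pointNorm X K.1)⁻¹) := by
                rw [mul_inv, div_eq_mul_inv]
                ring
            _ ≤ _ := by gcongr
      _ ≤ _ := by
          rw [← Finset.sum_mul]
          exact mul_le_of_le_one_left (by positivity) hPd.sum_le_one
  refine hsum.trans ((add_le_add h1 h2).trans (le_of_eq ?_))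
  ring

/-- If `‖χ_I‖` is comparable to `|I|`, the weighted column sums of the entries are bounded by
multiples of `|L|`. -/
theorem entrySum_le_of_pointNorm_le {C : ℝ} (hφ : ∀ k, 2 ^ k * pointNorm X k ≤ C)
    {P Q : Finset DyadicInterval} (hP : ∀ K ∈ P, K.1 ≤ N) (hQ : ∀ L ∈ Q, L.1 ≤ N)
    (hPd : PathDisjoint P) (hQd : PathDisjoint Q) {k₀ : ℕ} (hQ₀ : ∀ L ∈ Q, k₀ ≤ L.1) :
    he.entrySum T N P Q ≤ ‖T‖ ^ 2 * (4 * C ^ 2 * (2 ^ k₀)⁻¹) := by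
  have hΓ := norm_nonneg T
  have hC : 0 ≤ C := (pointNorm_nonneg X 0).trans (by simpa using hφ 0)
  rw [entrySum, Finset.sum_comm]
  have hcol : ∀ L ∈ Q, ∑ K ∈ P, ((2 ^ K.1)⁻¹ * he.entry T N K L) ^ 2 ≤
      (2 ^ L.1)⁻¹ * ((2 ^ k₀)⁻¹ * (2 * ‖T‖ * C) ^ 2) := by
    intro L hL
    have hφL : pointNorm X L.1 ≤ C * (2 ^ L.1)⁻¹ := by
      rw [← div_eq_mul_inv, le_div_iff₀ (by positivity), mul_comm]
      exact hφ _
    have h1 : ∑ K ∈ P, (2 ^ K.1)⁻¹ * |he.entry T N K L| ≤ 2 * ‖T‖ * C * (2 ^ L.1)⁻¹ := by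
      refine (he.sum_abs_entry_col_le T N (hQ L hL) hP hPd).trans ?_
      rw [mul_assoc _ C]
      gcongr
    have h2 : ∀ K ∈ P, (2 ^ K.1)⁻¹ * |he.entry T N K L| ≤ 2 * ‖T‖ * C * (2 ^ L.1)⁻¹ := fun K hK =>
      (Finset.single_le_sum (f := fun K => (2 ^ K.1)⁻¹ * |he.entry T N K L|)
        (fun _ _ => by positivity) hK).trans h1
    calc _ ≤ ∑ K ∈ P, 2 * ‖T‖ * C * (2 ^ L.1)⁻¹ * ((2 ^ K.1)⁻¹ * |he.entry T N K L|) := by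
          refine Finset.sum_le_sum fun K hK => ?_
          rw [mul_pow, ← sq_abs (he.entry T N K L), ← mul_pow, sq]
          have := h2 K hK
          gcongr
      _ ≤ 2 * ‖T‖ * C * (2 ^ L.1)⁻¹ * (2 * ‖T‖ * C * (2 ^ L.1)⁻¹) := by
          rw [← Finset.mul_sum]
          gcongr
      _ = (2 ^ L.1)⁻¹ * ((2 ^ L.1)⁻¹ * (2 * ‖T‖ * C) ^ 2) := by ring
      _ ≤ _ := by
          have h4 : ((2 : ℝ) ^ L.1)⁻¹ ≤ (2 ^ k₀)⁻¹ := by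
            gcongr
            · norm_num
            · exact hQ₀ L hL
          gcongr
  refine (Finset.sum_le_sum hcol).trans ?_
  rw [← Finset.sum_mul]
  refine (mul_le_of_le_one_left (by positivity) hQd.sum_le_one).trans (le_of_eq ?_)
  ring

include he in
/-- The entries on disjoint families of short intervals are uniformly small in the weighted
Hilbert-Schmidt sense: since `‖χ_I‖` is nonincreasing and `2^k ‖χ_I‖`, `|I| = 2^{-k}`, is
nondecreasing, one of the three preceding bounds applies. -/
theorem exists_entrySum_le {ε : ℝ} (hε : 0 < ε) : ∃ k₁, ∀ k₀ ≥ k₁, ∀ (T : E →L[ℝ] E) (N : ℕ)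
    (P Q : Finset DyadicInterval), (∀ K ∈ P, K.1 ≤ N) → (∀ L ∈ Q, L.1 ≤ N) → PathDisjoint P →
    PathDisjoint Q → (∀ K ∈ P, k₀ ≤ K.1) → (∀ L ∈ Q, k₀ ≤ L.1) →
    he.entrySum T N P Q ≤ ‖T‖ ^ 2 * ε := by
  have hpow : ∀ C : ℝ, ∃ k₁ : ℕ, ∀ k₀ ≥ k₁, C * ((2 : ℝ) ^ k₀)⁻¹ ≤ ε := by
    intro C
    have : Tendsto (fun k : ℕ => C * ((2 : ℝ) ^ k)⁻¹) atTop (𝓝 (C * 0)) := by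
      refine Tendsto.const_mul _ ?_
      exact tendsto_inv_atTop_zero.comp (tendsto_pow_atTop_atTop_of_one_lt one_lt_two)
    rw [mul_zero] at this
    obtain ⟨k₁, h⟩ := eventually_atTop.1 (this.eventually (gt_mem_nhds hε))
    exact ⟨k₁, fun k₀ hk => (h k₀ hk).le⟩
  by_cases hc : ∃ c > 0, ∀ k, c ≤ pointNorm X k
  · obtain ⟨c, hc, hφ⟩ := hc
    obtain ⟨k₁, hk₁⟩ := hpow ((2 / c) ^ 2)
    refine ⟨k₁, fun k₀ hk T N P Q hP hQ hPd hQd hP₀ _ => ?_⟩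
    refine (he.entrySum_le_of_le_pointNorm T N hc hφ hP hQ hPd hQd hP₀).trans ?_
    exact mul_le_mul_of_nonneg_left (hk₁ k₀ hk) (sq_nonneg _)
  · by_cases hC : ∃ C, ∀ k, 2 ^ k * pointNorm X k ≤ C
    · obtain ⟨C, hφ⟩ := hC
      obtain ⟨k₁, hk₁⟩ := hpow (4 * C ^ 2)
      refine ⟨k₁, fun k₀ hk T N P Q hP hQ hPd hQd _ hQ₀ => ?_⟩
      refine (he.entrySum_le_of_pointNorm_le T N hφ hP hQ hPd hQd hQ₀).trans ?_
      exact mul_le_mul_of_nonneg_left (hk₁ k₀ hk) (sq_nonneg _)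
    · push Not at hc hC
      obtain ⟨k₁, hk₁⟩ := hc (ε / 8) (by positivity)
      obtain ⟨k₂, hk₂⟩ := hC (8 / ε)
      refine ⟨max k₁ k₂, fun k₀ hk T N P Q hP hQ hPd hQd hP₀ hQ₀ => ?_⟩
      refine (he.entrySum_le_of_pos T N hP hQ hPd hQd hP₀ hQ₀).trans ?_
      refine mul_le_mul_of_nonneg_left ?_ (sq_nonneg _)
      have h1 := pointNorm_antitone X ((le_max_left _ _).trans hk)
      have h2 := two_pow_mul_pointNorm_monotone X ((le_max_right _ _).trans hk)
      dsimp only at h2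
      have h3 : (2 ^ k₀ * pointNorm X k₀)⁻¹ ≤ (8 / ε)⁻¹ :=
        inv_anti₀ (by positivity) (hk₂.le.trans h2)
      rw [inv_div] at h3
      linarith

end IsOmegaModel

/-! ### Layers of a set of dyadic intervals -/

namespace DyadicInterval

/-- The number of members of `S` of level less than `k` along the path `x`. -/
def pathDepth (S : Finset DyadicInterval) (x : ℕ → Bool) (k : ℕ) : ℕ :=
  Nat.count (fun i => node x i ∈ S) k

/-- The number of members of `S` which strictly contain `K`. -/
def depthIn (S : Finset DyadicInterval) (K : DyadicInterval) : ℕ := pathDepth S K.path K.1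

/-- The members of `S` which are strictly contained in exactly `j` members of `S`. -/
def layer (S : Finset DyadicInterval) (j : ℕ) : Finset DyadicInterval :=
  S.filter fun K => depthIn S K = j

theorem mem_layer {S : Finset DyadicInterval} {j : ℕ} {K : DyadicInterval} :
    K ∈ layer S j ↔ K ∈ S ∧ depthIn S K = j := Finset.mem_filter

theorem pathDepth_succ (S : Finset DyadicInterval) (x : ℕ → Bool) (k : ℕ) :
    pathDepth S x (k + 1) = pathDepth S x k + if node x k ∈ S then 1 else 0 := Nat.count_succ _ _

theorem pathDepth_congr (S : Finset DyadicInterval) {x y : ℕ → Bool} {k : ℕ}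
    (h : ∀ i < k, x i = y i) : pathDepth S x k = pathDepth S y k := by
  induction k with
  | zero => rfl
  | succ k ih =>
    rw [pathDepth_succ, pathDepth_succ, ih fun i hi => h i (by omega),
      node_congr fun i hi => h i (Nat.lt_succ_of_lt hi)]

theorem node_path_node (x : ℕ → Bool) (k : ℕ) : node (node x k).path k = node x k := by
  have := node_path (node x k)
  rwa [node_level] at this

theorem depthIn_node (S : Finset DyadicInterval) (x : ℕ → Bool) (k : ℕ) :
    depthIn S (node x k) = pathDepth S x k := by
  rw [depthIn, node_level]
  exact pathDepth_congr S (node_inj (node_path_node x k))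

theorem pathDisjoint_layer (S : Finset DyadicInterval) (j : ℕ) : PathDisjoint (layer S j) := by
  intro x i k hik hi hk
  rw [mem_layer, depthIn_node] at hi hk
  have h : pathDepth S x (i + 1) ≤ pathDepth S x k := Nat.count_monotone _ hik
  rw [pathDepth_succ, if_pos hi.1] at h
  omega

open Classical in
/-- The members of `S` in layers with numbers in `J`. -/
def layers (S : Finset DyadicInterval) (J : Finset ℕ) : Finset DyadicInterval :=
  S.filter fun K => depthIn S K ∈ J

theorem mem_layers {S : Finset DyadicInterval} {J : Finset ℕ} {K : DyadicInterval} :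
    K ∈ layers S J ↔ K ∈ S ∧ depthIn S K ∈ J := by
  rw [layers, Finset.mem_filter]

theorem pathDepth_layers (S : Finset DyadicInterval) (J : Finset ℕ) (x : ℕ → Bool) (k : ℕ) :
    pathDepth (layers S J) x k = Nat.count (· ∈ J) (pathDepth S x k) := by
  induction k with
  | zero => simp [pathDepth]
  | succ k ih =>
    rw [pathDepth_succ, pathDepth_succ, ih]
    by_cases h : node x k ∈ S
    · rw [if_pos h, Nat.count_succ]
      simp only [mem_layers, h, true_and, depthIn_node]
    · rw [if_neg h, if_neg fun h' => h (mem_layers.1 h').1, add_zero, add_zero]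

/-- The layers of the union of some layers of `S` are layers of `S`. -/
theorem layer_layers (S : Finset DyadicInterval) (J : Finset ℕ) {i : ℕ} (hi : i < J.card) :
    layer (layers S J) i = layer S (Nat.nth (· ∈ J) i) := by
  have hJ : ∀ hf : (Set.ofPred fun j => j ∈ J).Finite, i < hf.toFinset.card := by
    intro hf
    have : hf.toFinset = J := by ext; simp
    rwa [this]
  ext K
  have hdepth : depthIn (layers S J) K = Nat.count (· ∈ J) (depthIn S K) :=
    pathDepth_layers S J K.path K.1
  rw [mem_layer, mem_layers, mem_layer, hdepth]
  constructor
  · rintro ⟨⟨h1, h2⟩, rfl⟩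
    exact ⟨h1, (Nat.nth_count (p := (· ∈ J)) h2).symm⟩
  · rintro ⟨h1, h2⟩
    refine ⟨⟨h1, ?_⟩, ?_⟩
    · rw [h2]
      exact Nat.nth_mem i hJ
    · rw [h2]
      exact Nat.count_nth hJ

theorem nth_mem_of_lt_card (J : Finset ℕ) {i : ℕ} (hi : i < J.card) : Nat.nth (· ∈ J) i ∈ J := by
  refine Nat.nth_mem i fun hf => ?_
  have : hf.toFinset = J := by ext; simp
  rwa [this]

/-- The dyadic intervals of level at most `n`. -/
def upTo (n : ℕ) : Finset DyadicInterval := (Finset.range (n + 1)).biUnion level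

theorem mem_upTo {n : ℕ} {I : DyadicInterval} : I ∈ upTo n ↔ I.1 ≤ n := by
  rw [upTo, Finset.mem_biUnion]
  constructor
  · rintro ⟨k, hk, hI⟩
    rw [mem_level.1 hI]
    exact Nat.lt_succ_iff.1 (Finset.mem_range.1 hk)
  · intro h
    exact ⟨I.1, Finset.mem_range.2 (Nat.lt_succ_of_le h), mem_level.2 rfl⟩

end DyadicInterval

namespace BlockSelection

variable (s : BlockSelection)

theorem image_level (K : DyadicInterval) : (s.image K).1 = depthIn s.sel K := s.img_level _ _

theorem fiber_subset_layer (I : DyadicInterval) : s.fiber I ⊆ layer s.sel I.1 := by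
  intro K hK
  rw [mem_fiber] at hK
  rw [mem_layer, ← s.image_level, hK.2]
  exact ⟨hK.1, rfl⟩

/-- The path is mapped to the path `w` if and only if its bits at the selected intervals, changed
by the twist, are the bits of `w`. -/
theorem img_eq_node_iff (x w : ℕ → Bool) (k : ℕ) : s.img x k = node w (s.depth x k) ↔
    ∀ i < k, node x i ∈ s.sel → xor (s.twist (node x i)) (x i) = w (s.depth x i) := by
  induction k with
  | zero => simp [img, depth_zero, node]
  | succ k ih =>
    rw [Nat.forall_lt_succ_right, ← ih, img, depth_succ]
    by_cases h : node x k ∈ s.sel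
    · rw [if_pos h, if_pos h, node]
      constructor
      · intro h1
        obtain ⟨h2, h3⟩ := child_injective h1
        exact ⟨h2, fun _ => h3⟩
      · rintro ⟨h2, h3⟩
        rw [h2, h3 h]
    · rw [if_neg h, if_neg h, add_zero]
      exact ⟨fun h1 => ⟨h1, fun h2 => absurd h2 h⟩, fun h1 => h1.1⟩

/-- The image of `K` is determined by the signs at the selected intervals which contain `K`. -/
theorem image_eq_iff {K I : DyadicInterval} (hK : depthIn s.sel K = I.1) :
    s.image K = I ↔ ∀ i < K.1, node K.path i ∈ s.sel →
      s.twist (node K.path i) = xor (K.path i) (I.path (pathDepth s.sel K.path i)) := by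
  have h := s.img_eq_node_iff K.path I.path K.1
  have h1 : s.depth K.path K.1 = I.1 := hK
  rw [h1, node_path] at h
  refine h.trans (forall₃_congr fun i _ _ => ?_)
  change xor _ _ = I.path (pathDepth s.sel K.path i) ↔ _
  cases s.twist (node K.path i) <;> cases K.path i <;>
    cases I.path (pathDepth s.sel K.path i) <;> simp

end BlockSelection

/-! ### Random selections -/

/-- The selection of all intervals in `S`, with signs `θ`. -/
def signedSelection {S : Finset DyadicInterval} {N : ℕ} (hS : ∀ K ∈ S, K.1 ≤ N)
    (θ : {K // K ∈ S} → Bool) : BlockSelection where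
  block := N
  sel := S
  le := hS
  twist K := if h : K ∈ S then θ ⟨K, h⟩ else false

section

variable {S : Finset DyadicInterval} {N : ℕ} (hS : ∀ K ∈ S, K.1 ≤ N)

theorem twist_signedSelection (θ : {K // K ∈ S} → Bool) (K : {K // K ∈ S}) :
    (signedSelection hS θ).twist K = θ K := dif_pos K.2

open Classical in
/-- The members of `S` which strictly contain `K`. -/
def strictAncestors (S : Finset DyadicInterval) (K : DyadicInterval) : Finset {K // K ∈ S} :=
  Finset.univ.filter fun L => L.1.1 < K.1 ∧ node K.path L.1.1 = L

theorem mem_strictAncestors {K : DyadicInterval} {L : {K // K ∈ S}} :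
    L ∈ strictAncestors S K ↔ L.1.1 < K.1 ∧ node K.path L.1.1 = L := by
  simp [strictAncestors]

theorem card_strictAncestors (K : DyadicInterval) : (strictAncestors S K).card = depthIn S K := by
  classical
  rw [depthIn, pathDepth, Nat.count_eq_card_filter_range]
  refine Finset.card_bij (fun L _ => L.1.1) ?_ ?_ ?_
  · intro L hL
    rw [mem_strictAncestors] at hL
    rw [Finset.mem_filter, Finset.mem_range, hL.2]
    exact ⟨hL.1, L.2⟩
  · intro L hL L' hL' h
    rw [mem_strictAncestors] at hL hL'
    rw [Subtype.ext_iff, ← hL.2, ← hL'.2, h]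
  · intro i hi
    rw [Finset.mem_filter, Finset.mem_range] at hi
    refine ⟨⟨node K.path i, hi.2⟩, mem_strictAncestors.2 ?_, node_level _ _⟩
    simp only [node_level]
    exact ⟨hi.1, trivial⟩

/-- The event that `K` has image `I` prescribes the signs of all members of `S` which strictly
contain `K`, and depends on no other sign. -/
theorem image_signedSelection_eq_iff (θ : {K // K ∈ S} → Bool) {K I : DyadicInterval}
    (hK : depthIn S K = I.1) : (signedSelection hS θ).image K = I ↔
      ∀ L ∈ strictAncestors S K, θ L = xor (K.path L.1.1) (I.path (depthIn S L)) := by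
  rw [(signedSelection hS θ).image_eq_iff hK]
  constructor
  · intro h L hL
    rw [mem_strictAncestors] at hL
    have := h L.1.1 hL.1 (by rw [hL.2]; exact L.2)
    rw [hL.2, twist_signedSelection] at this
    rw [this]
    change _ = xor _ (I.path (depthIn S L))
    congr 2
    change pathDepth S K.path L.1.1 = _
    rw [← depthIn_node, hL.2]
  · intro h i hi hiS
    have := h ⟨node K.path i, hiS⟩ (mem_strictAncestors.2 (by
      simp only [node_level]
      exact ⟨hi, trivial⟩))
    simp only [node_level] at this
    change (signedSelection hS θ).twist (⟨node K.path i, hiS⟩ : {K // K ∈ S}).1 = _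
    rw [twist_signedSelection, this]
    congr 2
    exact depthIn_node S _ _

/-- The rank of a dyadic interval: larger intervals come first. -/
def intervalRank (K : {K // K ∈ S}) : ℕ := dyadicIndex (some K.1)

theorem intervalRank_injective : Function.Injective (intervalRank (S := S)) :=
  dyadicIndex_some_injective.comp Subtype.val_injective

theorem image_signedSelection_congr {θ θ' : {K // K ∈ S} → Bool} (K : {K // K ∈ S})
    (h : ∀ L, intervalRank L < intervalRank K → θ L = θ' L) :
    (signedSelection hS θ).image K = (signedSelection hS θ').image K := by
  have h1 : ((signedSelection hS θ').image K).1 = depthIn S K :=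
    (signedSelection hS θ').image_level K
  rw [image_signedSelection_eq_iff hS θ h1.symm]
  intro L hL
  have h2 := (image_signedSelection_eq_iff hS θ' h1.symm).1 rfl L hL
  rw [← h2]
  exact h L (DyadicOmega.level_lt_of_index_le (mem_strictAncestors.1 hL).1)

end

/-- Prescribed values of disjoint sets of coordinates are independent events. -/
theorem expect_cylinder_mul {Q : Type*} [Fintype Q] [DecidableEq Q] {F F' : Finset Q}
    (hF : Disjoint F F') (v v' : Q → Bool) :
    𝔼 x : Q → Bool, (if ∀ q ∈ F, x q = v q then (1 : ℝ) else 0) *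
      (if ∀ q ∈ F', x q = v' q then 1 else 0) = (2 ^ F.card)⁻¹ * (2 ^ F'.card)⁻¹ := by
  have h := expect_cylinder (F ∪ F') fun q => if q ∈ F then v q else v' q
  rw [Finset.card_union_of_disjoint hF, pow_add, mul_inv] at h
  rw [← h]
  refine Finset.expect_congr rfl fun x _ => ?_
  have hiff : (∀ q ∈ F ∪ F', x q = if q ∈ F then v q else v' q) ↔
      (∀ q ∈ F, x q = v q) ∧ ∀ q ∈ F', x q = v' q := by
    constructor
    · intro h1
      refine ⟨fun q hq => ?_, fun q hq => ?_⟩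
      · simpa [hq] using h1 q (Finset.mem_union_left _ hq)
      · have hq' : q ∉ F := fun h2 => (Finset.disjoint_left.1 hF) h2 hq
        simpa [hq'] using h1 q (Finset.mem_union_right _ hq)
    · rintro ⟨h1, h2⟩ q hq
      split_ifs with hqF
      · exact h1 q hqF
      · exact h2 q ((Finset.mem_union.1 hq).resolve_left hqF)
  rw [if_congr hiff rfl rfl]
  by_cases h1 : ∀ q ∈ F, x q = v q
  · by_cases h2 : ∀ q ∈ F', x q = v' q
    · rw [if_pos h1, if_pos h2, if_pos ⟨h1, h2⟩, mul_one]
    · rw [if_neg h2, mul_zero, if_neg fun h => h2 h.2]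
  · rw [if_neg h1, zero_mul, if_neg fun h => h1 h.1]

section

variable {S : Finset DyadicInterval} {N : ℕ} (hS : ∀ K ∈ S, K.1 ≤ N)

open Classical in
/-- The normalized and centered indicator function of the event that `K` has image `I`. -/
def centeredIndicator (I K : DyadicInterval) (θ : {K // K ∈ S} → Bool) : ℝ :=
  2 ^ I.1 * (if (signedSelection hS θ).image K = I then 1 else 0) - 1

theorem abs_centeredIndicator_le (I K : DyadicInterval) (θ : {K // K ∈ S} → Bool) :
    |centeredIndicator hS I K θ| ≤ 2 ^ I.1 := by
  have h : (1 : ℝ) ≤ 2 ^ I.1 := one_le_pow₀ one_le_two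
  rw [centeredIndicator]
  split_ifs
  · rw [mul_one, abs_of_nonneg (by linarith)]
    linarith
  · rw [mul_zero, zero_sub, abs_neg, abs_one]
    exact h

/-- An interval of the layer `j` has each interval of level `j` as image with probability `2^{-j}`.
-/
theorem expect_image_eq {I K : DyadicInterval} (hK : K ∈ layer S I.1)
    [∀ θ : {K // K ∈ S} → Bool, Decidable ((signedSelection hS θ).image K = I)] :
    𝔼 θ : {K // K ∈ S} → Bool, (if (signedSelection hS θ).image K = I then (1 : ℝ) else 0) =
      (2 ^ I.1)⁻¹ := by
  classical
  have hd := (mem_layer.1 hK).2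
  have h := expect_cylinder (strictAncestors S K) fun L : {K // K ∈ S} =>
    xor (K.path L.1.1) (I.path (depthIn S L))
  rw [card_strictAncestors, hd] at h
  rw [← h]
  exact Finset.expect_congr rfl fun θ _ =>
    if_congr (image_signedSelection_eq_iff hS θ hd) rfl rfl

theorem expect_abs_centeredIndicator_le {I K : DyadicInterval} (hK : K ∈ layer S I.1) :
    𝔼 θ : {K // K ∈ S} → Bool, |centeredIndicator hS I K θ| ≤ 2 := by
  classical
  calc _ ≤ 𝔼 θ : {K // K ∈ S} → Bool,
        (2 ^ I.1 * (if (signedSelection hS θ).image K = I then (1 : ℝ) else 0) + 1) := by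
        refine Finset.expect_le_expect fun θ _ => ?_
        rw [centeredIndicator]
        refine (abs_sub _ _).trans (le_of_eq ?_)
        rw [abs_one, abs_of_nonneg (by split_ifs <;> positivity)]
    _ = 2 := by
        rw [Finset.expect_add_distrib, ← Finset.mul_expect, expect_image_eq hS hK,
          Fintype.expect_const, mul_inv_cancel₀ (by positivity)]
        norm_num

/-- If `K` and `K'` have no common strict ancestor in `S`, their images depend on disjoint sets of
signs and are independent. -/
theorem expect_centeredIndicator_mul_eq_zero {I K K' : DyadicInterval} (hK : K ∈ layer S I.1)
    (hK' : K' ∈ layer S I.1) (hd : Disjoint (strictAncestors S K) (strictAncestors S K')) :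
    𝔼 θ : {K // K ∈ S} → Bool, centeredIndicator hS I K θ * centeredIndicator hS I K' θ = 0 := by
  classical
  have h1 := (mem_layer.1 hK).2
  have h2 := (mem_layer.1 hK').2
  have h := expect_cylinder_mul hd (fun L : {K // K ∈ S} =>
    xor (K.path L.1.1) (I.path (depthIn S L))) fun L : {K // K ∈ S} =>
    xor (K'.path L.1.1) (I.path (depthIn S L))
  rw [card_strictAncestors, card_strictAncestors, h1, h2] at h
  have h3 : 𝔼 θ : {K // K ∈ S} → Bool,
      (if (signedSelection hS θ).image K = I then (1 : ℝ) else 0) *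
      (if (signedSelection hS θ).image K' = I then (1 : ℝ) else 0) =
      (2 ^ I.1)⁻¹ * (2 ^ I.1)⁻¹ := by
    rw [← h]
    refine Finset.expect_congr rfl fun θ _ => ?_
    rw [if_congr (image_signedSelection_eq_iff hS θ h1) rfl rfl,
      if_congr (image_signedSelection_eq_iff hS θ h2) rfl rfl]
  have h4 : ∀ θ : {K // K ∈ S} → Bool,
      centeredIndicator hS I K θ * centeredIndicator hS I K' θ =
      2 ^ I.1 * 2 ^ I.1 * ((if (signedSelection hS θ).image K = I then (1 : ℝ) else 0) *
        (if (signedSelection hS θ).image K' = I then (1 : ℝ) else 0)) -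
      2 ^ I.1 * (if (signedSelection hS θ).image K = I then (1 : ℝ) else 0) -
      2 ^ I.1 * (if (signedSelection hS θ).image K' = I then (1 : ℝ) else 0) + 1 := by
    intro θ
    rw [centeredIndicator, centeredIndicator]
    ring
  simp only [h4]
  rw [Finset.expect_add_distrib, Finset.expect_sub_distrib, Finset.expect_sub_distrib,
    ← Finset.mul_expect, ← Finset.mul_expect, ← Finset.mul_expect, h3, expect_image_eq hS hK,
    expect_image_eq hS hK', Fintype.expect_const]
  have : (2 : ℝ) ^ I.1 ≠ 0 := by positivity
  field_simp
  ring

theorem abs_expect_centeredIndicator_mul_le {I K : DyadicInterval} (K' : DyadicInterval)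
    (hK : K ∈ layer S I.1) :
    |𝔼 θ : {K // K ∈ S} → Bool, centeredIndicator hS I K θ * centeredIndicator hS I K' θ| ≤
      2 * 2 ^ I.1 := by
  calc _ ≤ 𝔼 θ : {K // K ∈ S} → Bool, |centeredIndicator hS I K θ| * 2 ^ I.1 := by
        refine (Finset.abs_expect_le _ _).trans (Finset.expect_le_expect fun θ _ => ?_)
        rw [abs_mul]
        exact mul_le_mul_of_nonneg_left (abs_centeredIndicator_le hS I K' θ) (abs_nonneg _)
    _ ≤ _ := by
        rw [← Finset.expect_mul]
        exact mul_le_mul_of_nonneg_right (expect_abs_centeredIndicator_le hS hK) (by positivity)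

/-- The random averages over the intervals with image `I` are concentrated: the images of two
intervals are independent unless the intervals have a common strict ancestor in `S`. -/
theorem expect_sq_diagonal_le {I : DyadicInterval} {k₀ : ℕ} (hk₀ : ∀ K ∈ S, k₀ ≤ K.1)
    (a : DyadicInterval → ℝ) {B : ℝ} (ha : ∀ K ∈ S, |a K| ≤ B * (2 ^ K.1)⁻¹) :
    𝔼 θ : {K // K ∈ S} → Bool, (2 ^ I.1 * (∑ K ∈ (signedSelection hS θ).fiber I, a K) -
      ∑ K ∈ layer S I.1, a K) ^ 2 ≤ 2 * 2 ^ I.1 * B ^ 2 * (2 ^ k₀)⁻¹ := by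
  classical
  have h1 : ∀ θ : {K // K ∈ S} → Bool,
      2 ^ I.1 * (∑ K ∈ (signedSelection hS θ).fiber I, a K) - ∑ K ∈ layer S I.1, a K =
      ∑ K ∈ layer S I.1, a K * centeredIndicator hS I K θ := by
    intro θ
    have h2 : (signedSelection hS θ).fiber I =
        (layer S I.1).filter fun K => (signedSelection hS θ).image K = I := by
      ext K
      rw [Finset.mem_filter]
      constructor
      · intro h
        exact ⟨(signedSelection hS θ).fiber_subset_layer I h,
          ((signedSelection hS θ).mem_fiber.1 h).2⟩
      · rintro ⟨h, h'⟩
        exact (signedSelection hS θ).mem_fiber.2 ⟨(mem_layer.1 h).1, h'⟩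
    rw [h2, Finset.sum_filter, Finset.mul_sum, ← Finset.sum_sub_distrib]
    refine Finset.sum_congr rfl fun K _ => ?_
    rw [centeredIndicator]
    split_ifs <;> ring
  simp only [h1, sq (∑ K ∈ layer S I.1, _), Finset.sum_mul_sum, Finset.expect_sum_comm]
  have hB : ∀ K ∈ S, 0 ≤ B := fun K hK => by
    have := (abs_nonneg _).trans (ha K hK)
    exact nonneg_of_mul_nonneg_left this (by positivity)
  have hrow : ∀ K ∈ layer S I.1, ∑ K' ∈ layer S I.1, 𝔼 θ : {K // K ∈ S} → Bool,
      a K * centeredIndicator hS I K θ * (a K' * centeredIndicator hS I K' θ) ≤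
      (2 ^ K.1)⁻¹ * (2 * 2 ^ I.1 * B ^ 2 * (2 ^ k₀)⁻¹) := by
    intro K hK
    have hKS := (mem_layer.1 hK).1
    have hBK := hB K hKS
    -- A common strict ancestor has level at least `k₀`, so that `K` and `K'` lie in the same
    -- interval of level `k₀`.
    have hterm : ∀ K' ∈ layer S I.1, 𝔼 θ : {K // K ∈ S} → Bool,
        a K * centeredIndicator hS I K θ * (a K' * centeredIndicator hS I K' θ) ≤
        if node K'.path k₀ = node K.path k₀ then
          (2 ^ K.1)⁻¹ * (2 * 2 ^ I.1 * B ^ 2) * (2 ^ K'.1)⁻¹ else 0 := by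
      intro K' hK'
      have hKS' := (mem_layer.1 hK').1
      have h3 : 𝔼 θ : {K // K ∈ S} → Bool,
          a K * centeredIndicator hS I K θ * (a K' * centeredIndicator hS I K' θ) =
          a K * a K' * 𝔼 θ : {K // K ∈ S} → Bool,
            centeredIndicator hS I K θ * centeredIndicator hS I K' θ := by
        rw [Finset.mul_expect]
        exact Finset.expect_congr rfl fun θ _ => by ring
      rw [h3]
      split_ifs with hnode
      · refine (le_abs_self _).trans ?_
        rw [abs_mul, abs_mul]
        have h4 := ha K hKS
        have h5 := ha K' hKS'
        have h6 := abs_expect_centeredIndicator_mul_le hS K' hK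
        calc _ ≤ B * (2 ^ K.1)⁻¹ * (B * (2 ^ K'.1)⁻¹) * (2 * 2 ^ I.1) := by gcongr
          _ = _ := by ring
      · rw [expect_centeredIndicator_mul_eq_zero hS hK hK', mul_zero]
        rw [Finset.disjoint_left]
        intro L hL hL'
        rw [mem_strictAncestors] at hL hL'
        refine hnode (node_congr fun i hi => ?_)
        exact node_inj (hL'.2.trans hL.2.symm) i (hi.trans_le (hk₀ _ L.2))
    refine (Finset.sum_le_sum hterm).trans ?_
    rw [← Finset.sum_filter, ← Finset.mul_sum, mul_assoc ((2 : ℝ) ^ K.1)⁻¹]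
    have h7 : ∑ K' ∈ (layer S I.1).filter (fun K' => node K'.path k₀ = node K.path k₀),
        ((2 : ℝ) ^ K'.1)⁻¹ ≤ (2 ^ k₀)⁻¹ :=
      ((pathDisjoint_layer S I.1).subset (Finset.filter_subset _ _)).sum_le fun K' hK' => by
        rw [Finset.mem_filter] at hK'
        exact ⟨hk₀ _ (mem_layer.1 hK'.1).1, hK'.2⟩
    gcongr
  refine (Finset.sum_le_sum hrow).trans ?_
  rw [← Finset.sum_mul]
  exact mul_le_of_le_one_left (by positivity) (pathDisjoint_layer S I.1).sum_le_one

end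

namespace IsOmegaModel

variable {X : HaarSystemNorm} {η : Bool → ℝ} {E : Type} [NormedAddCommGroup E] [NormedSpace ℝ E]
  {e : DyadicOmega → E} (he : IsOmegaModel X η e) (T : E →L[ℝ] E)

/-- The weighted sum of the diagonal entries of an operator over a set of intervals. -/
def diagSum (N : ℕ) (P : Finset DyadicInterval) : ℝ :=
  ∑ K ∈ P, (2 ^ K.1)⁻¹ * he.entry T N K K

theorem abs_entry_self_le {N : ℕ} {K : DyadicInterval} (hK : K.1 ≤ N) :
    |he.entry T N K K| ≤ 2 * ‖T‖ :=
  le_of_mul_le_mul_right (he.abs_entry_mul_le T N hK hK) (pointNorm_pos X _)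

theorem abs_diagSum_le {N : ℕ} {P : Finset DyadicInterval} (hP : ∀ K ∈ P, K.1 ≤ N)
    (hd : PathDisjoint P) : |he.diagSum T N P| ≤ 2 * ‖T‖ := by
  refine (Finset.abs_sum_le_sum_abs _ _).trans ?_
  calc _ ≤ ∑ K ∈ P, ((2 : ℝ) ^ K.1)⁻¹ * (2 * ‖T‖) := by
        refine Finset.sum_le_sum fun K hK => ?_
        rw [abs_mul, abs_of_nonneg (by positivity : (0 : ℝ) ≤ (2 ^ K.1)⁻¹)]
        exact mul_le_mul_of_nonneg_left (he.abs_entry_self_le T (hP K hK)) (by positivity)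
    _ ≤ _ := by
        rw [← Finset.sum_mul]
        exact mul_le_of_le_one_left (by positivity) hd.sum_le_one

theorem average_apply_vec (s : BlockSelection) (I J : DyadicInterval) :
    s.average he.coord I (T (s.vec e J)) = 2 ^ I.1 * ∑ K ∈ s.fiber I, ∑ L ∈ s.fiber J,
      bitSign (s.twist K) * bitSign (s.twist L) * ((2 ^ K.1)⁻¹ * he.entry T s.block K L) := by
  rw [BlockSelection.average, BlockSelection.vec, smul_apply, smul_eq_mul, sum_apply]
  congr 1
  refine Finset.sum_congr rfl fun K _ => ?_
  rw [smul_apply, smul_eq_mul, map_sum, map_sum, Finset.mul_sum]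
  refine Finset.sum_congr rfl fun L _ => ?_
  rw [map_smul, map_smul, smul_eq_mul, entry]
  ring

variable {S : Finset DyadicInterval} {N : ℕ} (hS : ∀ K ∈ S, K.1 ≤ N)

open Classical in
theorem sum_fiber_signedSelection (θ : {K // K ∈ S} → Bool) (I : DyadicInterval)
    (f : DyadicInterval → ℝ) : ∑ K ∈ (signedSelection hS θ).fiber I, f K =
      ∑ K : {K // K ∈ S}, (if (signedSelection hS θ).image K = I then 1 else 0) * f K := by
  rw [Finset.sum_coe_sort S fun K => (if (signedSelection hS θ).image K = I then 1 else 0) * f K,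
    BlockSelection.fiber, Finset.sum_filter]
  refine Finset.sum_congr rfl fun K _ => ?_
  split_ifs <;> simp

open Classical in
/-- The random matrix entries split into an off-diagonal and a diagonal part. -/
theorem average_apply_vec_signedSelection (θ : {K // K ∈ S} → Bool) (I J : DyadicInterval) :
    (signedSelection hS θ).average he.coord I (T ((signedSelection hS θ).vec e J)) =
    2 ^ I.1 * (∑ K : {K // K ∈ S}, ∑ L : {K // K ∈ S}, if K = L then 0 else
      bitSign (θ K) * bitSign (θ L) * ((if (signedSelection hS θ).image K = I then 1 else 0) *
        (if (signedSelection hS θ).image L = J then 1 else 0) *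
        (if K.1 ∈ layer S I.1 ∧ L.1 ∈ layer S J.1 then
          (2 ^ K.1.1)⁻¹ * he.entry T N K L else 0))) +
    if I = J then 2 ^ I.1 * ∑ K ∈ (signedSelection hS θ).fiber I, (2 ^ K.1)⁻¹ * he.entry T N K K
      else 0 := by
  set s := signedSelection hS θ with hs
  have hlayer : ∀ (I : DyadicInterval) (K : {K // K ∈ S}), s.image K = I → K.1 ∈ layer S I.1 := by
    intro I K hK
    exact s.fiber_subset_layer I (s.mem_fiber.2 ⟨K.2, hK⟩)
  rw [he.average_apply_vec T s, sum_fiber_signedSelection hS]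
  have hterm : ∀ K L : {K // K ∈ S}, (if s.image K = I then 1 else 0) *
      ((if s.image L = J then 1 else 0) * (bitSign (s.twist K) * bitSign (s.twist L) *
        ((2 ^ K.1.1)⁻¹ * he.entry T s.block K L))) =
      (if K = L then 0 else bitSign (θ K) * bitSign (θ L) * ((if s.image K = I then 1 else 0) *
        (if s.image L = J then 1 else 0) * (if K.1 ∈ layer S I.1 ∧ L.1 ∈ layer S J.1 then
          (2 ^ K.1.1)⁻¹ * he.entry T N K L else 0))) +
      if L = K then (if I = J then
        (if s.image K = I then 1 else 0) * ((2 ^ K.1.1)⁻¹ * he.entry T N K K) else 0) else 0 := by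
    intro K L
    have hb : s.block = N := rfl
    rw [hs, twist_signedSelection, twist_signedSelection, ← hs, hb]
    by_cases hKL : K = L
    · subst hKL
      rw [if_pos rfl, if_pos rfl, bitSign_mul_self]
      by_cases h1 : s.image K = I
      · by_cases h2 : I = J
        · simp [h1, h2]
        · simp [h1, h2]
      · by_cases h2 : I = J
        · simp [h1]
        · simp [h1, h2]
    · rw [if_neg hKL, if_neg (Ne.symm hKL)]
      by_cases h1 : s.image K = I
      · by_cases h2 : s.image L = J
        · rw [if_pos h1, if_pos h2, if_pos ⟨hlayer I K h1, hlayer J L h2⟩]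
          ring
        · simp [h2]
      · simp [h1]
  simp only [hs, sum_fiber_signedSelection hS]
  simp only [← hs]
  rw [← mul_ite_zero, ← mul_add]
  congr 1
  have hI : (if I = J then ∑ K : {K // K ∈ S}, (if s.image K = I then 1 else 0) *
      ((2 ^ K.1.1)⁻¹ * he.entry T N K K) else 0) =
      ∑ K : {K // K ∈ S}, ∑ L : {K // K ∈ S}, if L = K then (if I = J then
        (if s.image K = I then 1 else 0) * ((2 ^ K.1.1)⁻¹ * he.entry T N K K) else 0) else 0 := by
    by_cases h : I = J <;> simp [h]
  rw [hI, ← Finset.sum_add_distrib]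
  refine Finset.sum_congr rfl fun K _ => ?_
  rw [← Finset.sum_add_distrib, Finset.mul_sum]
  exact Finset.sum_congr rfl fun L _ => hterm K L

/-- For random signs the averaged matrix entries are close to the diagonal matrix of the averages
of the diagonal entries over the layers: the off-diagonal part is controlled by the weighted
Hilbert-Schmidt sum, the diagonal part by concentration. -/
theorem expect_sq_average_le {k₀ : ℕ} (hk₀ : ∀ K ∈ S, k₀ ≤ K.1) (I J : DyadicInterval) {v : ℝ}
    (hv : he.entrySum T N (layer S I.1) (layer S J.1) ≤ v) :
    𝔼 θ : {K // K ∈ S} → Bool,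
      ((signedSelection hS θ).average he.coord I (T ((signedSelection hS θ).vec e J)) -
        if I = J then he.diagSum T N (layer S I.1) else 0) ^ 2 ≤
      8 * (2 ^ I.1) ^ 2 * v + 16 * 2 ^ I.1 * ‖T‖ ^ 2 * (2 ^ k₀)⁻¹ := by
  classical
  have h1 := expect_sq_offDiag_le (ι := {K // K ∈ S}) intervalRank_injective
    (fun K θ => if (signedSelection hS θ).image K = I then 1 else 0)
    (fun K θ => if (signedSelection hS θ).image K = J then 1 else 0)
    (fun K θ θ' h => by rw [image_signedSelection_congr hS K h])
    (fun K θ θ' h => by rw [image_signedSelection_congr hS K h])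
    (fun K θ => by split_ifs <;> norm_num) (fun K θ => by split_ifs <;> norm_num)
    fun K L => if K.1 ∈ layer S I.1 ∧ L.1 ∈ layer S J.1 then
          (2 ^ K.1.1)⁻¹ * he.entry T N K L else 0
  have h2 := expect_sq_diagonal_le hS (I := I) hk₀ (fun K => (2 ^ K.1)⁻¹ * he.entry T N K K)
    (B := 2 * ‖T‖) fun K hK => by
      rw [abs_mul, abs_of_nonneg (by positivity : (0 : ℝ) ≤ (2 ^ K.1)⁻¹), mul_comm]
      exact mul_le_mul_of_nonneg_right (he.abs_entry_self_le T (hS K hK)) (by positivity)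
  have h3 : ∑ K : {K // K ∈ S}, ∑ L : {K // K ∈ S},
      (if K.1 ∈ layer S I.1 ∧ L.1 ∈ layer S J.1 then
          (2 ^ K.1.1)⁻¹ * he.entry T N K L else 0) ^ 2 =
      he.entrySum T N (layer S I.1) (layer S J.1) := by
    have h4 : ∀ K : {K // K ∈ S}, ∑ L : {K // K ∈ S},
        (if K.1 ∈ layer S I.1 ∧ L.1 ∈ layer S J.1 then
          (2 ^ K.1.1)⁻¹ * he.entry T N K L else 0) ^ 2 =
        if K.1 ∈ layer S I.1 then ∑ L ∈ layer S J.1, ((2 ^ K.1.1)⁻¹ * he.entry T N K L) ^ 2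
          else 0 := by
      intro K
      rw [Finset.sum_coe_sort S fun L => (if K.1 ∈ layer S I.1 ∧ L ∈ layer S J.1 then
          (2 ^ K.1.1)⁻¹ * he.entry T N K L else 0) ^ 2]
      by_cases hK : K.1 ∈ layer S I.1
      · simp only [hK, true_and, if_true]
        rw [← Finset.sum_filter_add_sum_filter_not S (· ∈ layer S J.1)]
        have h5 : S.filter (· ∈ layer S J.1) = layer S J.1 := by
          ext L
          rw [Finset.mem_filter]
          exact ⟨fun h => h.2, fun h => ⟨(mem_layer.1 h).1, h⟩⟩
        rw [h5, Finset.sum_eq_zero (s := S.filter fun L => L ∉ layer S J.1), add_zero]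
        · exact Finset.sum_congr rfl fun L hL => by rw [if_pos hL]
        · intro L hL
          rw [if_neg (Finset.mem_filter.1 hL).2]
          norm_num
      · simp [hK]
    simp only [h4]
    rw [Finset.sum_coe_sort S fun K => if K ∈ layer S I.1 then
      ∑ L ∈ layer S J.1, ((2 ^ K.1)⁻¹ * he.entry T N K L) ^ 2 else 0, ← Finset.sum_filter]
    refine Finset.sum_congr ?_ fun _ _ => rfl
    ext K
    rw [Finset.mem_filter]
    exact ⟨fun h => h.2, fun h => ⟨(mem_layer.1 h).1, h⟩⟩
  rw [h3] at h1
  have h6 : ∀ θ : {K // K ∈ S} → Bool,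
      ((signedSelection hS θ).average he.coord I (T ((signedSelection hS θ).vec e J)) -
        if I = J then he.diagSum T N (layer S I.1) else 0) ^ 2 ≤
      2 * (2 ^ I.1) ^ 2 * (∑ K : {K // K ∈ S}, ∑ L : {K // K ∈ S}, if K = L then 0 else
        bitSign (θ K) * bitSign (θ L) * ((if (signedSelection hS θ).image K = I then 1 else 0) *
        (if (signedSelection hS θ).image L = J then 1 else 0) *
        (if K.1 ∈ layer S I.1 ∧ L.1 ∈ layer S J.1 then
          (2 ^ K.1.1)⁻¹ * he.entry T N K L else 0))) ^ 2 +
      2 * (2 ^ I.1 * (∑ K ∈ (signedSelection hS θ).fiber I, (2 ^ K.1)⁻¹ * he.entry T N K K) -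
        ∑ K ∈ layer S I.1, (2 ^ K.1)⁻¹ * he.entry T N K K) ^ 2 := by
    intro θ
    rw [he.average_apply_vec_signedSelection T hS, add_sub_assoc, mul_assoc, ← mul_pow, ← mul_add]
    refine add_sq_le.trans ?_
    refine mul_le_mul_of_nonneg_left (add_le_add le_rfl ?_) zero_le_two
    by_cases h : I = J
    · simp only [h, if_true, diagSum]
      exact le_rfl
    · simp only [h, if_false, sub_zero]
      rw [zero_pow two_ne_zero]
      exact sq_nonneg _
  refine (Finset.expect_le_expect fun θ _ => h6 θ).trans ?_
  rw [Finset.expect_add_distrib, ← Finset.mul_expect, ← Finset.mul_expect]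
  have h7 : (0 : ℝ) ≤ 2 * (2 ^ I.1) ^ 2 := by positivity
  have h8 := mul_le_mul_of_nonneg_left (h1.trans (mul_le_mul_of_nonneg_left hv (by norm_num))) h7
  have h9 := mul_le_mul_of_nonneg_left h2 zero_le_two
  refine (add_le_add h8 h9).trans (le_of_eq ?_)
  ring

include he in
/-- A functional which is small on all selected vectors is small on their random sums: the squares
of its values are at most `κ` times the values, and these are summable with sum at most `‖ψ‖` since
the intervals are disjoint. -/
theorem expect_sq_functional_le [CompleteSpace E] (J : DyadicInterval) (ψ : StrongDual ℝ E) {κ : ℝ}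
    (hκ : 0 ≤ κ) (hψ : ∀ K ∈ S, |ψ (atBlock e N K)| ≤ κ) :
    𝔼 θ : {K // K ∈ S} → Bool, ψ ((signedSelection hS θ).vec e J) ^ 2 ≤ κ * ‖ψ‖ := by
  classical
  have h1 : ∀ θ : {K // K ∈ S} → Bool, ψ ((signedSelection hS θ).vec e J) =
      ∑ K : {K // K ∈ S}, bitSign (θ K) *
        ((if (signedSelection hS θ).image K = J then 1 else 0) *
          if K.1 ∈ layer S J.1 then ψ (atBlock e N K) else 0) := by
    intro θ
    rw [BlockSelection.vec, map_sum]
    simp only [map_smul, smul_eq_mul]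
    rw [sum_fiber_signedSelection hS]
    refine Finset.sum_congr rfl fun K _ => ?_
    rw [twist_signedSelection]
    by_cases h : (signedSelection hS θ).image K = J
    · rw [if_pos h, if_pos]
      · change 1 * (_ * ψ (atBlock e N K)) = _
        ring
      · exact (signedSelection hS θ).fiber_subset_layer J
          ((signedSelection hS θ).mem_fiber.2 ⟨K.2, h⟩)
    · rw [if_neg h]
      ring
  simp only [h1]
  rw [expect_sq_sum_bitSign intervalRank_injective]
  swap
  · intro K θ θ' h
    rw [image_signedSelection_congr hS K h]
  set b : DyadicInterval → Bool := fun L => decide (ψ (atBlock e N L) < 0)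
  have h2 := he.norm_sum_disjoint_le N (P := layer S J.1) (fun K hK => hS K (mem_layer.1 hK).1)
    (pathDisjoint_layer S J.1) b
  have h3 : ∑ K ∈ layer S J.1, |ψ (atBlock e N K)| ≤ ‖ψ‖ := by
    have h4 : ∑ K ∈ layer S J.1, |ψ (atBlock e N K)| =
        ψ (∑ K ∈ layer S J.1, bitSign (b K) • atBlock e N K) := by
      simp only [map_sum, map_smul, smul_eq_mul]
      refine Finset.sum_congr rfl fun K _ => ?_
      by_cases h : ψ (atBlock e N K) < 0
      · simp [b, bitSign, h, abs_of_neg]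
      · simp only [b, bitSign, h, decide_false, Bool.false_eq_true, if_false, one_mul]
        exact abs_of_nonneg (not_lt.1 h)
    rw [h4]
    exact (le_abs_self _).trans ((ψ.le_opNorm _).trans
      (mul_le_of_le_one_right (norm_nonneg _) h2))
  calc _ ≤ ∑ K : {K // K ∈ S}, if K.1 ∈ layer S J.1 then κ * |ψ (atBlock e N K)| else 0 := by
        refine Finset.sum_le_sum fun K _ => ?_
        refine Finset.expect_le Finset.univ_nonempty fun θ _ => ?_
        by_cases hK : K.1 ∈ layer S J.1
        · rw [if_pos hK, if_pos hK, mul_pow, ← sq_abs (ψ (atBlock e N K))]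
          have h5 := hψ K K.2
          have h6 := abs_nonneg (ψ (atBlock e N K))
          split_ifs
          · nlinarith
          · nlinarith
        · rw [if_neg hK, if_neg hK]
          simp
    _ = ∑ K ∈ layer S J.1, κ * |ψ (atBlock e N K)| := by
        rw [Finset.sum_coe_sort S fun K => if K ∈ layer S J.1 then κ * |ψ (atBlock e N K)| else 0,
          ← Finset.sum_filter]
        refine Finset.sum_congr ?_ fun _ _ => rfl
        ext K
        rw [Finset.mem_filter]
        exact ⟨fun h => h.2, fun h => ⟨(mem_layer.1 h).1, h⟩⟩
    _ ≤ _ := by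
        rw [← Finset.mul_sum]
        gcongr

end IsOmegaModel

/-! ### Almost diagonalization in one block -/

/-- Among sufficiently many bounded numbers there are `n + 1` which are close to each other. -/
theorem exists_pigeonhole (n : ℕ) (B : ℝ) {η : ℝ} (hη : 0 < η) : ∃ m : ℕ, ∀ c : ℕ → ℝ,
    (∀ j < m, |c j| ≤ B) → ∃ J : Finset ℕ, (∀ j ∈ J, j < m) ∧ n < J.card ∧
      ∀ i ∈ J, ∀ j ∈ J, |c i - c j| ≤ η := by
  classical
  set t : Finset ℤ := Finset.Icc ⌊-B / η⌋ ⌊B / η⌋ with ht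
  refine ⟨t.card * n + 1, fun c hc => ?_⟩
  obtain ⟨y, -, hy⟩ := Finset.exists_lt_card_fiber_of_mul_lt_card_of_maps_to
    (s := Finset.range (t.card * n + 1)) (t := t) (f := fun j => ⌊c j / η⌋) (n := n)
    (fun j hj => by
      have := abs_le.1 (hc j (Finset.mem_range.1 hj))
      rw [ht, Finset.mem_Icc]
      constructor
      · exact Int.floor_mono (div_le_div_of_nonneg_right this.1 hη.le)
      · exact Int.floor_mono (div_le_div_of_nonneg_right this.2 hη.le))
    (by rw [Finset.card_range]; exact Nat.lt_succ_self _)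
  refine ⟨_, fun j hj => Finset.mem_range.1 (Finset.mem_filter.1 hj).1, hy, fun i hi j hj => ?_⟩
  have hi' := (Finset.mem_filter.1 hi).2
  have hj' := (Finset.mem_filter.1 hj).2
  have h := Int.abs_sub_lt_one_of_floor_eq_floor (hi'.trans hj'.symm)
  rw [← sub_div, abs_div, abs_of_pos hη, div_lt_one hη] at h
  exact h.le

theorem exists_pos_mul_le (A : ℝ) (hA : 0 ≤ A) {η : ℝ} (hη : 0 < η) : ∃ v > 0, A * v ≤ η := by
  refine ⟨η / (A + 1), by positivity, ?_⟩
  rw [mul_div_assoc', div_le_iff₀ (by positivity)]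
  nlinarith

theorem exists_le_of_expect_le {α : Type*} [Fintype α] [Nonempty α] (f : α → ℝ) {C : ℝ}
    (h : 𝔼 a, f a ≤ C) : ∃ a, f a ≤ C := by
  obtain ⟨a, -, ha⟩ := Finset.exists_le_of_expect_le Finset.univ_nonempty h
  exact ⟨a, ha⟩

namespace IsOmegaModel

variable {X : HaarSystemNorm} {η : Bool → ℝ} {E : Type} [NormedAddCommGroup E] [NormedSpace ℝ E]
  {e : DyadicOmega → E} (he : IsOmegaModel X η e) (T : E →L[ℝ] E)

/-- In infinitely many blocks there are sets of intervals with many layers, such that the averages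
of the diagonal entries of the operator over the layers are bounded below, even after the removal
of some levels. -/
def HasLargeAverages (δ : ℝ) : Prop :=
  ∀ N₀ : ℕ, ∃ N ≥ N₀, ∃ S : Finset DyadicInterval, (∀ K ∈ S, K.1 ≤ N) ∧
    ∀ (R : Finset ℕ) (j : ℕ), 2 * (j + R.card) < N + 1 →
      δ ≤ he.diagSum T N (layer (S.filter fun K => K.1 ∉ R) j)

include he in
/-- If the norms of sums of `m` Rademacher functions are `o(m)`, a functional is large on few
levels of a block only. -/
theorem card_bad_levels_lt (ψ : StrongDual ℝ E) {κ : ℝ} {m : ℕ} (hm : 0 < m)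
    (hρ : ‖ψ‖ * rademacherNorm X η m ≤ κ * m) (N : ℕ) (R : Finset ℕ)
    (hR : ∀ k ∈ R, ∃ K : DyadicInterval, K.1 = k ∧ k ≤ N ∧ κ < |ψ (atBlock e N K)|) :
    R.card < m := by
  by_contra hcard
  obtain ⟨R', hR', hm'⟩ := Finset.exists_subset_card_eq (not_lt.1 hcard)
  choose! L hL using hR
  set L' : Fin m → DyadicInterval := fun t => L (R'.orderEmbOfFin hm' t)
  have hmem : ∀ t, R'.orderEmbOfFin hm' t ∈ R := fun t => hR' (Finset.orderEmbOfFin_mem _ _ _)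
  have hlev : ∀ t, (L' t).1 = R'.orderEmbOfFin hm' t := fun t => (hL _ (hmem t)).1
  set b : Fin m → Bool := fun t => decide (ψ (atBlock e N (L' t)) < 0)
  -- On the signed sum of the vectors on which `ψ` is large, one from each of `m` levels, the
  -- value of `ψ` would exceed `κ * m`.
  have h1 := he.norm_sum_levels_le N L' (fun t => by rw [hlev]; exact (hL _ (hmem t)).2.1)
    (fun t t' h => by
      simp only [hlev] at h
      exact (R'.orderEmbOfFin hm').injective h) b
  have h2 : ψ (∑ t, bitSign (b t) • atBlock e N (L' t)) = ∑ t, |ψ (atBlock e N (L' t))| := by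
    simp only [map_sum, map_smul, smul_eq_mul]
    refine Finset.sum_congr rfl fun t _ => ?_
    by_cases h : ψ (atBlock e N (L' t)) < 0
    · simp [b, bitSign, h, abs_of_neg]
    · simp only [b, bitSign, h, decide_false, Bool.false_eq_true, if_false, one_mul]
      exact (abs_of_nonneg (not_lt.1 h)).symm
  have h3 : κ * m < ∑ t, |ψ (atBlock e N (L' t))| := by
    have : κ * m = ∑ _t : Fin m, κ := by simp [mul_comm]
    rw [this]
    have : Nonempty (Fin m) := ⟨⟨0, hm⟩⟩
    exact Finset.sum_lt_sum_of_nonempty Finset.univ_nonempty fun t _ => (hL _ (hmem t)).2.2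
  rw [← h2] at h3
  have h4 := (le_abs_self _).trans (ψ.le_opNorm (∑ t, bitSign (b t) • atBlock e N (L' t)))
  have h5 := mul_le_mul_of_nonneg_left h1 (norm_nonneg ψ)
  linarith

variable [CompleteSpace E]

/-- The expectation of the sum of the squares of all errors is small, and therefore some choice of
signs makes all errors small. -/
theorem exists_signedSelection {S : Finset DyadicInterval} {N k₀ n : ℕ} (hS : ∀ K ∈ S, K.1 ≤ N)
    (hk₀ : ∀ K ∈ S, k₀ ≤ K.1) (Ψ : Finset (StrongDual ℝ E)) {v κ ε : ℝ} (hκ : 0 ≤ κ) (hε : 0 ≤ ε)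
    (hv : ∀ i ≤ n, ∀ j ≤ n, he.entrySum T N (layer S i) (layer S j) ≤ v)
    (hΨ : ∀ ψ ∈ Ψ, ∀ K ∈ S, |ψ (atBlock e N K)| ≤ κ)
    (hε' : (upTo n).card ^ 2 * (8 * (2 ^ n) ^ 2 * v + 16 * 2 ^ n * ‖T‖ ^ 2 * (2 ^ k₀)⁻¹) +
      (upTo n).card * (κ * ∑ ψ ∈ Ψ, ‖ψ‖) ≤ ε ^ 2) :
    ∃ θ : {K // K ∈ S} → Bool,
      (∀ I J : DyadicInterval, I.1 ≤ n → J.1 ≤ n →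
        |(signedSelection hS θ).average he.coord I (T ((signedSelection hS θ).vec e J)) -
          if I = J then he.diagSum T N (layer S I.1) else 0| ≤ ε) ∧
      ∀ ψ ∈ Ψ, ∀ J : DyadicInterval, J.1 ≤ n → |ψ ((signedSelection hS θ).vec e J)| ≤ ε := by
  classical
  set f : ({K // K ∈ S} → Bool) → ℝ := fun θ => ∑ I ∈ upTo n, ∑ J ∈ upTo n,
      ((signedSelection hS θ).average he.coord I (T ((signedSelection hS θ).vec e J)) -
        if I = J then he.diagSum T N (layer S I.1) else 0) ^ 2 with hf
  set g : ({K // K ∈ S} → Bool) → ℝ := fun θ =>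
    ∑ J ∈ upTo n, ∑ ψ ∈ Ψ, ψ ((signedSelection hS θ).vec e J) ^ 2 with hg
  have hv0 : 0 ≤ v := (Finset.sum_nonneg fun _ _ => Finset.sum_nonneg fun _ _ => sq_nonneg _).trans
    (hv 0 (Nat.zero_le _) 0 (Nat.zero_le _))
  have h1 : 𝔼 θ, f θ ≤
      (upTo n).card ^ 2 * (8 * (2 ^ n) ^ 2 * v + 16 * 2 ^ n * ‖T‖ ^ 2 * (2 ^ k₀)⁻¹) := by
    simp only [hf, Finset.expect_sum_comm]
    calc _ ≤ ∑ I ∈ upTo n, ∑ J ∈ upTo n,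
          (8 * (2 ^ n) ^ 2 * v + 16 * 2 ^ n * ‖T‖ ^ 2 * ((2 : ℝ) ^ k₀)⁻¹) := by
          refine Finset.sum_le_sum fun I hI => Finset.sum_le_sum fun J hJ => ?_
          have hI' := mem_upTo.1 hI
          refine (he.expect_sq_average_le T hS hk₀ I J (hv _ hI' _ (mem_upTo.1 hJ))).trans ?_
          have : (2 : ℝ) ^ I.1 ≤ 2 ^ n := pow_le_pow_right₀ one_le_two hI'
          gcongr
      _ = _ := by
          rw [Finset.sum_const, Finset.sum_const, nsmul_eq_mul, nsmul_eq_mul]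
          ring
  have h2 : 𝔼 θ, g θ ≤ (upTo n).card * (κ * ∑ ψ ∈ Ψ, ‖ψ‖) := by
    simp only [hg, Finset.expect_sum_comm]
    calc _ ≤ ∑ J ∈ upTo n, ∑ ψ ∈ Ψ, κ * ‖ψ‖ :=
          Finset.sum_le_sum fun J _ => Finset.sum_le_sum fun ψ hψ =>
            he.expect_sq_functional_le hS J ψ hκ (hΨ ψ hψ)
      _ = _ := by rw [Finset.sum_const, nsmul_eq_mul, ← Finset.mul_sum]
  obtain ⟨θ, hθ⟩ := exists_le_of_expect_le (fun θ => f θ + g θ) (C := ε ^ 2) (by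
    rw [Finset.expect_add_distrib]
    exact (add_le_add h1 h2).trans hε')
  have hf0 : 0 ≤ f θ := Finset.sum_nonneg fun _ _ => Finset.sum_nonneg fun _ _ => sq_nonneg _
  have hg0 : 0 ≤ g θ := Finset.sum_nonneg fun _ _ => Finset.sum_nonneg fun _ _ => sq_nonneg _
  refine ⟨θ, fun I J hI hJ => ?_, fun ψ hψ J hJ => ?_⟩
  · refine abs_le_of_sq_le_sq ?_ hε
    refine le_trans ?_ (show f θ ≤ ε ^ 2 by linarith)
    refine le_trans ?_ (Finset.single_le_sum (f := fun I => ∑ J ∈ upTo n,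
      ((signedSelection hS θ).average he.coord I (T ((signedSelection hS θ).vec e J)) -
        if I = J then he.diagSum T N (layer S I.1) else 0) ^ 2)
      (fun _ _ => Finset.sum_nonneg fun _ _ => sq_nonneg _) (mem_upTo.2 hI))
    exact Finset.single_le_sum (f := fun J =>
      ((signedSelection hS θ).average he.coord I (T ((signedSelection hS θ).vec e J)) -
        if I = J then he.diagSum T N (layer S I.1) else 0) ^ 2) (fun _ _ => sq_nonneg _)
      (mem_upTo.2 hJ)
  · refine abs_le_of_sq_le_sq ?_ hε
    refine le_trans ?_ (show g θ ≤ ε ^ 2 by linarith)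
    refine le_trans ?_ (Finset.single_le_sum (f := fun J => ∑ ψ ∈ Ψ,
      ψ ((signedSelection hS θ).vec e J) ^ 2)
      (fun _ _ => Finset.sum_nonneg fun _ _ => sq_nonneg _) (mem_upTo.2 hJ))
    exact Finset.single_le_sum (f := fun ψ => ψ ((signedSelection hS θ).vec e J) ^ 2)
      (fun _ _ => sq_nonneg _) hψ

/-- In some block the operator is, on a randomly chosen copy of the first `n` levels of the Haar
system, close to a multiple of the identity. -/
theorem exists_almost_scalar {δ : ℝ} (hT : he.HasLargeAverages T δ)
    (hρ : ∀ κ > 0, ∃ m > 0, rademacherNorm X η m ≤ κ * m) (n N₀ : ℕ) {ε : ℝ} (hε : 0 < ε)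
    (Ψ : Finset (StrongDual ℝ E)) :
    ∃ (s : BlockSelection) (c : ℝ), N₀ ≤ s.block ∧ δ ≤ c ∧ c ≤ 2 * ‖T‖ ∧
      (∀ I J : DyadicInterval, I.1 ≤ n → J.1 ≤ n →
        |s.average he.coord I (T (s.vec e J)) - if I = J then c else 0| ≤ ε) ∧
      ∀ ψ ∈ Ψ, ∀ J : DyadicInterval, J.1 ≤ n → |ψ (s.vec e J)| ≤ ε := by
  classical
  -- The square `(ε / 2) ^ 2` is divided equally between the three contributions to the second
  -- moment, from the off-diagonal entries, the diagonal entries and the functionals.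
  obtain ⟨v, hv0, hv⟩ := exists_pos_mul_le
    ((upTo n).card ^ 2 * (8 * (2 ^ n) ^ 2) * ‖T‖ ^ 2) (by positivity)
    (show 0 < (ε / 2) ^ 2 / 3 by positivity)
  obtain ⟨w, hw0, hw⟩ := exists_pos_mul_le
    ((upTo n).card ^ 2 * (16 * 2 ^ n) * ‖T‖ ^ 2) (by positivity)
    (show 0 < (ε / 2) ^ 2 / 3 by positivity)
  obtain ⟨κ, hκ0, hκ⟩ := exists_pos_mul_le ((upTo n).card * ∑ ψ ∈ Ψ, ‖ψ‖) (by positivity)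
    (show 0 < (ε / 2) ^ 2 / 3 by positivity)
  obtain ⟨k₁, hk₁⟩ := he.exists_entrySum_le hv0
  obtain ⟨k₂, hk₂⟩ : ∃ k₂ : ℕ, ((2 : ℝ) ^ k₂)⁻¹ ≤ w := by
    obtain ⟨k, hk⟩ := exists_pow_lt_of_lt_one hw0 (show (2 : ℝ)⁻¹ < 1 by norm_num)
    exact ⟨k, by rw [← inv_pow]; exact hk.le⟩
  set k₀ := max k₁ k₂ with hk₀
  have hm : ∀ ψ : StrongDual ℝ E, ∃ m : ℕ, 0 < m ∧ ‖ψ‖ * rademacherNorm X η m ≤ κ * m := by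
    intro ψ
    obtain ⟨a, ha0, ha⟩ := exists_pos_mul_le ‖ψ‖ (norm_nonneg _) hκ0
    obtain ⟨m, hm0, hm⟩ := hρ a ha0
    refine ⟨m, hm0, ?_⟩
    calc _ ≤ ‖ψ‖ * (a * m) := by gcongr
      _ = ‖ψ‖ * a * m := by ring
      _ ≤ _ := by gcongr
  choose m hm0 hm using hm
  -- The first `M` layers remaining after the removal have diagonal averages in a bounded
  -- interval, so that `n + 1` of these averages differ by at most `ε / 2`.
  obtain ⟨M, hM⟩ := exists_pigeonhole n (2 * ‖T‖) (show 0 < ε / 2 by positivity)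
  obtain ⟨N, hN, S, hS, hSδ⟩ := hT (max N₀ (2 * (M + (k₀ + ∑ ψ ∈ Ψ, m ψ))))
  -- the short levels and those on which one of the functionals is large are removed
  set bad : StrongDual ℝ E → Finset ℕ := fun ψ => (Finset.range (N + 1)).filter fun k =>
    ∃ K : DyadicInterval, K.1 = k ∧ k ≤ N ∧ κ < |ψ (atBlock e N K)| with hbad
  set R : Finset ℕ := Finset.range k₀ ∪ Ψ.biUnion bad with hR
  have hRcard : R.card ≤ k₀ + ∑ ψ ∈ Ψ, m ψ := by
    refine (Finset.card_union_le _ _).trans ?_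
    rw [Finset.card_range]
    refine Nat.add_le_add_left (Finset.card_biUnion_le.trans (Finset.sum_le_sum fun ψ _ => ?_)) _
    exact (he.card_bad_levels_lt ψ (hm0 ψ) (hm ψ) N (bad ψ)
      fun k hk => (Finset.mem_filter.1 hk).2).le
  set S' := S.filter fun K => K.1 ∉ R with hS'
  have hS'N : ∀ K ∈ S', K.1 ≤ N := fun K hK => hS K (Finset.mem_filter.1 hK).1
  have hS'k : ∀ K ∈ S', k₀ ≤ K.1 := fun K hK => by
    by_contra h
    exact (Finset.mem_filter.1 hK).2
      (Finset.mem_union_left _ (Finset.mem_range.2 (not_le.1 h)))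
  have hS'ψ : ∀ ψ ∈ Ψ, ∀ K ∈ S', |ψ (atBlock e N K)| ≤ κ := fun ψ hψ K hK => by
    by_contra h
    refine (Finset.mem_filter.1 hK).2 (Finset.mem_union_right _
      (Finset.mem_biUnion.2 ⟨ψ, hψ, Finset.mem_filter.2 ⟨?_, K, rfl, hS'N K hK, not_le.1 h⟩⟩))
    exact Finset.mem_range.2 (Nat.lt_succ_of_le (hS'N K hK))
  obtain ⟨J, hJM, hJn, hJ⟩ := hM (fun j => he.diagSum T N (layer S' j)) fun j _ =>
    he.abs_diagSum_le T (fun K hK => hS'N K (mem_layer.1 hK).1) (pathDisjoint_layer _ _)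
  obtain ⟨j₀, hj₀⟩ : J.Nonempty := Finset.card_pos.1 (by omega)
  set S'' := layers S' J with hS''
  have hsub : ∀ K ∈ S'', K ∈ S' := fun K hK => (mem_layers.1 hK).1
  have hS''N : ∀ K ∈ S'', K.1 ≤ N := fun K hK => hS'N K (hsub K hK)
  obtain ⟨θ, hθ, hθψ⟩ := he.exists_signedSelection T (S := S'') (k₀ := k₀) (n := n) hS''N
    (fun K hK => hS'k K (hsub K hK)) Ψ (v := ‖T‖ ^ 2 * v) (κ := κ) (ε := ε / 2) hκ0.le
    (by positivity)
    (fun i _ j _ => hk₁ k₀ (le_max_left _ _) T N _ _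
      (fun K hK => hS''N K (mem_layer.1 hK).1) (fun K hK => hS''N K (mem_layer.1 hK).1)
      (pathDisjoint_layer _ _) (pathDisjoint_layer _ _)
      (fun K hK => hS'k K (hsub K (mem_layer.1 hK).1))
      fun K hK => hS'k K (hsub K (mem_layer.1 hK).1))
    (fun ψ hψ K hK => hS'ψ ψ hψ K (hsub K hK)) (by
      have h1 : ((2 : ℝ) ^ k₀)⁻¹ ≤ w := le_trans (by
        gcongr
        · norm_num
        · exact le_max_right _ _) hk₂
      have h2 : ((upTo n).card : ℝ) ^ 2 * (16 * 2 ^ n) * ‖T‖ ^ 2 * (2 ^ k₀)⁻¹ ≤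
        (upTo n).card ^ 2 * (16 * 2 ^ n) * ‖T‖ ^ 2 * w := by gcongr
      linarith)
  refine ⟨signedSelection hS''N θ, he.diagSum T N (layer S' j₀), (le_max_left _ _).trans hN,
    hSδ R j₀ ?_, ?_, fun I J' hI hJ' => ?_, fun ψ hψ J' hJ' => ?_⟩
  · have h1 := hJM j₀ hj₀
    have h2 := (le_max_right _ _).trans hN
    omega
  · exact (le_abs_self _).trans (he.abs_diagSum_le T (fun K hK => hS'N K (mem_layer.1 hK).1)
      (pathDisjoint_layer _ _))
  · have h1 := hθ I J' hI hJ'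
    by_cases h : I = J'
    · rw [if_pos h] at h1 ⊢
      have hl : layer S'' I.1 = layer S' (Nat.nth (· ∈ J) I.1) :=
        layer_layers S' J (by omega : I.1 < J.card)
      rw [hl] at h1
      have h2 := hJ _ (nth_mem_of_lt_card J (by omega : I.1 < J.card)) j₀ hj₀
      have h3 := abs_add_le ((signedSelection hS''N θ).average he.coord I
        (T ((signedSelection hS''N θ).vec e J')) -
        he.diagSum T N (layer S' (Nat.nth (· ∈ J) I.1)))
        (he.diagSum T N (layer S' (Nat.nth (· ∈ J) I.1)) - he.diagSum T N (layer S' j₀))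
      rw [sub_add_sub_cancel] at h3
      linarith
    · rw [if_neg h] at h1 ⊢
      linarith
  · have := hθψ ψ hψ J' hJ'
    linarith

end IsOmegaModel

/-! ### The identity factors through operators with large averages -/

instance : Countable DyadicOmega := Subtype.countable

theorem DyadicOmega.finite_setOf_block_le (n : ℕ) : {p : DyadicOmega | p.1.1 ≤ n}.Finite := by
  refine (Set.finite_Icc DyadicOmega.bottom
    (DyadicOmega.mk (n + 1) ⟨0, 0⟩ (Nat.zero_le _))).subset fun p hp => ⟨DyadicOmega.bottom_le p, ?_⟩
  exact DyadicOmega.le_iff.2 (Or.inl (Nat.lt_succ_of_le hp))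

/-- Summable weights on the indices, together with tolerances for the blocks which are negligible
with respect to these weights. -/
theorem exists_tolerance {ε : ℝ} (hε : 0 < ε) : ∃ (w : DyadicOmega → ℝ) (t : ℕ → ℝ),
    (∀ p, 0 < w p) ∧ (∀ n, 0 < t n) ∧ (∀ F : Finset DyadicOmega, ∑ p ∈ F, w p ≤ 1) ∧
    ∀ n (p q : DyadicOmega), p.1.1 ≤ n → q.1.1 ≤ n →
      2 * 2 ^ p.1.2.1 * t n ≤ ε * (w p * w q) := by
  cases nonempty_encodable DyadicOmega
  obtain ⟨w, hw0, C, hw, hC⟩ := posSumOfEncodable one_pos DyadicOmega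
  have ht : ∀ n : ℕ, ∃ t : ℝ, 0 < t ∧ ∀ p ∈ {p : DyadicOmega | p.1.1 ≤ n},
      ∀ q ∈ {p : DyadicOmega | p.1.1 ≤ n}, 2 * 2 ^ p.1.2.1 * t ≤ ε * (w p * w q) := by
    intro n
    have hfin := DyadicOmega.finite_setOf_block_le n
    have h1 : ∀ᶠ t : ℝ in 𝓝[>] 0, ∀ p ∈ {p : DyadicOmega | p.1.1 ≤ n},
        ∀ q ∈ {p : DyadicOmega | p.1.1 ≤ n}, 2 * 2 ^ p.1.2.1 * t ≤ ε * (w p * w q) := by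
      refine (Filter.eventually_all_finite hfin).2 fun p _ =>
        (Filter.eventually_all_finite hfin).2 fun q _ => ?_
      have h2 : Tendsto (fun t : ℝ => 2 * 2 ^ p.1.2.1 * t) (𝓝[>] 0) (𝓝 0) := by
        have : Tendsto (fun t : ℝ => 2 * 2 ^ p.1.2.1 * t) (𝓝 0) (𝓝 (2 * 2 ^ p.1.2.1 * 0)) :=
          tendsto_id.const_mul _
        rw [mul_zero] at this
        exact this.mono_left nhdsWithin_le_nhds
      exact (h2.eventually_lt_const (mul_pos hε (mul_pos (hw0 p) (hw0 q)))).mono fun _ h => h.le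
    obtain ⟨t, h, ht⟩ := (h1.and self_mem_nhdsWithin).exists
    exact ⟨t, ht, h⟩
  choose t ht0 ht using ht
  exact ⟨w, t, hw0, ht0,
    fun F => (sum_le_hasSum F (fun p _ => (hw0 p).le) hw).trans hC,
    fun n p q hp hq => ht n p hp q hq⟩

namespace IsOmegaModel

variable {X : HaarSystemNorm} {η : Bool → ℝ} {E : Type} [NormedAddCommGroup E] [NormedSpace ℝ E]
  {e : DyadicOmega → E} (he : IsOmegaModel X η e) (T : E →L[ℝ] E)

/-- An operator whose matrix is close to that of `c • id` is close to `c • id`. -/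
theorem norm_sub_smul_id_le {S : E →L[ℝ] E} {c ε : ℝ} (hε : 0 ≤ ε) {w : DyadicOmega → ℝ}
    (hw0 : ∀ p, 0 ≤ w p) (hw : ∀ F : Finset DyadicOmega, ∑ p ∈ F, w p ≤ 1)
    (hS : ∀ p q, 2 * 2 ^ p.1.2.1 * |he.coord q (S (e p)) - if p = q then c else 0| ≤
      ε * (w p * w q)) : ‖S - c • ContinuousLinearMap.id ℝ E‖ ≤ ε := by
  refine ContinuousLinearMap.opNorm_le_bound _ hε fun x => ?_
  refine he.dense.induction_on (p := fun x => ‖(S - c • ContinuousLinearMap.id ℝ E) x‖ ≤ ε * ‖x‖) x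
    (isClosed_le (by fun_prop) (by fun_prop)) fun a => ?_
  set x := Finsupp.linearCombination ℝ e a with hx
  have h1 : ∀ q, |he.coord q ((S - c • ContinuousLinearMap.id ℝ E) x)| ≤ ε * ‖x‖ * w q := by
    intro q
    have h2 : he.coord q ((S - c • ContinuousLinearMap.id ℝ E) x) =
        ∑ p ∈ a.support, a p * (he.coord q (S (e p)) - if p = q then c else 0) := by
      rw [hx, Finsupp.linearCombination_apply, Finsupp.sum, map_sum, map_sum]
      refine Finset.sum_congr rfl fun p _ => ?_
      rw [map_smul, map_smul, smul_eq_mul, _root_.sub_apply, map_sub,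
        _root_.smul_apply, map_smul, ContinuousLinearMap.id_apply, he.coord_basis,
        smul_eq_mul, mul_ite, mul_one, mul_zero]
    rw [h2]
    calc _ ≤ ∑ p ∈ a.support, ε * ‖x‖ * w q * w p := by
          refine (Finset.abs_sum_le_sum_abs _ _).trans (Finset.sum_le_sum fun p _ => ?_)
          rw [abs_mul]
          have h3 := he.abs_coord_le p x
          rw [hx, he.coord_linearCombination, ← hx] at h3
          calc _ ≤ 2 * 2 ^ p.1.2.1 * ‖x‖ * |he.coord q (S (e p)) - if p = q then c else 0| := by
                gcongr
            _ = ‖x‖ * (2 * 2 ^ p.1.2.1 * |he.coord q (S (e p)) - if p = q then c else 0|) := by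
                ring
            _ ≤ ‖x‖ * (ε * (w p * w q)) := mul_le_mul_of_nonneg_left (hS p q) (norm_nonneg _)
            _ = _ := by ring
      _ = ε * ‖x‖ * w q * ∑ p ∈ a.support, w p := by rw [Finset.mul_sum]
      _ ≤ _ := mul_le_of_le_one_right (by have := hw0 q; positivity) (hw _)
  refine he.norm_le_of_sum_abs_coord_le fun F => ?_
  calc _ ≤ ∑ q ∈ F, ε * ‖x‖ * w q := Finset.sum_le_sum fun q _ => h1 q
    _ = ε * ‖x‖ * ∑ q ∈ F, w q := by rw [Finset.mul_sum]
    _ ≤ _ := mul_le_of_le_one_right (by positivity) (hw _)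

variable [CompleteSpace E]

/-- The averages are taken over disjoint intervals. -/
theorem abs_average_le (s : BlockSelection) (J : DyadicInterval) (x : E) :
    |s.average he.coord J x| ≤ 2 * 2 ^ J.1 * ‖x‖ := by
  have h1 := he.abs_sum_coord_disjoint_le s.block (P := s.fiber J)
    (fun K hK => s.le K (s.mem_fiber.1 hK).1)
    ((pathDisjoint_layer s.sel J.1).subset (s.fiber_subset_layer J)) x
  have h2 : s.average he.coord J x = 2 ^ J.1 * ∑ K ∈ s.fiber J,
      (2 ^ K.1)⁻¹ * bitSign (s.twist K) * atBlock he.coord s.block K x := by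
    rw [BlockSelection.average]
    simp
  rw [h2, abs_mul, abs_of_pos (by positivity : (0 : ℝ) < 2 ^ J.1)]
  have h3 : |∑ K ∈ s.fiber J,
      ((2 : ℝ) ^ K.1)⁻¹ * bitSign (s.twist K) * atBlock he.coord s.block K x| ≤ 2 * ‖x‖ := by
    refine (Finset.abs_sum_le_sum_abs _ _).trans (le_trans (le_of_eq ?_) h1)
    refine Finset.sum_congr rfl fun K _ => ?_
    rw [abs_mul, abs_mul, abs_bitSign, mul_one, abs_of_pos (by positivity)]
  calc _ ≤ 2 ^ J.1 * (2 * ‖x‖) := by gcongr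
    _ = _ := by ring

/-- The averages of the coordinates of a fixed vector are small in all late blocks. -/
theorem exists_average_le (n : ℕ) (x : E) {ε : ℝ} (hε : 0 < ε) :
    ∃ N₀ : ℕ, ∀ s : BlockSelection, N₀ ≤ s.block → ∀ J : DyadicInterval, J.1 ≤ n →
      |s.average he.coord J x| ≤ ε := by
  obtain ⟨v, hv0, hv⟩ := exists_pos_mul_le (2 * 2 ^ n) (by positivity) hε
  obtain ⟨c, hc⟩ := he.dense.exists_dist_lt x hv0
  obtain ⟨M, hM⟩ := exists_block_bound c
  refine ⟨M, fun s hs J hJ => ?_⟩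
  set y := Finsupp.linearCombination ℝ e c
  have h0 : s.average he.coord J y = 0 := by
    rw [BlockSelection.average]
    simp only [_root_.smul_apply, sum_apply]
    rw [Finset.sum_eq_zero, smul_zero]
    intro K hK
    rw [atBlock_of_le _ (s.le K (s.mem_fiber.1 hK).1),
      he.coord_linearCombination, Finsupp.notMem_support_iff.1, smul_zero]
    intro h
    exact absurd (hM _ hs _ h) (lt_irrefl _)
  have h1 : s.average he.coord J x = s.average he.coord J (x - y) := by rw [map_sub, h0, sub_zero]
  rw [h1]
  refine (he.abs_average_le s J _).trans (le_trans ?_ hv)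
  rw [dist_eq_norm] at hc
  have : (2 : ℝ) ^ J.1 ≤ 2 ^ n := pow_le_pow_right₀ one_le_two hJ
  gcongr

/-- There is a sequence of selections in different blocks, of increasing depth, on which the
operator is almost a multiple of the identity on each block, and almost vanishes between
different blocks. -/
theorem exists_selection_sequence {δ : ℝ} (hT : he.HasLargeAverages T δ)
    (hρ : ∀ κ > 0, ∃ m > 0, rademacherNorm X η m ≤ κ * m) {t : ℕ → ℝ} (ht : ∀ n, 0 < t n) :
    ∃ (β : ℕ → BlockSelection) (c : ℕ → ℝ) (d : ℕ → ℕ), StrictMono d ∧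
      StrictMono (fun l => (β l).block) ∧ (∀ l, c l ∈ Icc δ (2 * ‖T‖)) ∧
      (∀ l, ∀ I J : DyadicInterval, I.1 ≤ d l → J.1 ≤ d l →
        |(β l).average he.coord I (T ((β l).vec e J)) - if I = J then c l else 0| ≤ t (d l)) ∧
      ∀ l m, l < m → ∀ I J : DyadicInterval, I.1 ≤ d l → J.1 ≤ d m →
        |(β l).average he.coord I (T ((β m).vec e J))| ≤ t (d m) ∧
        |(β m).average he.coord J (T ((β l).vec e I))| ≤ t (d m) := by
  classical
  obtain ⟨f, hf, hr⟩ := exists_seq_of_forall_finset_exists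
    (α := BlockSelection × ℝ × ℕ)
    (fun a => a.2.1 ∈ Icc δ (2 * ‖T‖) ∧ ∀ I J : DyadicInterval, I.1 ≤ a.2.2 → J.1 ≤ a.2.2 →
        |a.1.average he.coord I (T (a.1.vec e J)) - if I = J then a.2.1 else 0| ≤ t a.2.2)
    (fun a b => a.2.2 < b.2.2 ∧ a.1.block < b.1.block ∧
      ∀ I J : DyadicInterval, I.1 ≤ a.2.2 → J.1 ≤ b.2.2 →
        |a.1.average he.coord I (T (b.1.vec e J))| ≤ t b.2.2 ∧
        |b.1.average he.coord J (T (a.1.vec e I))| ≤ t b.2.2) (by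
      intro F _
      set n := F.sup (fun a => a.2.2) + 1 with hn
      have hlt : ∀ a ∈ F, a.2.2 < n := fun a ha =>
        Nat.lt_succ_of_le (Finset.le_sup (f := fun a : BlockSelection × ℝ × ℕ => a.2.2) ha)
      choose N hN using fun x : E => he.exists_average_le n x (ht n)
      set N₀ := max (F.sup fun a => a.1.block + 1)
        (F.sup fun a => (upTo a.2.2).sup fun I => N (T (a.1.vec e I))) with hN₀
      -- The block is so late that the images of the vectors chosen before have small
      -- coordinates there, and the functionals are the rows of the matrix which belong to
      -- the preceding blocks.
      obtain ⟨s, c, hs, hc, hc', hsc, hsΨ⟩ := he.exists_almost_scalar T hT hρ n N₀ (ht n)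
        (F.biUnion fun a => (upTo a.2.2).image fun I => (a.1.average he.coord I).comp T)
      refine ⟨(s, c, n), ⟨⟨hc, hc'⟩, hsc⟩, fun a ha => ⟨hlt a ha, ?_, fun I J hI hJ => ⟨?_, ?_⟩⟩⟩
      · have h1 : a.1.block + 1 ≤ N₀ := le_trans (Finset.le_sup
          (f := fun a : BlockSelection × ℝ × ℕ => a.1.block + 1) ha) (le_max_left _ _)
        exact h1.trans hs
      · exact hsΨ ((a.1.average he.coord I).comp T) (Finset.mem_biUnion.2
          ⟨a, ha, Finset.mem_image_of_mem _ (mem_upTo.2 hI)⟩) J hJ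
      · refine hN (T (a.1.vec e I)) s (le_trans ?_ hs) J hJ
        refine le_trans ?_ (le_max_right _ _)
        refine le_trans ?_ (Finset.le_sup (f := fun a : BlockSelection × ℝ × ℕ =>
          (upTo a.2.2).sup fun I => N (T (a.1.vec e I))) ha)
        exact Finset.le_sup (f := fun I => N (T (a.1.vec e I))) (mem_upTo.2 hI))
  exact ⟨fun l => (f l).1, fun l => (f l).2.1, fun l => (f l).2.2, fun l m h => (hr l m h).1,
    fun l m h => (hr l m h).2.1, fun l => (hf l).1, fun l => (hf l).2,
    fun l m h => (hr l m h).2.2⟩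

/-- Along a sequence of blocks on which `T` is almost a multiple of the identity, with factors
converging to `γ ≥ δ`, the operator `A T B` is a small perturbation of `γ • id` and hence
invertible. -/
theorem idFactorsThrough_of_hasLargeAverages {δ : ℝ} (hδ : 0 < δ) (hT : he.HasLargeAverages T δ)
    (hρ : ∀ κ > 0, ∃ m > 0, rademacherNorm X η m ≤ κ * m) : IdFactorsThrough T := by
  obtain ⟨w, t, hw0, ht0, hw, hwt⟩ := exists_tolerance (show 0 < δ / 4 by positivity)
  obtain ⟨β, c, d, hd, hβ, hc, hdiag, hoff⟩ := he.exists_selection_sequence T hT hρ ht0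
  obtain ⟨γ, hγ, φ, hφ, hlim⟩ := isCompact_Icc.tendsto_subseq hc
  -- The block `l` is replaced by the block `φ (ψ l)`, whose factor is within the tolerance of
  -- `γ`.
  obtain ⟨ψ, hψ, hclose⟩ := Filter.extraction_forall_of_eventually
    (P := fun n k => |c (φ k) - γ| ≤ t n) fun n => by
      filter_upwards [Metric.tendsto_nhds.1 hlim (t n) (ht0 n)] with k hk
      rw [Real.dist_eq] at hk
      exact hk.le
  set g : ℕ → ℕ := φ ∘ ψ with hg
  have hgm : StrictMono g := hφ.comp hψ
  have hdg : ∀ l, l ≤ d (g l) := fun _ => (hd.comp hgm).le_apply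
  obtain ⟨A, B, -, -, hB, hA⟩ := he.exists_selection_operators (fun l => β (g l)) (hβ.comp hgm)
  have hS : ∀ p q, 2 * 2 ^ p.1.2.1 *
      |he.coord q ((A ∘L T ∘L B) (e p)) - if p = q then γ else 0| ≤ δ / 2 * (w p * w q) := by
    intro p q
    have h1 : he.coord q ((A ∘L T ∘L B) (e p)) =
        (β (g q.1.1)).average he.coord q.1.2 (T ((β (g p.1.1)).vec e p.1.2)) := by
      rw [ContinuousLinearMap.comp_apply, ContinuousLinearMap.comp_apply, hA, hB]
    rw [h1]
    have hp := p.2.trans (hdg p.1.1)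
    have hq := q.2.trans (hdg q.1.1)
    have hpos : 0 < δ / 4 * (w p * w q) := by have := hw0 p; have := hw0 q; positivity
    rcases lt_trichotomy p.1.1 q.1.1 with h | h | h
    · rw [if_neg (fun h' => by rw [h'] at h; exact lt_irrefl _ h), sub_zero]
      have h2 := (hoff _ _ (hgm h) p.1.2 q.1.2 hp hq).2
      have h3 := hwt (d (g q.1.1)) p q (h.le.trans (hdg _)) (hdg _)
      have h4 : (2 : ℝ) * 2 ^ p.1.2.1 * |(β (g q.1.1)).average he.coord q.1.2
        (T ((β (g p.1.1)).vec e p.1.2))| ≤ 2 * 2 ^ p.1.2.1 * t (d (g q.1.1)) := by gcongr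
      linarith
    · have h2 := hdiag (g p.1.1) q.1.2 p.1.2 (by rw [← h] at hq; exact hq) hp
      have h3 := hclose p.1.1
      have h4 := hwt (d (g p.1.1)) p q (hdg _) (h.symm.le.trans (hdg _))
      have h5 := hwt p.1.1 p q le_rfl h.symm.le
      rw [← h]
      have h6 : |(β (g p.1.1)).average he.coord q.1.2 (T ((β (g p.1.1)).vec e p.1.2)) -
          if p = q then γ else 0| ≤ t (d (g p.1.1)) + t p.1.1 := by
        by_cases hpq : p = q
        · rw [if_pos hpq]
          rw [if_pos (by rw [hpq])] at h2
          exact (abs_sub_le _ _ _).trans (add_le_add h2 h3)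
        · rw [if_neg hpq]
          rw [if_neg fun h' => hpq (Subtype.ext (Prod.ext h h'.symm))] at h2
          exact h2.trans (le_add_of_nonneg_right (ht0 _).le)
      calc _ ≤ 2 * 2 ^ p.1.2.1 * (t (d (g p.1.1)) + t p.1.1) := by gcongr
        _ ≤ _ := by linarith
    · rw [if_neg (fun h' => by rw [h'] at h; exact lt_irrefl _ h), sub_zero]
      have h2 := (hoff _ _ (hgm h) q.1.2 p.1.2 hq hp).1
      have h3 := hwt (d (g p.1.1)) p q (hdg _) (h.le.trans (hdg _))
      have h4 : (2 : ℝ) * 2 ^ p.1.2.1 * |(β (g q.1.1)).average he.coord q.1.2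
        (T ((β (g p.1.1)).vec e p.1.2))| ≤ 2 * 2 ^ p.1.2.1 * t (d (g p.1.1)) := by gcongr
      linarith
  have hnorm := he.norm_sub_smul_id_le (by positivity) (fun p => (hw0 p).le) hw hS
  set S := A ∘L T ∘L B with hSdef
  have hγ0 : 0 < γ := hδ.trans_le hγ.1
  have hlt : ‖(1 : E →L[ℝ] E) - γ⁻¹ • S‖ < 1 := by
    have h1 : (1 : E →L[ℝ] E) - γ⁻¹ • S = -(γ⁻¹ • (S - γ • ContinuousLinearMap.id ℝ E)) := by
      rw [smul_sub, smul_smul, inv_mul_cancel₀ hγ0.ne', one_smul, neg_sub]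
      rfl
    rw [h1, norm_neg, norm_smul, norm_inv, Real.norm_eq_abs, abs_of_pos hγ0, inv_mul_lt_iff₀ hγ0,
      mul_one]
    have := hγ.1
    linarith
  have hu := isUnit_one_sub_of_norm_lt_one hlt
  rw [sub_sub_cancel] at hu
  obtain ⟨U, hU⟩ := hu.exists_right_inv
  refine ⟨A, B ∘L (γ⁻¹ • U), ?_⟩
  have h2 : A ∘L T ∘L B ∘L (γ⁻¹ • U) = (γ⁻¹ • S) * U := by
    ext x
    simp [hSdef]
  rw [h2, hU]
  rfl

end IsOmegaModel

/-! ### Operators with large averages -/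

namespace DyadicInterval

theorem expect_sum_node {M : ℕ} {P : Finset DyadicInterval} (hP : ∀ K ∈ P, K.1 ≤ M) :
    𝔼 x : Fin M → Bool, ((P.filter fun K => node (extendPath x) K.1 = K).card : ℝ) =
      ∑ K ∈ P, ((2 : ℝ) ^ K.1)⁻¹ := by
  classical
  rw [← Finset.sum_congr rfl fun K hK => expect_node_eq K (hP K hK), ← Finset.expect_sum_comm]
  refine Finset.expect_congr rfl fun x _ => ?_
  rw [Finset.card_filter, Nat.cast_sum]
  refine Finset.sum_congr rfl fun K _ => ?_
  split_ifs <;> simp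

/-- A path which contains more than `j` members of `S` meets the layer `j`. -/
theorem exists_node_mem_layer {S : Finset DyadicInterval} {x : ℕ → Bool} {n j : ℕ}
    (hj : j < pathDepth S x n) : ∃ k < n, node x k ∈ layer S j := by
  induction n with
  | zero => simp [pathDepth] at hj
  | succ n ih =>
    rw [pathDepth_succ] at hj
    by_cases h : j < pathDepth S x n
    · obtain ⟨k, hk, hx⟩ := ih h
      exact ⟨k, by omega, hx⟩
    · by_cases hn : node x n ∈ S
      · rw [if_pos hn] at hj
        exact ⟨n, Nat.lt_succ_self n, mem_layer.2 ⟨hn, by rw [depthIn_node]; omega⟩⟩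
      · rw [if_neg hn] at hj
        omega

open Classical in
/-- The measure of a layer is at least the measure of the paths which reach it. -/
theorem expect_le_sum_layer {S : Finset DyadicInterval} {N : ℕ} (hS : ∀ K ∈ S, K.1 ≤ N) (j : ℕ) :
    𝔼 x : Fin N → Bool, (if j < pathDepth S (extendPath x) (N + 1) then (1 : ℝ) else 0) ≤
      ∑ K ∈ layer S j, ((2 : ℝ) ^ K.1)⁻¹ := by
  rw [← expect_sum_node fun K hK => hS K (mem_layer.1 hK).1]
  refine Finset.expect_le_expect fun x _ => ?_
  split_ifs with h
  · obtain ⟨k, -, hk⟩ := exists_node_mem_layer h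
    have h1 : 0 < ((layer S j).filter fun K => node (extendPath x) K.1 = K).card :=
      Finset.card_pos.2 ⟨_, Finset.mem_filter.2 ⟨hk, by rw [node_level]⟩⟩
    exact_mod_cast h1
  · positivity

/-- Removing some levels from `S` diminishes the depth by at most the number of these levels. -/
theorem pathDepth_le_add_card (S : Finset DyadicInterval) (R : Finset ℕ) (x : ℕ → Bool) (n : ℕ) :
    pathDepth S x n ≤ pathDepth (S.filter fun K => K.1 ∉ R) x n + R.card := by
  have h : pathDepth S x n ≤ pathDepth (S.filter fun K => K.1 ∉ R) x n +
      Nat.count (· ∈ R) n := by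
    induction n with
    | zero => simp [pathDepth]
    | succ n ih =>
      rw [pathDepth_succ, pathDepth_succ, Nat.count_succ]
      by_cases h1 : node x n ∈ S
      · by_cases h2 : n ∈ R
        · rw [if_pos h1, if_pos h2]
          omega
        · rw [if_pos h1, if_neg h2,
            if_pos (Finset.mem_filter.2 ⟨h1, by rwa [node_level]⟩)]
          omega
      · rw [if_neg h1]
        omega
  refine h.trans (Nat.add_le_add_left ?_ _)
  rw [Nat.count_eq_card_filter_range]
  exact Finset.card_le_card fun i hi => (Finset.mem_filter.1 hi).2

/-- The layers of a union of levels are these levels. -/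
theorem layer_biUnion_level (L : Finset ℕ) {j : ℕ} (hj : j < L.card) :
    layer (L.biUnion level) j = level (Nat.nth (· ∈ L) j) := by
  have hL : ∀ hf : (Set.ofPred fun j => j ∈ L).Finite, j < hf.toFinset.card := by
    intro hf
    have : hf.toFinset = L := by ext; simp
    rwa [this]
  have hmem : ∀ K : DyadicInterval, K ∈ L.biUnion level ↔ K.1 ∈ L := by
    intro K
    simp only [Finset.mem_biUnion, mem_level]
    exact ⟨fun ⟨k, hk, h⟩ => h ▸ hk, fun h => ⟨_, h, rfl⟩⟩
  have hdepth : ∀ K : DyadicInterval, depthIn (L.biUnion level) K = Nat.count (· ∈ L) K.1 := by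
    intro K
    rw [depthIn, pathDepth]
    congr 1
    ext i
    rw [hmem, node_level]
  ext K
  rw [mem_layer, hmem, hdepth, mem_level]
  constructor
  · rintro ⟨h1, rfl⟩
    exact (Nat.nth_count (p := (· ∈ L)) h1).symm
  · intro h
    rw [h]
    exact ⟨Nat.nth_mem j hL, Nat.count_nth hL⟩

theorem sum_level_inv (k : ℕ) : ∑ K ∈ level k, ((2 : ℝ) ^ K.1)⁻¹ = 1 := by
  rw [Finset.sum_congr rfl fun K hK => by rw [mem_level.1 hK], Finset.sum_const, card_level,
    nsmul_eq_mul]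
  push_cast
  exact mul_inv_cancel₀ (by positivity)

end DyadicInterval

namespace IsOmegaModel

variable {X : HaarSystemNorm} {η : Bool → ℝ} {E : Type} [NormedAddCommGroup E] [NormedSpace ℝ E]
  {e : DyadicOmega → E} (he : IsOmegaModel X η e) (T : E →L[ℝ] E)

theorem entry_self_of_le {N : ℕ} {K : DyadicInterval} (h : K.1 ≤ N) :
    he.entry T N K K = he.coord (DyadicOmega.mk N K h) (T (e (DyadicOmega.mk N K h))) := by
  rw [entry, atBlock_of_le _ h, atBlock_of_le _ h]

/-- One of the two alternatives holds for infinitely many blocks. -/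
theorem hasLargeAverages_or {T T' : E →L[ℝ] E} {δ δ' : ℝ}
    (h : ∀ N, (∃ S : Finset DyadicInterval, (∀ K ∈ S, K.1 ≤ N) ∧
        ∀ (R : Finset ℕ) (j : ℕ), 2 * (j + R.card) < N + 1 →
          δ ≤ he.diagSum T N (layer (S.filter fun K => K.1 ∉ R) j)) ∨
      ∃ S : Finset DyadicInterval, (∀ K ∈ S, K.1 ≤ N) ∧
        ∀ (R : Finset ℕ) (j : ℕ), 2 * (j + R.card) < N + 1 →
          δ' ≤ he.diagSum T' N (layer (S.filter fun K => K.1 ∉ R) j)) :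
    he.HasLargeAverages T δ ∨ he.HasLargeAverages T' δ' := by
  have := Filter.frequently_or_distrib.1 (Filter.Eventually.of_forall (f := atTop) h).frequently
  exact this.imp Filter.frequently_atTop.1 Filter.frequently_atTop.1

/-- If half of the levels of a block have average at least `δ`, these levels can be selected. -/
theorem exists_layers_of_card_levels {δ : ℝ} {N : ℕ} {L : Finset ℕ} (hL : ∀ k ∈ L, k ≤ N)
    (hcard : N + 1 ≤ 2 * L.card) (hδ : ∀ k ∈ L, δ ≤ he.diagSum T N (level k)) :
    ∃ S : Finset DyadicInterval, (∀ K ∈ S, K.1 ≤ N) ∧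
      ∀ (R : Finset ℕ) (j : ℕ), 2 * (j + R.card) < N + 1 →
        δ ≤ he.diagSum T N (layer (S.filter fun K => K.1 ∉ R) j) := by
  classical
  have hmem : ∀ (L : Finset ℕ) (K : DyadicInterval), K ∈ L.biUnion level ↔ K.1 ∈ L := by
    intro L K
    simp only [Finset.mem_biUnion, mem_level]
    exact ⟨fun ⟨k, hk, h⟩ => h ▸ hk, fun h => ⟨_, h, rfl⟩⟩
  refine ⟨L.biUnion level, fun K hK => hL _ ((hmem L K).1 hK), fun R j hj => ?_⟩
  have h1 : (L.biUnion level).filter (fun K => K.1 ∉ R) = (L \ R).biUnion level := by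
    ext K
    rw [Finset.mem_filter, hmem, hmem, Finset.mem_sdiff]
  have h2 : j < (L \ R).card := by
    have := Finset.le_card_sdiff R L
    omega
  rw [h1, layer_biUnion_level _ h2]
  exact hδ _ (Finset.mem_sdiff.1 (nth_mem_of_lt_card _ h2)).1

theorem diagSum_level_add {N k : ℕ} (hk : k ≤ N) :
    he.diagSum T N (level k) + he.diagSum (ContinuousLinearMap.id ℝ E - T) N (level k) = 1 := by
  rw [diagSum, diagSum, ← Finset.sum_add_distrib, ← sum_level_inv k]
  refine Finset.sum_congr rfl fun K hK => ?_
  have hle : K.1 ≤ N := (mem_level.1 hK).le.trans hk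
  rw [he.entry_self_of_le _ hle, he.entry_self_of_le _ hle, ← mul_add, _root_.sub_apply, map_sub,
    ContinuousLinearMap.id_apply, he.coord_basis, if_pos rfl]
  ring

/-- On each level the averages of the diagonal entries of `T` and of `id - T` add up to `1`, so
that one of the two operators has average at least `1 / 2` on half of the levels. -/
theorem hasLargeAverages_or_id_sub : he.HasLargeAverages T (1 / 2) ∨
    he.HasLargeAverages (ContinuousLinearMap.id ℝ E - T) (1 / 2) := by
  classical
  refine he.hasLargeAverages_or fun N => ?_
  set L := (Finset.range (N + 1)).filter fun k => 1 / 2 ≤ he.diagSum T N (level k) with hL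
  set L' := (Finset.range (N + 1)).filter fun k => ¬ 1 / 2 ≤ he.diagSum T N (level k) with hL'
  have hcard : L.card + L'.card = N + 1 := by
    rw [hL, hL', Finset.card_filter_add_card_filter_not, Finset.card_range]
  have hle : ∀ k ∈ Finset.range (N + 1), k ≤ N := fun k hk =>
    Nat.lt_succ_iff.1 (Finset.mem_range.1 hk)
  rcases le_or_gt (N + 1) (2 * L.card) with h | h
  · exact Or.inl (he.exists_layers_of_card_levels T (L := L)
      (fun k hk => hle k (Finset.mem_filter.1 hk).1) h fun k hk => (Finset.mem_filter.1 hk).2)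
  · refine Or.inr (he.exists_layers_of_card_levels _ (L := L')
      (fun k hk => hle k (Finset.mem_filter.1 hk).1) (by omega) fun k hk => ?_)
    have h1 := he.diagSum_level_add T (hle k (Finset.mem_filter.1 hk).1)
    have h2 := not_le.1 (Finset.mem_filter.1 hk).2
    linarith

/-- If half of the paths contain many members of `S`, the first layers of `S` have measure at least
`1 / 2`, even after the removal of some levels. -/
theorem exists_layers_of_expect {δ : ℝ} (hδ : 0 ≤ δ) {N : ℕ} {S : Finset DyadicInterval}
    (hS : ∀ K ∈ S, K.1 ≤ N) (hSδ : ∀ K ∈ S, δ ≤ he.entry T N K K)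
    (hP : 1 / 2 ≤ 𝔼 x : Fin N → Bool,
      (if N + 1 ≤ 2 * pathDepth S (extendPath x) (N + 1) then (1 : ℝ) else 0)) :
    ∃ S : Finset DyadicInterval, (∀ K ∈ S, K.1 ≤ N) ∧
      ∀ (R : Finset ℕ) (j : ℕ), 2 * (j + R.card) < N + 1 →
        δ / 2 ≤ he.diagSum T N (layer (S.filter fun K => K.1 ∉ R) j) := by
  classical
  refine ⟨S, hS, fun R j hj => ?_⟩
  set S' := S.filter fun K => K.1 ∉ R with hS'
  have h1 : (1 : ℝ) / 2 ≤ ∑ K ∈ layer S' j, ((2 : ℝ) ^ K.1)⁻¹ := by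
    refine hP.trans (le_trans (Finset.expect_le_expect fun x _ => ?_)
      (expect_le_sum_layer (fun K hK => hS K (Finset.mem_filter.1 hK).1) j))
    have h2 := pathDepth_le_add_card S R (extendPath x) (N + 1)
    by_cases h : N + 1 ≤ 2 * pathDepth S (extendPath x) (N + 1)
    · rw [if_pos h, if_pos (by omega)]
    · rw [if_neg h]
      split_ifs <;> norm_num
  calc δ / 2 = δ * (1 / 2) := by ring
    _ ≤ δ * ∑ K ∈ layer S' j, ((2 : ℝ) ^ K.1)⁻¹ := by gcongr
    _ = ∑ K ∈ layer S' j, ((2 : ℝ) ^ K.1)⁻¹ * δ := by rw [mul_comm, Finset.sum_mul]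
    _ ≤ _ := Finset.sum_le_sum fun K hK => mul_le_mul_of_nonneg_left
        (hSδ K (Finset.mem_filter.1 (mem_layer.1 hK).1).1) (by positivity)

/-- If all diagonal entries are large, on at least half of the paths at least half of the entries
have the same sign. -/
theorem hasLargeAverages_or_neg {δ : ℝ} (hδ : 0 < δ)
    (hT : ∀ p, δ ≤ |he.coord p (T (e p))|) :
    he.HasLargeAverages T (δ / 2) ∨ he.HasLargeAverages (-T) (δ / 2) := by
  classical
  refine he.hasLargeAverages_or fun N => ?_
  set S := (upTo N).filter fun K => δ ≤ he.entry T N K K with hS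
  set S' := (upTo N).filter fun K => δ ≤ he.entry (-T) N K K with hS'
  have hneg : ∀ K : DyadicInterval, K.1 ≤ N → he.entry (-T) N K K = -he.entry T N K K := by
    intro K hK
    rw [he.entry_self_of_le _ hK, he.entry_self_of_le _ hK, _root_.neg_apply, map_neg]
  have hor : ∀ x : ℕ → Bool, ∀ k ≤ N, node x k ∈ S ∨ node x k ∈ S' := by
    intro x k hk
    have hlev : (node x k).1 ≤ N := by rwa [node_level]
    have h := hT (DyadicOmega.mk N (node x k) hlev)
    rw [← he.entry_self_of_le] at h
    rcases le_abs.1 h with h | h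
    · exact Or.inl (Finset.mem_filter.2 ⟨mem_upTo.2 hlev, h⟩)
    · exact Or.inr (Finset.mem_filter.2 ⟨mem_upTo.2 hlev, by rwa [hneg _ hlev]⟩)
  have hsum : ∀ (x : ℕ → Bool) (n : ℕ), n ≤ N + 1 → n ≤ pathDepth S x n + pathDepth S' x n := by
    intro x n hn
    induction n with
    | zero => exact Nat.zero_le _
    | succ n ih =>
      have h1 := ih (by omega)
      rw [pathDepth_succ, pathDepth_succ]
      rcases hor x n (by omega) with h | h
      · rw [if_pos h]
        omega
      · rw [if_pos h]
        omega
  have h1 : (1 : ℝ) ≤ (𝔼 x : Fin N → Bool,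
      (if N + 1 ≤ 2 * pathDepth S (extendPath x) (N + 1) then (1 : ℝ) else 0)) +
      𝔼 x : Fin N → Bool,
      (if N + 1 ≤ 2 * pathDepth S' (extendPath x) (N + 1) then (1 : ℝ) else 0) := by
    rw [← Finset.expect_add_distrib]
    refine Finset.le_expect Finset.univ_nonempty fun x _ => ?_
    have h2 := hsum (extendPath x) (N + 1) le_rfl
    by_cases h : N + 1 ≤ 2 * pathDepth S (extendPath x) (N + 1)
    · rw [if_pos h]
      split_ifs <;> norm_num
    · rw [if_neg h, if_pos (by omega)]
      norm_num
  rcases le_or_gt (1 / 2) (𝔼 x : Fin N → Bool,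
      (if N + 1 ≤ 2 * pathDepth S (extendPath x) (N + 1) then (1 : ℝ) else 0)) with h | h
  · exact Or.inl (he.exists_layers_of_expect T hδ.le
      (fun K hK => mem_upTo.1 (Finset.mem_filter.1 hK).1)
      (fun K hK => (Finset.mem_filter.1 hK).2) h)
  · exact Or.inr (he.exists_layers_of_expect (-T) hδ.le
      (fun K hK => mem_upTo.1 (Finset.mem_filter.1 hK).1)
      (fun K hK => (Finset.mem_filter.1 hK).2) (by linarith))

variable [CompleteSpace E]

include he in
theorem hasPrimaryFactorizationProperty (hρ : ∀ κ > 0, ∃ m > 0, rademacherNorm X η m ≤ κ * m) :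
    HasPrimaryFactorizationProperty E := fun T =>
  (he.hasLargeAverages_or_id_sub T).imp
    (fun h => he.idFactorsThrough_of_hasLargeAverages T (by norm_num) h hρ)
    fun h => he.idFactorsThrough_of_hasLargeAverages _ (by norm_num) h hρ

theorem hasFactorizationProperty (hρ : ∀ κ > 0, ∃ m > 0, rademacherNorm X η m ≤ κ * m) :
    HasFactorizationProperty he.schauderBasis := by
  rintro T ⟨δ, hδ, hT⟩
  rcases he.hasLargeAverages_or_neg T hδ hT with h | h
  · exact he.idFactorsThrough_of_hasLargeAverages T (by positivity) h hρ
  · obtain ⟨A, B, hAB⟩ := he.idFactorsThrough_of_hasLargeAverages _ (by positivity) h hρ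
    refine ⟨-A, B, ?_⟩
    rw [← hAB]
    ext x
    simp

end IsOmegaModel

/-! ### The largest ideal -/

/-- If `E` has the primary factorization property, the operators through which the identity does
not factor form the largest proper ideal; only the closedness under sums is not formal. -/
theorem isLargestIdeal_nonFactoringOperators {E : Type*} [NormedAddCommGroup E] [NormedSpace ℝ E]
    [Nontrivial E] (h : HasPrimaryFactorizationProperty E) :
    IsLargestIdeal (nonFactoringOperators E) := by
  have hmem : ∀ T : E →L[ℝ] E, T ∈ nonFactoringOperators E ↔ ¬ IdFactorsThrough T := by
    intro T
    simp only [nonFactoringOperators, IdFactorsThrough, mem_ofPred_eq, not_exists]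
    exact forall₂_congr fun A B => by rw [ne_eq, eq_comm]
  have hmul : ∀ S T U : E →L[ℝ] E, IdFactorsThrough (S * T * U) → IdFactorsThrough T := by
    rintro S T U ⟨A, B, hAB⟩
    refine ⟨A ∘L S, U ∘L B, ?_⟩
    rw [← hAB]
    rfl
  have hadd : ∀ S T : E →L[ℝ] E, IdFactorsThrough (S + T) →
      IdFactorsThrough S ∨ IdFactorsThrough T := by
    rintro S T ⟨A, B, hAB⟩
    -- Here `A S B + A T B = id`, and the identity factors through one of the two summands.
    rcases h (A ∘L S ∘L B) with h1 | h1
    · exact Or.inl (hmul A S B h1)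
    · refine Or.inr (hmul A T B ?_)
      have h2 : ContinuousLinearMap.id ℝ E - A ∘L S ∘L B = A * T * B := by
        rw [← hAB]
        ext x
        simp
      rwa [h2] at h1
  have hone : IdFactorsThrough (1 : E →L[ℝ] E) := ⟨1, 1, rfl⟩
  refine ⟨TwoSidedIdeal.mk' (nonFactoringOperators E) ?_ ?_ ?_ ?_ ?_, ?_, ?_, ?_⟩
  · rw [hmem]
    rintro ⟨A, B, hAB⟩
    obtain ⟨x, hx⟩ := exists_ne (0 : E)
    refine hx ?_
    have := DFunLike.congr_fun hAB x
    simpa using this.symm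
  · intro S T hS hT
    rw [hmem] at hS hT ⊢
    exact fun h => (hadd S T h).elim hS hT
  · intro S hS
    rw [hmem] at hS ⊢
    intro h
    refine hS (hmul (-1) S 1 ?_)
    simpa using h
  · intro S T hT
    rw [hmem] at hT ⊢
    intro h
    exact hT (hmul S T 1 (by rwa [mul_one]))
  · intro S T hS
    rw [hmem] at hS ⊢
    intro h
    exact hS (hmul 1 S T (by rwa [one_mul]))
  · exact TwoSidedIdeal.coe_mk' _ _ _ _ _ _
  · intro htop
    have h1 : (1 : E →L[ℝ] E) ∈ (⊤ : TwoSidedIdeal (E →L[ℝ] E)) := trivial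
    rw [← htop, TwoSidedIdeal.mem_mk', hmem] at h1
    exact h1 hone
  · intro J hJ T hT
    rw [TwoSidedIdeal.mem_mk', hmem]
    rintro ⟨A, B, hAB⟩
    refine hJ ?_
    rw [← TwoSidedIdeal.one_mem_iff]
    have h1 : A * T * B = 1 := hAB
    rw [← h1]
    exact J.mul_mem_right _ _ (J.mul_mem_left _ _ hT)

/-! ### The norm of a Haar system Hardy space in terms of binary digits -/

/-- The signs of the family of Rademacher functions, as functions of a random bit: for the
independent family they are the values of the bits, for the constant family they can be
replaced by `1`. -/
def IsSignOf (r : rademacherFamilies) (η : Bool → ℝ) : Prop :=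
  (r.1 = (fun I => rademacher (dyadicIndex I)) ∧ η = bitSign) ∨
    (r.1 = (fun _ => rademacher 0) ∧ η = fun _ => 1)

theorem exists_isSignOf (r : rademacherFamilies) : ∃ η, IsSignOf r η := by
  rcases r.2 with h | h
  · exact ⟨bitSign, Or.inl ⟨h, rfl⟩⟩
  · exact ⟨fun _ => 1, Or.inr ⟨mem_singleton_iff.1 h, rfl⟩⟩

theorem IsSignOf.abs_eq_one {r : rademacherFamilies} {η : Bool → ℝ} (h : IsSignOf r η) (b : Bool) :
    |η b| = 1 := by
  rcases h with ⟨-, rfl⟩ | ⟨-, rfl⟩ <;> simp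

/-- In the independent family distinct intervals have independent signs; in the constant family the
common sign does not change the absolute value. -/
theorem IsSignOf.integral_abs_sum {r : rademacherFamilies} {η : Bool → ℝ} (h : IsSignOf r η)
    {Q : Type*} [Fintype Q] [DecidableEq Q] {J : Q → DyadicInterval} (hJ : Function.Injective J)
    (c : Q → ℝ) : ∫ u in (0 : ℝ)..1, |∑ q, r.1 (some (J q)) u * c q| =
      𝔼 ε : Q → Bool, |∑ q, η (ε q) * c q| := by
  rw [intervalIntegral.integral_of_le zero_le_one, ← integral_Ico_eq_integral_Ioc]
  rcases h with ⟨hr, rfl⟩ | ⟨hr, rfl⟩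
  · have hi : Function.Injective fun q => dyadicIndex (some (J q)) :=
      dyadicIndex_some_injective.comp hJ
    rw [← integral_binaryDigit hi fun ε => |∑ q, bitSign (ε q) * c q|]
    refine setIntegral_congr_fun measurableSet_Ico fun u hu => ?_
    simp only [hr, rademacher_eq _ hu]
  · have h1 : ∀ u ∈ Ico (0 : ℝ) 1, |∑ q, r.1 (some (J q)) u * c q| = |∑ q, c q| := by
      intro u hu
      simp only [hr, rademacher_eq _ hu]
      rw [← Finset.mul_sum, abs_mul, abs_bitSign, one_mul]
    rw [setIntegral_congr_fun measurableSet_Ico h1]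
    simp

/-- A linear combination of Haar functions whose levels are the numbers `i q` depends on the binary
digits at the positions `i q`, and its norm is the corresponding norm on the cube if the
coefficients on each level depend only on the digits at these positions. -/
theorem hardyNorm_linearCombination {X : HaarSystemNorm} {r : rademacherFamilies} {η : Bool → ℝ}
    (h : IsSignOf r η) {Q : Type} [Fintype Q] [DecidableEq Q] {i : Q → ℕ}
    (hi : Function.Injective i) (a : DyadicInterval →₀ ℝ) (G : Q → (Q → Bool) → ℝ)
    (ha : ∀ K ∈ a.support, K.1 ∈ range i)
    (hG : ∀ (x : ℕ → Bool) (q : Q), a (node x (i q)) = G q fun q' => x (i q')) :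
    hardyNorm X r (Finsupp.linearCombination ℝ (fun K => haarBasis (some K)) a) =
      cubeHardyNorm X η G := by
  set f := Finsupp.linearCombination ℝ (fun K => haarBasis (some K)) a with hf
  have hrepr : haarBasis.repr f = a.mapDomain some := by
    have : f = Finsupp.linearCombination ℝ haarBasis (a.mapDomain some) := by
      rw [Finsupp.linearCombination_mapDomain]
      rfl
    rw [this, Module.Basis.repr_linearCombination]
  have hfun : hardyFun r f = digitFun i fun x => 𝔼 ε, |randomSum η G x ε| := by
    funext s
    by_cases hs : s ∈ Ico (0 : ℝ) 1
    · rw [digitFun, indicator_of_mem hs]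
      let d : ℕ → Bool := fun k => binaryDigit k s
      have h3 : ∀ K, haarFun (some K) s = if K = node d K.1 then bitSign (d K.1) else 0 :=
        fun K => haarFun_some K hs
      have h1 : ∀ u, (haarBasis.repr f).sum (fun I a => r.1 I u * a * haarFun I s) =
          ∑ q, r.1 (some (node (d) (i q))) u *
            (bitSign (d (i q)) * G q fun q' => d (i q')) := by
        intro u
        rw [hrepr, Finsupp.sum_mapDomain_index_inj (Option.some_injective _), Finsupp.sum]
        have h2 : ∀ K ∈ a.support, r.1 (some K) u * a K * haarFun (some K) s =
            ∑ q, if node (d) (i q) = K then r.1 (some (node (d) (i q))) u *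
            (bitSign (d (i q)) * G q fun q' => d (i q')) else 0 := by
          intro K hK
          obtain ⟨q, hq⟩ := ha K hK
          rw [Finset.sum_eq_single q]
          · rw [h3, ← hq]
            by_cases hKs : K = node (d) (i q)
            · rw [if_pos hKs, if_pos hKs.symm, ← hG (d) q, ← hKs]
              ring
            · rw [if_neg hKs, if_neg (fun h => hKs h.symm), mul_zero]
          · intro q' _ hne
            rw [if_neg]
            rintro rfl
            rw [node_level] at hq
            exact hne (hi hq).symm
          · exact fun h => absurd (Finset.mem_univ _) h
        rw [Finset.sum_congr rfl h2, Finset.sum_comm]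
        refine Finset.sum_congr rfl fun q _ => ?_
        rw [Finset.sum_ite_eq]
        split_ifs with hq
        · rfl
        · rw [← hG (d) q, Finsupp.notMem_support_iff.1 hq]
          simp
      simp only [hardyFun, h1]
      rw [h.integral_abs_sum]
      · simp only [randomSum, mul_assoc]
        rfl
      · intro q q' hqq
        have := congrArg (fun K : DyadicInterval => K.1) hqq
        simp only [node_level] at this
        exact hi this
    · rw [digitFun, indicator_of_notMem hs]
      have h0 : ∀ I, haarFun I s = 0 := fun I => (isDyadicStep_haarFun I).1 s hs
      simp [hardyFun, h0]
  have hval : (⟨hardyFun r f, hardyFun_mem r f⟩ : haarSpan) = 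
      ⟨digitFun i fun x => 𝔼 ε, |randomSum η G x ε|, digitFun_mem i _⟩ :=
    Subtype.ext hfun
  change X.toSeminorm ⟨hardyFun r f, hardyFun_mem r f⟩ = _
  rw [hval, norm_digitFun_eq_cubeNorm X hi]
  rfl

theorem norm_toHardy (X : HaarSystemNorm) (r : rademacherFamilies) (f : haarSpan) :
    ‖toHardy X r f‖ = hardyNorm X r f :=
  UniformSpace.Completion.norm_coe (E := HardyPre X r) f

theorem norm_linearCombination_haarVec {X : HaarSystemNorm} {r : rademacherFamilies}
    {η : Bool → ℝ} (h : IsSignOf r η) {Q : Type} [Fintype Q] [DecidableEq Q] {i : Q → ℕ}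
    (hi : Function.Injective i) (a : DyadicInterval →₀ ℝ) (G : Q → (Q → Bool) → ℝ)
    (ha : ∀ K ∈ a.support, K.1 ∈ range i)
    (hG : ∀ (x : ℕ → Bool) (q : Q), a (node x (i q)) = G q fun q' => x (i q')) :
    ‖Finsupp.linearCombination ℝ (haarVec X r) a‖ = cubeHardyNorm X η G := by
  rw [← hardyNorm_linearCombination h hi a G ha hG, ← norm_toHardy]
  change ‖(hardyZero X r).subtype (Finsupp.linearCombination ℝ (haarVec X r) a)‖ = _
  rw [Finsupp.apply_linearCombination, Finsupp.apply_linearCombination]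
  rfl

/-! ### Rademacher functions -/

/-- On the cube the Rademacher functions become the coordinates. -/
theorem norm_sum_rademacherVec {X : HaarSystemNorm} {r : rademacherFamilies}
    {η : Bool → ℝ} (h : IsSignOf r η) {Q : Type} [Fintype Q] [DecidableEq Q] {i : Q → ℕ}
    (hi : Function.Injective i) (w : Q → ℝ) :
    ‖∑ q, w q • rademacherVec X r (i q)‖ = cubeHardyNorm X η fun q (_ : Q → Bool) => w q := by
  classical
  set a : DyadicInterval →₀ ℝ := ∑ q, w q • ∑ K ∈ level (i q), Finsupp.single K 1 with ha
  have hK : ∀ K : DyadicInterval, a K = ∑ q, if i q = K.1 then w q else 0 := by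
    intro K
    rw [ha, Finsupp.finsetSum_apply]
    refine Finset.sum_congr rfl fun q _ => ?_
    rw [Finsupp.smul_apply, Finsupp.finsetSum_apply]
    simp only [Finsupp.single_apply, Finset.sum_ite_eq', mem_level, smul_eq_mul, mul_ite, mul_one,
      mul_zero]
    exact if_congr eq_comm rfl rfl
  rw [← norm_linearCombination_haarVec h hi a]
  · congr 1
    rw [ha, map_sum]
    refine Finset.sum_congr rfl fun q _ => ?_
    rw [map_smul, map_sum, rademacherVec]
    simp
  · intro K hKa
    rw [Finsupp.mem_support_iff, hK] at hKa
    obtain ⟨q, -, hq⟩ := Finset.exists_ne_zero_of_sum_ne_zero hKa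
    exact ⟨q, by by_contra hne; exact hq (if_neg hne)⟩
  · intro x q
    rw [hK, node_level]
    simp [hi.eq_iff]

/-- The norms of sums of `m` elements of a weakly null sequence of Rademacher functions are
`o(m)`: by Mazur's theorem some convex combination is small, and it can be averaged over the
cyclic shifts. -/
theorem exists_rademacherNorm_le {X : HaarSystemNorm} {r : rademacherFamilies} {η : Bool → ℝ}
    (h : IsSignOf r η) (hnull : IsWeaklyNull (rademacherVec X r)) {κ : ℝ} (hκ : 0 < κ) :
    ∃ m > 0, rademacherNorm X η m ≤ κ * m := by
  classical
  have hmem : (0 : hardyZero X r) ∈ closure (convexHull ℝ (range (rademacherVec X r))) := by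
    by_contra hne
    obtain ⟨φ, u, h0, hu⟩ := geometric_hahn_banach_point_closed
      (convex_convexHull ℝ (range (rademacherVec X r))).closure isClosed_closure hne
    rw [map_zero] at h0
    obtain ⟨n, hn⟩ := ((hnull φ).eventually_lt_const h0).exists
    exact absurd (hu _ (subset_closure (subset_convexHull ℝ _ ⟨n, rfl⟩))) hn.not_gt
  obtain ⟨y, hy, hyκ⟩ := Metric.mem_closure_iff.1 hmem κ hκ
  rw [dist_zero_left] at hyκ
  obtain ⟨ι, _, w, z, hw0, hw1, hz, rfl⟩ := mem_convexHull_iff_exists_fintype.1 hy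
  choose k hk using hz
  set N := Finset.univ.sup k + 1 with hN
  have hkN : ∀ j, k j < N := fun j => Nat.lt_succ_of_le (Finset.le_sup (Finset.mem_univ j))
  set W : Fin N → ℝ := fun q => ∑ j, if k j = q then w j else 0 with hW
  have hsum : ∀ v : Fin N → hardyZero X r,
      ∑ q, W q • v q = ∑ j, w j • v ⟨k j, hkN j⟩ := by
    intro v
    simp only [hW, Finset.sum_smul]
    rw [Finset.sum_comm]
    refine Finset.sum_congr rfl fun j _ => ?_
    rw [Finset.sum_eq_single ⟨k j, hkN j⟩]
    · simp
    · intro q _ hq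
      rw [if_neg (fun h => hq (Fin.ext h.symm)), zero_smul]
    · simp
  have hsmall : ∀ t : Fin N, ‖∑ q, W q • rademacherVec X r ((q + t : Fin N) : ℕ)‖ ≤ κ := by
    intro t
    rw [norm_sum_rademacherVec h (i := fun q : Fin N => ((q + t : Fin N) : ℕ))
        (Fin.val_injective.comp (add_left_injective t)),
      ← norm_sum_rademacherVec (X := X) (r := r) h (i := fun q : Fin N => (q : ℕ))
        Fin.val_injective, hsum]
    simp only [hk]
    exact hyκ.le
  have hWsum : ∑ q, W q = 1 := by
    simp only [hW]
    rw [Finset.sum_comm, ← hw1]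
    refine Finset.sum_congr rfl fun j _ => ?_
    rw [Finset.sum_eq_single ⟨k j, hkN j⟩]
    · simp
    · intro q _ hq
      rw [if_neg (fun h => hq (Fin.ext h.symm))]
    · simp
  refine ⟨N, Nat.succ_pos _, ?_⟩
  have h1 : rademacherNorm X η N = ‖∑ t, ∑ q, W q • rademacherVec X r ((q + t : Fin N) : ℕ)‖ := by
    rw [rademacherNorm, ← norm_sum_rademacherVec (X := X) (r := r) h (i := fun q : Fin N => (q : ℕ))
      Fin.val_injective, Finset.sum_comm]
    congr 1
    have h2 : ∀ q : Fin N, ∑ t, W q • rademacherVec X r ((q + t : Fin N) : ℕ) =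
        W q • ∑ t : Fin N, rademacherVec X r (t : ℕ) := by
      intro q
      rw [← Finset.smul_sum]
      congr 1
      exact Fintype.sum_equiv (Equiv.addLeft q) _ _ fun t => rfl
    rw [Finset.sum_congr rfl fun q _ => h2 q, ← Finset.sum_smul, hWsum, one_smul]
    simp
  rw [h1]
  calc _ ≤ ∑ _t : Fin N, κ := (norm_sum_le _ _).trans (Finset.sum_le_sum fun t _ => hsmall t)
    _ = κ * N := by simp [mul_comm]

/-! ### Finite faithful Haar systems -/

theorem faithfulBlock_subset_level (k : ℕ → ℕ) (j i : ℕ) : faithfulBlock k j i ⊆ level (k j) := by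
  cases j with
  | zero => rw [faithfulBlock]
  | succ j =>
    classical
    rw [faithfulBlock]
    exact Finset.filter_subset _ _

theorem nonempty_toSet (K : DyadicInterval) : K.toSet.Nonempty := by
  refine ⟨(K.2 : ℝ) / 2 ^ K.1, le_rfl, ?_⟩
  gcongr
  linarith

/-- An interval belongs to the collection `ℬ_I` of a finite faithful Haar system if and only if
the bits of its path at the frequencies lead to `I`. -/
theorem node_mem_faithfulBlock_iff {k : ℕ → ℕ} {n : ℕ} (hk : ∀ j < n, k j < k (j + 1))
    (x : ℕ → Bool) {j i : ℕ} (hj : j ≤ n) (hi : i < 2 ^ j) :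
    node x (k j) ∈ faithfulBlock k j i ↔ ((node (fun l => x (k l)) j).2 : ℕ) = i := by
  classical
  induction j generalizing i with
  | zero =>
    rw [faithfulBlock]
    simp only [node_mem_level, true_iff]
    simp only [pow_zero, Nat.lt_one_iff] at hi
    rw [hi]
    rfl
  | succ j ih =>
    have hjn : j < n := hj
    have hkj := hk j hjn
    have hi2 : i / 2 < 2 ^ j := by
      rw [pow_succ] at hi
      omega
    set K := node x (k (j + 1)) with hK
    -- on `K` the function `h_I^n` is constant, since the level of `K` is larger than `k j`
    have hval : ∀ s ∈ K.toSet, ∑ L ∈ faithfulBlock k j (i / 2), haarFun (some L) s =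
        if ((node (fun l => x (k l)) j).2 : ℕ) = i / 2 then bitSign (x (k j)) else 0 := by
      intro s hs
      rw [hK, mem_node_toSet] at hs
      have hnode : node (fun l => binaryDigit l s) (k j) = node x (k j) :=
        node_congr fun l hl => hs.2 l (hl.trans hkj)
      have h1 : ∀ L ∈ faithfulBlock k j (i / 2), haarFun (some L) s =
          if node x (k j) = L then bitSign (x (k j)) else 0 := by
        intro L hL
        have hlev := mem_level.1 (faithfulBlock_subset_level k j _ hL)
        rw [haarFun_some L hs.1, hlev, hnode, hs.2 _ hkj]
        exact if_congr eq_comm rfl rfl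
      rw [Finset.sum_congr rfl h1, Finset.sum_ite_eq]
      exact if_congr (ih hjn.le hi2) rfl rfl
    rw [faithfulBlock, Finset.mem_filter]
    have h2 : (∀ s ∈ K.toSet, ∑ L ∈ faithfulBlock k j (i / 2), haarFun (some L) s =
        if Even i then 1 else -1) ↔
        (if ((node (fun l => x (k l)) j).2 : ℕ) = i / 2 then bitSign (x (k j)) else 0) =
          if Even i then 1 else -1 := by
      constructor
      · intro h
        obtain ⟨s, hs⟩ := nonempty_toSet K
        rw [← hval s hs, h s hs]
      · intro h s hs
        rw [hval s hs, h]
    rw [h2, node, child_index]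
    simp only [hK, node_mem_level, true_and]
    generalize ((node (fun l => x (k l)) j).2 : ℕ) = m
    rcases Nat.even_or_odd' i with ⟨l, rfl | rfl⟩
    · rw [if_pos (even_two_mul l), Nat.mul_div_cancel_left l two_pos]
      cases x (k j)
      · by_cases hm : m = l <;> simp [hm, bitSign]
      · by_cases hm : m = l
        · simp only [hm, if_true, bitSign, Bool.toNat_true]
          norm_num
        · simp only [hm, if_false, Bool.toNat_true]
          norm_num
          omega
    · have hodd : ¬ Even (2 * l + 1) := by simp
      have hdiv : (2 * l + 1) / 2 = l := by omega
      rw [if_neg hodd, hdiv]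
      cases x (k j)
      · by_cases hm : m = l
        · simp only [hm, if_true, bitSign, Bool.toNat_false]
          norm_num
        · simp only [hm, if_false, Bool.toNat_false]
          norm_num
          omega
      · by_cases hm : m = l <;> simp [hm, bitSign]

/-- Any proof of finiteness may occur in the definition of `Nat.nth`. -/
theorem card_toFinset_setOf_mem (t : Finset ℕ) (hf : (Set.ofPred fun m => m ∈ t).Finite) :
    hf.toFinset.card = t.card := by
  congr 1
  ext
  simp

theorem frequencies_mem {t : Finset ℕ} {j : ℕ} (hj : j < t.card) : frequencies t j ∈ t :=
  nth_mem_of_lt_card t hj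

theorem frequencies_lt {t : Finset ℕ} {j l : ℕ} (hjl : j < l) (hl : l < t.card) :
    frequencies t j < frequencies t l :=
  Nat.nth_lt_nth' hjl fun hf => by rwa [card_toFinset_setOf_mem]

theorem frequencies_inj {t : Finset ℕ} {j l : ℕ} (hj : j < t.card) (hl : l < t.card)
    (h : frequencies t j = frequencies t l) : j = l := by
  rcases lt_trichotomy j l with h1 | h1 | h1
  · exact absurd h (frequencies_lt h1 hl).ne
  · exact h1
  · exact absurd h (frequencies_lt h1 hj).ne'

/-- The vectors `h_I^n` as elements of the independent sum. -/
def omegaVec (X : HaarSystemNorm) (r : rademacherFamilies) (τ : ℕ → Finset ℕ) (p : DyadicOmega) :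
    independentSum X r τ :=
  ⟨omegaHaar X r τ p, Submodule.le_topologicalClosure _ (Submodule.subset_span ⟨p, rfl⟩)⟩

section

variable {τ : ℕ → Finset ℕ} (hdisj : Pairwise fun m n => Disjoint (τ m) (τ n))
  (hcard : ∀ n, (τ n).card = n + 1)

include hdisj hcard

theorem frequencies_eq_iff {n m j l : ℕ} (hj : j ≤ n) (hl : l ≤ m) :
    frequencies (τ n) j = frequencies (τ m) l ↔ n = m ∧ j = l := by
  have hj' : j < (τ n).card := by rw [hcard]; omega
  have hl' : l < (τ m).card := by rw [hcard]; omega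
  constructor
  · intro h
    have hnm : n = m := by
      by_contra hne
      exact Finset.disjoint_left.1 (hdisj hne) (frequencies_mem hj') (h ▸ frequencies_mem hl')
    subst hnm
    exact ⟨rfl, frequencies_inj hj' hl' h⟩
  · rintro ⟨rfl, rfl⟩
    rfl

/-- The frequencies of the first `M` blocks can be extended to an injective labelling of all
coordinates of the cube. -/
theorem exists_frequency_labelling (M : ℕ) : ∃ i : Fin M × Fin M → ℕ, Function.Injective i ∧
    (∀ q, (q.2 : ℕ) ≤ q.1 → i q = frequencies (τ q.1) q.2) ∧
    ∀ q, (q.1 : ℕ) < q.2 → ∀ n l : ℕ, n < M → l ≤ n → i q ≠ frequencies (τ n) l := by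
  classical
  -- The coordinates `(n, l)` with `l > n` carry no coefficients, and get labels beyond all
  -- frequencies of the first `M` blocks; `frequencies` has junk values there.
  set L := (Finset.range M).sup fun n => (τ n).sup id + 1 with hL
  have hlt : ∀ n l : ℕ, n < M → l ≤ n → frequencies (τ n) l < L := by
    intro n l hn hl
    have h1 : frequencies (τ n) l ≤ (τ n).sup id :=
      Finset.le_sup (f := id) (frequencies_mem (by rw [hcard]; omega))
    have h2 : (τ n).sup id + 1 ≤ L :=
      Finset.le_sup (f := fun n => (τ n).sup id + 1) (Finset.mem_range.2 hn)
    omega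
  refine ⟨fun q => if (q.2 : ℕ) ≤ q.1 then frequencies (τ q.1) q.2 else L + Nat.pair q.1 q.2,
    fun q q' h => ?_, fun q hq => if_pos hq, fun q hq n l hn hl => ?_⟩
  · dsimp only at h
    split_ifs at h with h1 h2 h2
    · obtain ⟨h3, h4⟩ := (frequencies_eq_iff hdisj hcard h1 h2).1 h
      exact Prod.ext (Fin.ext h3) (Fin.ext h4)
    · have := hlt _ _ q.1.2 h1
      omega
    · have := hlt _ _ q'.1.2 h2
      omega
    · obtain ⟨h3, h4⟩ := Nat.pair_eq_pair.1 (Nat.add_left_cancel h)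
      exact Prod.ext (Fin.ext h3) (Fin.ext h4)
  · dsimp only
    rw [if_neg (not_le.2 hq)]
    have := hlt n l hn hl
    omega

/-- Reading the digits at the frequencies of the blocks as independent coordinates, the faithful
Haar system of the block `n` becomes the Haar system of the row `n` of the cube. -/
theorem norm_linearCombination_omegaHaar {X : HaarSystemNorm} {r : rademacherFamilies}
    {η : Bool → ℝ} (h : IsSignOf r η) (c : DyadicOmega →₀ ℝ) (M : ℕ)
    (hM : ∀ p ∈ c.support, p.1.1 < M) :
    ‖Finsupp.linearCombination ℝ (omegaHaar X r τ) c‖ = cubeHardyNorm X η (treeCoef M c) := by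
  classical
  obtain ⟨i, hi, hi1, hi2⟩ := exists_frequency_labelling hdisj hcard M
  set a : DyadicInterval →₀ ℝ := c.sum fun p v =>
    v • ∑ K ∈ faithfulBlock (frequencies (τ p.1.1)) p.1.2.1 p.1.2.2, Finsupp.single K 1 with ha
  have haK : ∀ K, a K = ∑ p ∈ c.support,
      if K ∈ faithfulBlock (frequencies (τ p.1.1)) p.1.2.1 p.1.2.2 then c p else 0 := by
    intro K
    rw [ha, Finsupp.sum, Finsupp.finsetSum_apply]
    refine Finset.sum_congr rfl fun p _ => ?_
    rw [Finsupp.smul_apply, Finsupp.finsetSum_apply]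
    simp only [Finsupp.single_apply, Finset.sum_ite_eq', smul_eq_mul, mul_ite, mul_one,
      mul_zero]
  have hlevel : ∀ {p : DyadicOmega} {K : DyadicInterval},
      K ∈ faithfulBlock (frequencies (τ p.1.1)) p.1.2.1 p.1.2.2 →
      K.1 = frequencies (τ p.1.1) p.1.2.1 := fun h =>
    mem_level.1 (faithfulBlock_subset_level _ _ _ h)
  rw [← norm_linearCombination_haarVec h hi a]
  · congr 1
    rw [ha, Finsupp.sum, map_sum, Finsupp.linearCombination_apply, Finsupp.sum]
    refine Finset.sum_congr rfl fun p _ => ?_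
    rw [map_smul, map_sum, omegaHaar]
    simp
  · intro K hK
    rw [Finsupp.mem_support_iff, haK] at hK
    obtain ⟨p, hp, hpK⟩ := Finset.exists_ne_zero_of_sum_ne_zero hK
    have hpK' : K ∈ faithfulBlock (frequencies (τ p.1.1)) p.1.2.1 p.1.2.2 := by
      by_contra hne
      exact hpK (if_neg hne)
    have hpM := hM p hp
    have hp2 : p.1.2.1 ≤ p.1.1 := p.2
    exact ⟨(⟨p.1.1, hpM⟩, ⟨p.1.2.1, hp2.trans_lt hpM⟩), (hi1 _ hp2).trans (hlevel hpK').symm⟩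
  · intro x q
    rw [haK]
    rcases le_or_gt (q.2 : ℕ) q.1 with hq | hq
    · -- the interval belongs to the collection of exactly one index of the block
      set I := node (row (fun q' => x (i q')) q.1) q.2 with hI
      have hIq : I.1 = q.2 := node_level _ _
      have hIle : I.1 ≤ q.1 := hIq.le.trans hq
      have hfreq : node (fun l => x (frequencies (τ q.1) l)) q.2 = I := by
        refine node_congr fun l hl => ?_
        have hlM : l < M := hl.trans q.2.2
        rw [row, dif_pos hlM, hi1 (q.1, ⟨l, hlM⟩) (hl.le.trans hq)]
      have hiff : ∀ p : DyadicOmega, node x (i q) ∈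
          faithfulBlock (frequencies (τ p.1.1)) p.1.2.1 p.1.2.2 ↔
          p = DyadicOmega.mk q.1 I hIle := by
        rintro ⟨⟨n, J⟩, hJ⟩
        have hJ' : J.1 ≤ n := hJ
        have hbl : n = q.1 → J.1 = (q.2 : ℕ) → (node x (i q) ∈
            faithfulBlock (frequencies (τ n)) J.1 J.2 ↔ (I.2 : ℕ) = J.2) := by
          rintro rfl hJq
          obtain ⟨l, m⟩ := J
          obtain rfl : l = q.2 := hJq
          rw [hi1 q hq, node_mem_faithfulBlock_iff (n := q.1)
            (fun j hj => frequencies_lt (Nat.lt_succ_self j) (by rw [hcard]; omega)) x hq m.2, hfreq]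
        constructor
        · intro hmem
          have h1 := hlevel (p := ⟨(n, J), hJ⟩) hmem
          rw [node_level, hi1 q hq] at h1
          obtain ⟨h2, h3⟩ := (frequencies_eq_iff hdisj hcard hq hJ').1 h1
          have h4 := (hbl h2.symm h3.symm).1 hmem
          exact DyadicOmega.ext_iff'.2 ⟨h2.symm, ext_nat (h3.symm.trans hIq.symm) h4.symm⟩
        · intro hp
          obtain ⟨h1, h2⟩ := DyadicOmega.ext_iff'.1 hp
          change n = q.1 at h1
          change J = I at h2
          exact (hbl h1 (by rw [h2, hIq])).2 (by rw [h2])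
      simp only [hiff]
      rw [treeCoef, coefAt_of_le c hIle, Finset.sum_ite_eq']
      split_ifs with hmem
      · rfl
      · exact (Finsupp.notMem_support_iff.1 hmem).symm
    · rw [treeCoef, coefAt_of_lt c (by rw [node_level]; exact hq)]
      refine Finset.sum_eq_zero fun p hp => if_neg fun hmem => ?_
      have h1 := hlevel hmem
      rw [node_level] at h1
      exact hi2 q hq _ _ (hM p hp) p.2 h1

/-- The vectors `h_I^n` form a model: their span is dense by definition, and the norm is that of
independent blocks because the sets `τ n` are disjoint. -/
theorem isOmegaModel_omegaVec (X : HaarSystemNorm) {r : rademacherFamilies} {η : Bool → ℝ}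
    (h : IsSignOf r η) : IsOmegaModel X η (omegaVec X r τ) where
  dense := by
    have hval : ∀ c, ((Finsupp.linearCombination ℝ (omegaVec X r τ) c : independentSum X r τ) :
        hardyZero X r) = Finsupp.linearCombination ℝ (omegaHaar X r τ) c := by
      intro c
      change (independentSum X r τ).subtype _ = _
      rw [Finsupp.apply_linearCombination]
      rfl
    intro y
    rw [Metric.mem_closure_iff]
    intro ε hε
    have hy : (y : hardyZero X r) ∈ closure (Submodule.span ℝ (range (omegaHaar X r τ)) :
        Set (hardyZero X r)) := y.2
    obtain ⟨z, hz, hyz⟩ := Metric.mem_closure_iff.1 hy ε hε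
    rw [SetLike.mem_coe, Finsupp.mem_span_range_iff_exists_finsupp] at hz
    obtain ⟨c, rfl⟩ := hz
    refine ⟨_, ⟨c, rfl⟩, ?_⟩
    rw [Subtype.dist_eq, hval]
    exact hyz
  norm_eq c M hM := by
    rw [← norm_linearCombination_omegaHaar hdisj hcard h c M hM]
    change ‖(independentSum X r τ).subtype _‖ = _
    rw [Finsupp.apply_linearCombination]
    rfl
  abs_sign := h.abs_eq_one

end

instance (X : HaarSystemNorm) (r : rademacherFamilies) : CompleteSpace (hardyZero X r) :=
  (Submodule.isClosed_topologicalClosure _).completeSpace_coe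

instance (X : HaarSystemNorm) (r : rademacherFamilies) (τ : ℕ → Finset ℕ) :
    CompleteSpace (independentSum X r τ) :=
  (Submodule.isClosed_topologicalClosure _).completeSpace_coe

end

theorem theorem1p1 (X : HaarSystemNorm) (r : rademacherFamilies)
    (hnull : IsWeaklyNull (rademacherVec X r))
    (τ : ℕ → Finset ℕ) (hdisj : Pairwise fun m n => Disjoint (τ m) (τ n))
    (hcard : ∀ n, (τ n).card = n + 1) :
    HasPrimaryFactorizationProperty (independentSum X r τ) ∧
    (∃ b : GeneralSchauderBasis DyadicOmega ℝ (independentSum X r τ)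
        (SummationFilter.conditional DyadicOmega),
      (∀ p, (b.basis p : hardyZero X r) = omegaHaar X r τ p) ∧ HasFactorizationProperty b) ∧
    IsLargestIdeal (nonFactoringOperators (independentSum X r τ)) := by
  obtain ⟨η, hη⟩ := exists_isSignOf r
  have he := isOmegaModel_omegaVec hdisj hcard X hη
  have hρ : ∀ κ > 0, ∃ m > 0, rademacherNorm X η m ≤ κ * m := fun κ hκ =>
    exists_rademacherNorm_le hη hnull hκ
  have hprim := he.hasPrimaryFactorizationProperty hρ
  have : Nontrivial (independentSum X r τ) := by
    refine ⟨omegaVec X r τ DyadicOmega.bottom, 0, fun h0 => ?_⟩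
    have h1 := (pointNorm_pos X _).trans_eq (he.norm_basis DyadicOmega.bottom).symm
    exact h1.ne' (norm_eq_zero.2 h0)
  exact ⟨hprim, ⟨he.schauderBasis, fun _ => rfl, he.hasFactorizationProperty hρ⟩,
    isLargestIdeal_nonFactoringOperators hprim⟩
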